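/- **Theorem 5.2 (stability of minimizers in the presence of noise).** Let $0<\epsilon<M$, $T,R,\overline c>0$, $\Omega_T=(\epsilon,M)\times(0,T)$, and let $[\cdot]$ be the norm of the real Sobolev space $H^5(\Omega_T)\subset C^3(\overline{\Omega_T})$ (elements are identified with their continuous representatives). Put $B(R)=\{q\in H^5(\Omega_T):[q]<R\}$, $\overline{B(R)}=\{q\in H^5(\Omega_T):[q]\le R\}$, $\underline q=1/(2\overline c^{1/4})$. For functions $g_0,g_1$ let $H(g_0,g_1)$ be the set of all $q\in H^5(\Omega_T)$ with $q(\epsilon,t)=g_0(t+\epsilon)$, $q_x(\epsilon,t)=g_1(t+\epsilon)+g_0'(t+\epsilon)$, $q_x(M,t)=0$ for all $t\in[0,T]$ and $q(x,0)\ge\underline q$ for all $x\in[\epsilon,M]$ (here $g_0'$ is the derivative of $g_0$ on $[\epsilon,T+\epsilon]$). Let $$F(q)=q_{xx}-\frac{q_{xt}}{2q^2(x,0)}+\frac{q_t\,q_x(x,0)}{2q^3(x,0)},\qquad J_{\lambda,\alpha,\beta}(q)=\int_{\Omega_T}e^{-2\lambda(x+\alpha t)}|F(q)|^2\,dx\,dt+\beta[q]^2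 .$$ Let $0<\alpha<1/(2\sqrt{\overline c})$ and $\alpha T>2M$. Then there are numbers $\lambda_1\ge1$ and $C>0$, depending only on $R,T,\epsilon,\overline c,\alpha,M$, and for every $\gamma>0$ there is $\delta_0>0$, depending only on the same parameters and on $\gamma$, with $\delta_0<2R/3$ and $\ln(\delta_0^{-2/(\alpha T)})\ge\lambda_1$, such that the following holds for all $\delta\in(0,\delta_0)$. Let $g_0^*,g_1^*$ (exact data) and $g_0^\delta,g_1^\delta$ (noisy data) be given, $H^*=H(g_0^*,g_1^*)$, $H^\delta=H(g_0^\delta,g_1^\delta)$. Let $q^*\in B(R/3)\cap H^*$ satisfy $F(q^*)=0$ in $\Omega_T$ and $q^*(x,0)\ge\underline q+\gamma$ for all $x\in[\epsilon,M]$. Assume that $\overline{B(R/3)}\cap H^\delta\ne\varnothing$ and that there are $G^*\in H^*$, $G^\delta\in H^\delta$ with $[G^\delta-G^*]<\delta$. Put $\lambda=\ln(\delta^{-2/(\alpha T)})$ and $\beta=2e^{-\lambda\alpha T}$. Then $J_{\lambda,\alpha,\beta}$ has a unique minimizer $q^\delta_{\min}$ on $\overline{B(R)}\cap H^\delta$.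 For every $T_0\in(0,T)$ with $\alpha T>2M+2\alpha T_0$, the numbers $$\rho_1=\frac{\alpha T-2(M+\alpha T_0)}{\alpha T},\qquad \rho_2=\frac{\alpha T-2M}{\alpha T}$$ lie in $(0,1)$, and, with $c^*(x)=\frac1{16(q^*(x,0))^4}$ and $c^\delta_{\min}(x)=\frac1{16(q^\delta_{\min}(x,0))^4}$, $$\|q^*-q^\delta_{\min}\|_{H^1(\Omega_{T_0})}\le C\delta^{\rho_1},\qquad \|q^*(\cdot,0)-q^\delta_{\min}(\cdot,0)\|_{H^1(\epsilon,M)}\le C\delta^{\rho_2},\qquad \|c^*-c^\delta_{\min}\|_{H^1(\epsilon,M)}\le C\delta^{\rho_2}.$$ -/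

import Mathlib

open Set MeasureTheory
open scoped ContDiff

noncomputable section

/-! ### Weak derivatives and Sobolev spaces -/

/-- Directional derivative `∂_v φ`. -/
def dirDeriv {E : Type*} [NormedAddCommGroup E] [NormedSpace ℝ E] (v : E) (φ : E → ℝ) : E → ℝ :=
  fun p => fderiv ℝ φ p v

/-- Smooth functions with compact support contained in `Ω`. -/
def IsTestFunction {E : Type*} [NormedAddCommGroup E] [NormedSpace ℝ E]
    (Ω : Set E) (φ : E → ℝ) : Prop :=
  ContDiff ℝ ∞ φ ∧ HasCompactSupport φ ∧ tsupport φ ⊆ Ω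

/-- `g` is the weak derivative `∂_{v₁} ⋯ ∂_{vₙ} f` in `Ω`, where `l = [v₁, …, vₙ]`. -/
def IsWeakDeriv {E : Type*} [NormedAddCommGroup E] [NormedSpace ℝ E] [MeasureSpace E]
    (Ω : Set E) (l : List E) (f g : E → ℝ) : Prop :=
  LocallyIntegrableOn f Ω ∧ LocallyIntegrableOn g Ω ∧
    ∀ φ : E → ℝ, IsTestFunction Ω φ →
      ∫ p in Ω, f p * l.foldr dirDeriv φ p = (-1 : ℝ) ^ l.length * ∫ p in Ω, g p * φ p

open Classical in
/-- A representative of the weak derivative (it is unique almost everywhere in an open `Ω`);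
zero if there is none. -/
def weakDeriv {E : Type*} [NormedAddCommGroup E] [NormedSpace ℝ E] [MeasureSpace E]
    (Ω : Set E) (l : List E) (f : E → ℝ) : E → ℝ :=
  if h : ∃ g, IsWeakDeriv Ω l f g then h.choose else 0

open Classical in
/-- The representative of `f` that is continuous up to the boundary of `Ω`. Its values on
`closure Ω` are unique for an open `Ω`; it is zero if there is none. -/
def contRep {E : Type*} [TopologicalSpace E] [MeasureSpace E]
    (Ω : Set E) (f : E → ℝ) : E → ℝ :=
  if h : ∃ g : E → ℝ, ContinuousOn g (closure Ω) ∧ f =ᵐ[volume.restrict Ω] g then h.choose else 0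

/-- The directions of `∂_x^i ∂_t^j` for functions of `(x, t)`. -/
def dirs (i j : ℕ) : List (ℝ × ℝ) :=
  List.replicate i ((1, 0) : ℝ × ℝ) ++ List.replicate j ((0, 1) : ℝ × ℝ)

/-- The multi-indices `(i, j)` with `i + j ≤ k`. -/
def multiIndices (k : ℕ) : Finset (ℕ × ℕ) :=
  (Finset.range (k + 1) ×ˢ Finset.range (k + 1)).filter fun a => a.1 + a.2 ≤ k

/-- `f ∈ H^k(Ω)`, for `Ω` in the `(x, t)`-plane. -/
def MemH (k : ℕ) (Ω : Set (ℝ × ℝ)) (f : ℝ × ℝ → ℝ) : Prop :=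
  ∀ a ∈ multiIndices k, ∃ g : ℝ × ℝ → ℝ,
    MemLp g 2 (volume.restrict Ω) ∧ IsWeakDeriv Ω (dirs a.1 a.2) f g

/-- The norm of `H^k(Ω)`, for `Ω` in the `(x, t)`-plane. -/
def normH (k : ℕ) (Ω : Set (ℝ × ℝ)) (f : ℝ × ℝ → ℝ) : ℝ :=
  √(∑ a ∈ multiIndices k, ∫ p in Ω, (weakDeriv Ω (dirs a.1 a.2) f p) ^ 2)

/-- `f ∈ H^k(I)`, for `I` in the real line. -/
def MemH1D (k : ℕ) (I : Set ℝ) (f : ℝ → ℝ) : Prop :=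
  ∀ i ∈ Finset.range (k + 1), ∃ g : ℝ → ℝ,
    MemLp g 2 (volume.restrict I) ∧ IsWeakDeriv I (List.replicate i (1 : ℝ)) f g

/-- The norm of `H^k(I)`, for `I` in the real line. -/
def normH1D (k : ℕ) (I : Set ℝ) (f : ℝ → ℝ) : ℝ :=
  √(∑ i ∈ Finset.range (k + 1), ∫ x in I, (weakDeriv I (List.replicate i (1 : ℝ)) f x) ^ 2)

/-! ### The functional and the admissible sets -/

/-- `Ω_T = (ε, M) × (0, T)`. -/
def OmegaT (ε M T : ℝ) : Set (ℝ × ℝ) := Ioo ε M ×ˢ Ioo 0 T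

/-- `q(x, t)` for all `(x, t)` in the closure of `Ω_T`. -/
def val (ε M T : ℝ) (q : ℝ × ℝ → ℝ) (x t : ℝ) : ℝ := contRep (OmegaT ε M T) q (x, t)

/-- `q_x(x, t)` for all `(x, t)` in the closure of `Ω_T`. -/
def valX (ε M T : ℝ) (q : ℝ × ℝ → ℝ) (x t : ℝ) : ℝ :=
  contRep (OmegaT ε M T) (weakDeriv (OmegaT ε M T) (dirs 1 0) q) (x, t)

/-- `F(q) = q_xx - q_xt / (2 q²(x,0)) + q_t q_x(x,0) / (2 q³(x,0))`. -/
def opF (ε M T : ℝ) (q : ℝ × ℝ → ℝ) (p : ℝ × ℝ) : ℝ :=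
  weakDeriv (OmegaT ε M T) (dirs 2 0) q p
    - weakDeriv (OmegaT ε M T) (dirs 1 1) q p / (2 * val ε M T q p.1 0 ^ 2)
    + weakDeriv (OmegaT ε M T) (dirs 0 1) q p * valX ε M T q p.1 0 / (2 * val ε M T q p.1 0 ^ 3)

/-- The weighted Tikhonov-like functional `J_{λ,α,β}`. -/
def funJ (ε M T lam α β : ℝ) (q : ℝ × ℝ → ℝ) : ℝ :=
  (∫ p in OmegaT ε M T, Real.exp (-2 * lam * (p.1 + α * p.2)) * |opF ε M T q p| ^ 2)
    + β * normH 5 (OmegaT ε M T) q ^ 2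

/-- `1 / (2 c̄^{1/4})`, the lower bound of `q(x, 0)`. -/
def qLower (cbar : ℝ) : ℝ := 1 / (2 * cbar ^ (1 / 4 : ℝ))

/-- The set of admissible functions for the boundary data `g₀, g₁`. Only the values of `g₀` on
`[ε, T + ε]` enter, and its derivative is one-sided at the end points. -/
def admissible (ε M T cbar : ℝ) (g₀ g₁ : ℝ → ℝ) : Set (ℝ × ℝ → ℝ) :=
  {q | MemH 5 (OmegaT ε M T) q ∧
    (∀ t ∈ Icc 0 T, val ε M T q ε t = g₀ (t + ε)) ∧
    (∀ t ∈ Icc 0 T,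
      valX ε M T q ε t = g₁ (t + ε) + derivWithin g₀ (Icc ε (T + ε)) (t + ε)) ∧
    (∀ t ∈ Icc 0 T, valX ε M T q M t = 0) ∧
    (∀ x ∈ Icc ε M, qLower cbar ≤ val ε M T q x 0)}

/-- `B(R)`, the open ball of `H⁵(Ω_T)`. -/
def openB (ε M T R : ℝ) : Set (ℝ × ℝ → ℝ) :=
  {q | MemH 5 (OmegaT ε M T) q ∧ normH 5 (OmegaT ε M T) q < R}

/-- The closed ball of `H⁵(Ω_T)`. -/
def closedB (ε M T R : ℝ) : Set (ℝ × ℝ → ℝ) :=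
  {q | MemH 5 (OmegaT ε M T) q ∧ normH 5 (OmegaT ε M T) q ≤ R}

/-- `q` minimizes `J` on `S`. -/
def IsMinimizer (J : (ℝ × ℝ → ℝ) → ℝ) (S : Set (ℝ × ℝ → ℝ)) (q : ℝ × ℝ → ℝ) : Prop :=
  q ∈ S ∧ IsMinOn J S q

/-- The coefficient `c(x) = 1 / (16 q⁴(x, 0))`. -/
def coeff (ε M T : ℝ) (q : ℝ × ℝ → ℝ) (x : ℝ) : ℝ := 1 / (16 * val ε M T q x 0 ^ 4)

end

/-! ### Weak derivatives -/

section WeakDeriv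

variable {E : Type*} [NormedAddCommGroup E] [NormedSpace ℝ E]

/-! For large λ the functional J is strongly convex on the admissible functions of a ball, and
existence, uniqueness and stability all follow from that. The convexity is used at midpoints, so J
is never differentiated. For q, q' with the same boundary data put m = (q + q')/2 and h = (q -
q')/2. Then (`funJ_midpoint_convex`) J(m + h) + J(m - h) - 2 J(m) ≥ c₀ W(h) + β [h]², where W(h) is
the weighted H¹ energy of h in Ω_T plus that of its trace at t = 0.

To prove it, split F(m ± h) into its parts even and odd in h. With a(x) the mean of 1/(2q²) over the
two traces, the second difference of F² is at least (h_xx - a h_xt)² - 4 F(m) d(x) h_xt minus a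
quadratic form in h(x,0), h_x(x,0), h_t, where d = O(h(x,0)) (`second_difference_bound`).

The square is bounded below by a Carleman estimate. The function v = h_x solves a transport equation
v_x - a v_t = f and vanishes at x = ε and x = M. The weight exp(-2λ(x + αt)) decreases along (1, -a)
because αa < 1, which is the bound on α. This gives λ² on v, and λ on its trace at t = 0
(`carleman_transport`). Then h_t is recovered from h_x - a h_t, whose x-derivative is f - a' h_t and
which vanishes at x = ε (`carleman_estimate`).

The term with h_xt is not controlled by the estimate. Since d depends on x only, an integration by
parts in t moves the derivative onto F(m) and the weight (`integral_carlemanWeight_mixed_le`). This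
uses third derivatives of m, available from H⁵ ⊂ C³ (`exists_isC3Rep`). Every error is then absorbed
by large λ, except the boundary term at t = T. That one is of size λ exp(-2λαT) and is absorbed by β
[h]², because β = 2 exp(-λαT).

A minimizing sequence is Cauchy in H⁵ by the convexity, so a minimizer exists
(`exists_isMinimizer_funJ`).

For stability, the shifted function p = q* + G^δ - G* carries the noisy data, and the margin γ keeps
its trace above the lower bound (`shift_mem`). Since F(q*) = 0, F is Lipschitz and β = 2δ², one gets
J(p) = O(δ²) (`funJ_add_le`). Convexity between p and the minimizer gives W((p - q_min)/2) = O(δ²).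
Dividing by the least value of the weight on Ω_{T₀}, or at t = 0, produces the exponents ρ₁ and ρ₂.
-/

theorem IsTestFunction.dirDeriv {Ω : Set E} {φ : E → ℝ} (hφ : IsTestFunction Ω φ) (v : E) :
    IsTestFunction Ω (dirDeriv v φ) := by
  refine ⟨?_, ?_, ?_⟩
  · exact (hφ.1.fderiv_right (m := ∞) (by simp)).clm_apply contDiff_const
  · exact hφ.2.1.fderiv_apply (𝕜 := ℝ) v
  · exact (tsupport_fderiv_apply_subset ℝ v).trans hφ.2.2

theorem IsTestFunction.foldr_dirDeriv {Ω : Set E} {φ : E → ℝ} (hφ : IsTestFunction Ω φ)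
    (l : List E) : IsTestFunction Ω (l.foldr _root_.dirDeriv φ) := by
  induction l with
  | nil => exact hφ
  | cons v l ih => exact ih.dirDeriv v

theorem IsTestFunction.mono {Ω Ω' : Set E} {φ : E → ℝ} (hφ : IsTestFunction Ω' φ) (h : Ω' ⊆ Ω) :
    IsTestFunction Ω φ :=
  ⟨hφ.1, hφ.2.1, hφ.2.2.trans h⟩

theorem IsTestFunction.eq_zero_of_notMem {Ω : Set E} {φ : E → ℝ} (hφ : IsTestFunction Ω φ)
    {p : E} (hp : p ∉ Ω) : φ p = 0 :=
  image_eq_zero_of_notMem_tsupport fun h => hp (hφ.2.2 h)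

theorem dirDeriv_comm {φ : E → ℝ} (hφ : ContDiff ℝ ∞ φ) (v w : E) :
    dirDeriv v (dirDeriv w φ) = dirDeriv w (dirDeriv v φ) := by
  ext p
  have hd : DifferentiableAt ℝ (fderiv ℝ φ) p :=
    ((hφ.fderiv_right (m := ∞) (by simp)).differentiable (by simp)) p
  have hs : IsSymmSndFDerivAt ℝ φ p :=
    hφ.contDiffAt.isSymmSndFDerivAt
      (by simpa using WithTop.coe_le_coe.2 (le_top (a := (2 : ℕ∞))))
  have key : ∀ a b : E, dirDeriv a (dirDeriv b φ) p = fderiv ℝ (fderiv ℝ φ) p a b := by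
    intro a b
    have : HasFDerivAt (fun q => fderiv ℝ φ q b)
        ((fderiv ℝ (fderiv ℝ φ) p).flip b) p := by
      have := hd.hasFDerivAt.clm_apply (hasFDerivAt_const b p)
      simpa using this
    change fderiv ℝ (fun q => fderiv ℝ φ q b) p a = _
    rw [this.fderiv]
    rfl
  rw [key, key]
  exact hs v w

theorem foldr_dirDeriv_comm {Ω : Set E} {φ : E → ℝ} (hφ : IsTestFunction Ω φ) (v : E)
    (l : List E) :
    l.foldr dirDeriv (dirDeriv v φ) = dirDeriv v (l.foldr dirDeriv φ) := by
  induction l with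
  | nil => rfl
  | cons w l ih =>
    simp only [List.foldr_cons, ih]
    exact dirDeriv_comm (hφ.foldr_dirDeriv l).1 w v

variable [MeasureSpace E]

theorem setIntegral_mul_test {Ω : Set E} {φ : E → ℝ} (f : E → ℝ) (hφ : IsTestFunction Ω φ) :
    ∫ p in Ω, f p * φ p = ∫ p, f p * φ p :=
  setIntegral_eq_integral_of_forall_compl_eq_zero fun p hp => by
    rw [hφ.eq_zero_of_notMem hp, mul_zero]

theorem IsWeakDeriv.congr {Ω : Set E} {l : List E} {f f' g g' : E → ℝ}
    (h : IsWeakDeriv Ω l f g) (hf : f =ᵐ[volume.restrict Ω] f')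
    (hg : g =ᵐ[volume.restrict Ω] g') : IsWeakDeriv Ω l f' g' := by
  have aux : ∀ {u u' : E → ℝ}, LocallyIntegrableOn u Ω → u =ᵐ[volume.restrict Ω] u' →
      LocallyIntegrableOn u' Ω := by
    intro u u' hu he x hx
    obtain ⟨s, hs, hi⟩ := hu x hx
    refine ⟨s ∩ Ω, Filter.inter_mem hs self_mem_nhdsWithin, ?_⟩
    exact (hi.mono_set inter_subset_left).congr_fun_ae (ae_mono
      (Measure.restrict_mono inter_subset_right le_rfl) he)
  refine ⟨aux h.1 hf, aux h.2.1 hg, fun φ hφ => ?_⟩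
  have e1 : ∫ p in Ω, f p * l.foldr dirDeriv φ p = ∫ p in Ω, f' p * l.foldr dirDeriv φ p :=
    integral_congr_ae (hf.mul (ae_eq_refl _))
  have e2 : ∫ p in Ω, g p * φ p = ∫ p in Ω, g' p * φ p :=
    integral_congr_ae (hg.mul (ae_eq_refl _))
  rw [← e1, ← e2]
  exact h.2.2 φ hφ

theorem IsWeakDeriv.const_smul {Ω : Set E} {l : List E} {f g : E → ℝ}
    (h : IsWeakDeriv Ω l f g) (c : ℝ) : IsWeakDeriv Ω l (c • f) (c • g) := by
  refine ⟨fun x hx => ?_, fun x hx => ?_, fun φ hφ => ?_⟩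
  · obtain ⟨s, hs, hi⟩ := h.1 x hx
    exact ⟨s, hs, hi.smul c⟩
  · obtain ⟨s, hs, hi⟩ := h.2.1 x hx
    exact ⟨s, hs, hi.smul c⟩
  simp only [Pi.smul_apply, smul_eq_mul, mul_assoc, integral_const_mul]
  rw [h.2.2 φ hφ]
  ring

theorem IsWeakDeriv.mono {Ω Ω' : Set E} {l : List E} {f g : E → ℝ}
    (h : IsWeakDeriv Ω l f g) (hs : Ω' ⊆ Ω) : IsWeakDeriv Ω' l f g := by
  refine ⟨h.1.mono_set hs, h.2.1.mono_set hs, fun φ hφ => ?_⟩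
  have hφ' := hφ.mono hs
  rw [setIntegral_mul_test _ (hφ.foldr_dirDeriv l), setIntegral_mul_test _ hφ,
    ← setIntegral_mul_test _ (hφ'.foldr_dirDeriv l), ← setIntegral_mul_test _ hφ']
  exact h.2.2 φ hφ'

/-- Insert the test function ∂_v φ into the identity for `l`; second derivatives commute, so `v`
moves to the front. This makes the weak derivatives of q weak derivatives of one another, so that
each can be embedded separately. -/
theorem IsWeakDeriv.cons {Ω : Set E} {l : List E} {v : E} {f g g' : E → ℝ}
    (h : IsWeakDeriv Ω l f g) (h' : IsWeakDeriv Ω (v :: l) f g') : IsWeakDeriv Ω [v] g g' := by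
  refine ⟨h.2.1, h'.2.1, fun φ hφ => ?_⟩
  have h1 := h.2.2 _ (hφ.dirDeriv v)
  have h2 := h'.2.2 φ hφ
  rw [foldr_dirDeriv_comm hφ] at h1
  simp only [List.foldr_cons, List.length_cons] at h2
  simp only [List.foldr_cons, List.foldr_nil, List.length_cons, List.length_nil]
  rw [h1] at h2
  have hne : ((-1 : ℝ) ^ l.length) ≠ 0 := pow_ne_zero _ (by norm_num)
  apply mul_left_cancel₀ hne
  rw [h2]
  ring

theorem IsWeakDeriv.isWeakDeriv_weakDeriv {Ω : Set E} {l : List E} {f g : E → ℝ}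
    (h : IsWeakDeriv Ω l f g) : IsWeakDeriv Ω l f (weakDeriv Ω l f) := by
  have hex : ∃ g, IsWeakDeriv Ω l f g := ⟨g, h⟩
  rw [weakDeriv, dif_pos hex]
  exact hex.choose_spec

/-- In `dirs i (j + 1)` the additional t-direction stands behind the x-directions, whereas
`IsWeakDeriv.cons` peels off the head of the list. -/
theorem isWeakDeriv_append_cons {Ω : Set E} {l₁ l₂ : List E} {v : E} {f g : E → ℝ} :
    IsWeakDeriv Ω (l₁ ++ v :: l₂) f g ↔ IsWeakDeriv Ω (v :: (l₁ ++ l₂)) f g := by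
  refine and_congr_right fun _ => and_congr_right fun _ => forall₂_congr fun φ hφ => ?_
  rw [List.foldr_append, List.foldr_cons, foldr_dirDeriv_comm (hφ.foldr_dirDeriv l₂),
    List.foldr_cons, List.foldr_append]
  simp [List.length_append, add_assoc]

variable [BorelSpace E]

theorem integrable_mul_test {Ω : Set E} {f φ : E → ℝ} (hf : LocallyIntegrableOn f Ω)
    (hφ : IsTestFunction Ω φ) : Integrable (fun p => f p * φ p) := by
  have h1 : IntegrableOn f (tsupport φ) := hf.integrableOn_compact_subset hφ.2.2 hφ.2.1
  have h2 : IntegrableOn (fun p => f p * φ p) (tsupport φ) :=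
    h1.mul_continuousOn hφ.1.continuous.continuousOn hφ.2.1
  refine (integrableOn_iff_integrable_of_support_subset ?_).1 h2
  intro p hp
  exact subset_tsupport _ fun h => hp (by simp [h])

theorem IsWeakDeriv.add {Ω : Set E} {l : List E} {f f' g g' : E → ℝ}
    (h : IsWeakDeriv Ω l f g) (h' : IsWeakDeriv Ω l f' g') :
    IsWeakDeriv Ω l (f + f') (g + g') := by
  refine ⟨h.1.add h'.1, h.2.1.add h'.2.1, fun φ hφ => ?_⟩
  have hl := hφ.foldr_dirDeriv l
  simp only [Pi.add_apply, add_mul]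
  rw [integral_add (integrable_mul_test h.1 hl).integrableOn
    (integrable_mul_test h'.1 hl).integrableOn,
    integral_add (integrable_mul_test h.2.1 hφ).integrableOn
    (integrable_mul_test h'.2.1 hφ).integrableOn, h.2.2 φ hφ, h'.2.2 φ hφ, mul_add]

variable [FiniteDimensional ℝ E]

theorem IsWeakDeriv.unique {Ω : Set E} (hΩ : IsOpen Ω) {l : List E} {f g g' : E → ℝ}
    (h : IsWeakDeriv Ω l f g) (h' : IsWeakDeriv Ω l f g') : g =ᵐ[volume.restrict Ω] g' := by
  have := hΩ.ae_eq_zero_of_integral_contDiff_smul_eq_zero (μ := volume) (f := g - g')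
    (h.2.1.sub h'.2.1) fun φ h1 h2 h3 => by
      have hφ : IsTestFunction Ω φ := ⟨h1, h2, h3⟩
      have e1 := h.2.2 φ hφ
      rw [h'.2.2 φ hφ] at e1
      have hne : ((-1 : ℝ) ^ l.length) ≠ 0 := pow_ne_zero _ (by norm_num)
      have e2 := mul_left_cancel₀ hne e1
      rw [setIntegral_mul_test _ hφ, setIntegral_mul_test _ hφ] at e2
      simp only [smul_eq_mul, Pi.sub_apply, mul_sub]
      rw [integral_sub (by simpa [mul_comm] using integrable_mul_test h.2.1 hφ)
        (by simpa [mul_comm] using integrable_mul_test h'.2.1 hφ)]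
      simp only [mul_comm (φ _)]
      rw [e2, sub_self]
  rw [Filter.EventuallyEq, ae_restrict_iff' hΩ.measurableSet]
  filter_upwards [this] with x hx hxΩ
  exact sub_eq_zero.1 (hx hxΩ)

theorem IsWeakDeriv.weakDeriv_ae_eq {Ω : Set E} (hΩ : IsOpen Ω) {l : List E} {f g : E → ℝ}
    (h : IsWeakDeriv Ω l f g) : weakDeriv Ω l f =ᵐ[volume.restrict Ω] g := by
  have hex : ∃ g, IsWeakDeriv Ω l f g := ⟨g, h⟩
  rw [weakDeriv, dif_pos hex]
  exact hex.choose_spec.unique hΩ h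

theorem ae_eq_of_isWeakDeriv_nil {Ω : Set E} (hΩ : IsOpen Ω) {f g : E → ℝ}
    (h : IsWeakDeriv Ω [] f g) : f =ᵐ[volume.restrict Ω] g :=
  IsWeakDeriv.unique hΩ (⟨h.1, h.1, fun φ _ => by simp⟩ : IsWeakDeriv Ω [] f f) h

end WeakDeriv

/-! ### Test functions on intervals and rectangles -/

theorem exists_isTestFunction_integral_eq_one {a b : ℝ} (hab : a < b) :
    ∃ η : ℝ → ℝ, IsTestFunction (Ioo a b) η ∧ ∫ x in a..b, η x = 1 := by
  let f : ContDiffBump ((a + b) / 2) := ⟨(b - a) / 8, (b - a) / 4, by linarith, by linarith⟩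
  have hsub : tsupport (f.normed volume) ⊆ Ioo a b := by
    rw [f.tsupport_normed_eq, Real.closedBall_eq_Icc]
    intro x hx
    simp only [f, mem_Icc] at hx
    constructor <;> linarith [hx.1, hx.2]
  refine ⟨f.normed volume, ⟨f.contDiff_normed, f.hasCompactSupport_normed, hsub⟩, ?_⟩
  rw [intervalIntegral.integral_of_le hab.le,
    setIntegral_eq_integral_of_forall_compl_eq_zero, f.integral_normed]
  intro x hx
  exact image_eq_zero_of_notMem_tsupport fun h => hx (Ioo_subset_Ioc_self (hsub h))

theorem exists_Icc_of_isCompact_subset_Ioo {a b : ℝ} (hab : a < b) {K : Set ℝ} (hK : IsCompact K)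
    (h : K ⊆ Ioo a b) : ∃ a' b', a < a' ∧ b' < b ∧ K ⊆ Icc a' b' := by
  rcases K.eq_empty_or_nonempty with rfl | hne
  -- The end points are interchanged on purpose: `Icc b a` is empty.
  · exact ⟨b, a, hab, hab, by simp⟩
  · obtain ⟨u, hu⟩ := hK.exists_isLeast hne
    obtain ⟨v, hv⟩ := hK.exists_isGreatest hne
    exact ⟨u, v, (h hu.1).1, (h hv.1).2, fun x hx => ⟨hu.2 hx, hv.2 hx⟩⟩

theorem hasDerivAt_primitive {ψ : ℝ → ℝ} (hψ : Continuous ψ) (a s : ℝ) :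
    HasDerivAt (fun s => ∫ x in a..s, ψ x) (ψ s) s :=
  intervalIntegral.integral_hasDerivAt_right (hψ.intervalIntegrable _ _)
    (hψ.stronglyMeasurableAtFilter _ _) hψ.continuousAt

/-- A primitive of a test function with vanishing integral is a test function. -/
theorem IsTestFunction.primitive {a b : ℝ} (hab : a < b) {ψ : ℝ → ℝ}
    (hψ : IsTestFunction (Ioo a b) ψ) (h0 : ∫ x in a..b, ψ x = 0) :
    IsTestFunction (Ioo a b) (fun s => ∫ x in a..s, ψ x) := by
  obtain ⟨a', b', ha', hb', hK⟩ := exists_Icc_of_isCompact_subset_Ioo hab hψ.2.1 hψ.2.2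
  have hc := hψ.1.continuous
  have hz : ∀ x, x ∉ Icc a' b' → ψ x = 0 := fun x hx =>
    image_eq_zero_of_notMem_tsupport fun h => hx (hK h)
  -- Left of the support the integrand vanishes on the whole range; right of it the integral already
  -- equals the total one, which is zero.
  have hsupp : ∀ s, s ∉ Icc a' b' → ∫ x in a..s, ψ x = 0 := by
    intro s hs
    rw [mem_Icc, not_and_or, not_le, not_le] at hs
    rcases hs with hs | hs
    · rw [intervalIntegral.integral_congr (g := fun _ => 0)]
      · simp
      · intro x hx
        refine hz x fun h => ?_
        have := (uIcc_subset_Icc (a₂ := min a s) (b₂ := max a s) ⟨min_le_left _ _, le_max_left _ _⟩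
          ⟨min_le_right _ _, le_max_right _ _⟩ hx).2
        rcases le_max_iff.1 this with h' | h' <;> linarith [h.1]
    · rw [← intervalIntegral.integral_add_adjacent_intervals (hc.intervalIntegrable a b)
        (hc.intervalIntegrable b s), h0, zero_add, intervalIntegral.integral_congr (g := fun _ => 0)]
      · simp
      · intro x hx
        refine hz x fun h => ?_
        have := (uIcc_subset_Icc (a₂ := min b s) (b₂ := max b s) ⟨min_le_left _ _, le_max_left _ _⟩
          ⟨min_le_right _ _, le_max_right _ _⟩ hx).1
        rcases min_le_iff.1 this with h' | h' <;> linarith [h.2]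
  have hts : tsupport (fun s => ∫ x in a..s, ψ x) ⊆ Icc a' b' :=
    closure_minimal (fun s hs => by_contra fun h => hs (hsupp s h)) isClosed_Icc
  refine ⟨?_, ?_, ?_⟩
  · rw [contDiff_infty_iff_deriv]
    refine ⟨fun s => (hasDerivAt_primitive hc a s).differentiableAt, ?_⟩
    rw [show deriv (fun s => ∫ x in a..s, ψ x) = ψ from
      funext fun s => (hasDerivAt_primitive hc a s).deriv]
    exact hψ.1
  · exact isCompact_Icc.of_isClosed_subset (isClosed_tsupport _) hts
  · exact hts.trans fun x hx => ⟨ha'.trans_le hx.1, hx.2.trans_lt hb'⟩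

theorem IsTestFunction.sub {E : Type*} [NormedAddCommGroup E] [NormedSpace ℝ E] {Ω : Set E}
    {φ ψ : E → ℝ} (hφ : IsTestFunction Ω φ) (hψ : IsTestFunction Ω ψ) :
    IsTestFunction Ω (φ - ψ) :=
  ⟨hφ.1.sub hψ.1, hφ.2.1.sub hψ.2.1, (tsupport_sub φ ψ).trans (union_subset hφ.2.2 hψ.2.2)⟩

theorem IsTestFunction.const_smul {E : Type*} [NormedAddCommGroup E] [NormedSpace ℝ E] {Ω : Set E}
    {φ : E → ℝ} (hφ : IsTestFunction Ω φ) (c : ℝ) : IsTestFunction Ω (c • φ) :=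
  ⟨hφ.1.const_smul c, hφ.2.1.smul_left (f := fun _ => c),
    (tsupport_smul_subset_right (fun _ => c) φ).trans hφ.2.2⟩

theorem IsTestFunction.prod_mul {I J : Set ℝ} {φ ψ : ℝ → ℝ} (hφ : IsTestFunction I φ)
    (hψ : IsTestFunction J ψ) : IsTestFunction (I ×ˢ J) (fun p : ℝ × ℝ => φ p.1 * ψ p.2) := by
  have hts : tsupport (fun p : ℝ × ℝ => φ p.1 * ψ p.2) ⊆ tsupport φ ×ˢ tsupport ψ := by
    refine closure_minimal (fun p hp => ?_) ((isClosed_tsupport _).prod (isClosed_tsupport _))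
    have := mul_ne_zero_iff.1 hp
    exact ⟨subset_tsupport _ this.1, subset_tsupport _ this.2⟩
  exact ⟨(hφ.1.comp contDiff_fst).mul (hψ.1.comp contDiff_snd),
    (hφ.2.1.prod hψ.2.1).of_isClosed_subset (isClosed_tsupport _) hts,
    hts.trans (prod_mono hφ.2.2 hψ.2.2)⟩

theorem dirDeriv_fst_prod_mul {φ ψ : ℝ → ℝ} (hφ : ContDiff ℝ ∞ φ) (hψ : ContDiff ℝ ∞ ψ)
    (p : ℝ × ℝ) :
    dirDeriv ((1, 0) : ℝ × ℝ) (fun p : ℝ × ℝ => φ p.1 * ψ p.2) p = deriv φ p.1 * ψ p.2 := by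
  have h1 : HasFDerivAt (fun p : ℝ × ℝ => φ p.1) _ p :=
    (hφ.differentiable (by simp) p.1).hasDerivAt.comp_hasFDerivAt p (hasFDerivAt_fst (𝕜 := ℝ) (p := p))
  have h2 : HasFDerivAt (fun p : ℝ × ℝ => ψ p.2) _ p :=
    (hψ.differentiable (by simp) p.2).hasDerivAt.comp_hasFDerivAt p (hasFDerivAt_snd (𝕜 := ℝ) (p := p))
  have h3 : HasFDerivAt (fun p : ℝ × ℝ => φ p.1 * ψ p.2) _ p := h1.mul h2
  rw [dirDeriv, h3.fderiv]
  simp [mul_comm]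

theorem dirDeriv_snd_prod_mul {φ ψ : ℝ → ℝ} (hφ : ContDiff ℝ ∞ φ) (hψ : ContDiff ℝ ∞ ψ)
    (p : ℝ × ℝ) :
    dirDeriv ((0, 1) : ℝ × ℝ) (fun p : ℝ × ℝ => φ p.1 * ψ p.2) p = φ p.1 * deriv ψ p.2 := by
  have h1 : HasFDerivAt (fun p : ℝ × ℝ => φ p.1) _ p :=
    (hφ.differentiable (by simp) p.1).hasDerivAt.comp_hasFDerivAt p (hasFDerivAt_fst (𝕜 := ℝ) (p := p))
  have h2 : HasFDerivAt (fun p : ℝ × ℝ => ψ p.2) _ p :=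
    (hψ.differentiable (by simp) p.2).hasDerivAt.comp_hasFDerivAt p (hasFDerivAt_snd (𝕜 := ℝ) (p := p))
  have h3 : HasFDerivAt (fun p : ℝ × ℝ => φ p.1 * ψ p.2) _ p := h1.mul h2
  rw [dirDeriv, h3.fderiv]
  simp

/-- Rectangles form a π-system that generates the product σ-algebra, and the whole space is a
rectangle, which handles complements. -/
theorem ae_eq_zero_of_forall_setIntegral_prod_eq_zero {α β : Type*} [MeasurableSpace α]
    [MeasurableSpace β] {ρ : Measure (α × β)} {f : α × β → ℝ} (hf : Integrable f ρ)
    (h : ∀ s t, MeasurableSet s → MeasurableSet t → ∫ p in s ×ˢ t, f p ∂ρ = 0) :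
    f =ᵐ[ρ] 0 := by
  suffices H : ∀ s, MeasurableSet s → ∫ p in s, f p ∂ρ = 0 from
    hf.ae_eq_zero_of_forall_setIntegral_eq_zero fun s hs _ => H s hs
  intro s hs
  induction s, hs using MeasurableSpace.induction_on_inter generateFrom_prod.symm
    isPiSystem_prod with
  | empty => simp
  | basic u hu =>
    obtain ⟨s, hs, t, ht, rfl⟩ := hu
    exact h s t hs ht
  | compl u hu ih =>
    have h1 := integral_add_compl hu hf
    have h2 := h univ univ .univ .univ
    rw [univ_prod_univ, setIntegral_univ] at h2
    rw [h2] at h1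
    linarith
  | iUnion u hd hu ih =>
    rw [integral_iUnion hu hd hf.integrableOn]
    simp [ih]

/-! ### Continuous representatives on rectangles -/

theorem volume_restrict_prod (I J : Set ℝ) :
    (volume : Measure (ℝ × ℝ)).restrict (I ×ˢ J) = (volume.restrict I).prod (volume.restrict J) := by
  rw [Measure.volume_eq_prod, Measure.prod_restrict]

theorem IsTestFunction.exists_bound {E : Type*} [NormedAddCommGroup E] [NormedSpace ℝ E]
    {Ω : Set E} {φ : E → ℝ} (hφ : IsTestFunction Ω φ) : ∃ C, ∀ x, ‖φ x‖ ≤ C :=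
  hφ.2.1.exists_bound_of_continuous hφ.1.continuous

theorem ae_eq_zero_of_forall_test {I : Set ℝ} (hI : IsOpen I) {g : ℝ → ℝ} (hg : IntegrableOn g I)
    (h : ∀ φ, IsTestFunction I φ → ∫ x in I, g x * φ x = 0) : g =ᵐ[volume.restrict I] 0 := by
  have := hI.ae_eq_zero_of_integral_contDiff_smul_eq_zero (μ := volume) (f := g)
    hg.locallyIntegrableOn fun φ h1 h2 h3 => by
      have hφ : IsTestFunction I φ := ⟨h1, h2, h3⟩
      simp only [smul_eq_mul, mul_comm (φ _)]
      rw [← setIntegral_mul_test _ hφ, h φ hφ]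
  rw [Filter.EventuallyEq, ae_restrict_iff' hI.measurableSet]
  exact this

/-- Products of one-dimensional test functions separate integrable functions on `I × J`. -/
theorem ae_eq_zero_of_forall_test_prod {I J : Set ℝ} (hI : IsOpen I) (hJ : IsOpen J)
    {f : ℝ × ℝ → ℝ} (hf : IntegrableOn f (I ×ˢ J))
    (h : ∀ φ ψ, IsTestFunction I φ → IsTestFunction J ψ →
      ∫ p in I ×ˢ J, f p * (φ p.1 * ψ p.2) = 0) :
    f =ᵐ[volume.restrict (I ×ˢ J)] 0 := by
  rw [IntegrableOn, volume_restrict_prod] at hf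
  simp only [volume_restrict_prod] at h ⊢
  refine ae_eq_zero_of_forall_setIntegral_prod_eq_zero hf fun S S' hS hS' => ?_
  have hle : ((volume.restrict I).restrict S).prod (volume.restrict J) ≤
      (volume.restrict I).prod (volume.restrict J) := by
    have := Measure.prod_restrict (μ := volume.restrict I) (ν := volume.restrict J) S univ
    rw [Measure.restrict_univ] at this
    exact this.trans_le Measure.restrict_le_self
  have hfS : Integrable f (((volume.restrict I).restrict S).prod (volume.restrict J)) :=
    hf.mono_measure hle
  have hψi : ∀ ψ, IsTestFunction J ψ → Integrable (fun p => f p * ψ p.2)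
      ((volume.restrict I).prod (volume.restrict J)) := by
    intro ψ hψ
    obtain ⟨C, hC⟩ := hψ.exists_bound
    exact hf.mul_bdd (hψ.1.continuous.comp continuous_snd).aestronglyMeasurable
      (Filter.Eventually.of_forall fun p => hC p.2)
  -- One variable at a time: fix ψ and vary φ to annihilate almost every section. Then integrate
  -- over an arbitrary measurable set in x and vary ψ. What remains is that f has zero integral over
  -- all rectangles.
  have hA : ∀ ψ, IsTestFunction J ψ → ∀ᵐ x ∂(volume.restrict I),
      ∫ y, f (x, y) * ψ y ∂(volume.restrict J) = 0 := by
    intro ψ hψ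
    refine ae_eq_zero_of_forall_test hI (hψi ψ hψ).integral_prod_left fun φ hφ => ?_
    obtain ⟨C, hC⟩ := hφ.exists_bound
    have hi : Integrable (fun p => f p * ψ p.2 * φ p.1)
        ((volume.restrict I).prod (volume.restrict J)) :=
      (hψi ψ hψ).mul_bdd (hφ.1.continuous.comp continuous_fst).aestronglyMeasurable
        (Filter.Eventually.of_forall fun p => hC p.1)
    have := h φ ψ hφ hψ
    rw [show (fun p : ℝ × ℝ => f p * (φ p.1 * ψ p.2)) = fun p => f p * ψ p.2 * φ p.1 by
      ext p; ring, integral_prod _ hi] at this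
    simpa only [integral_mul_const] using this
  have hB : ∀ᵐ y ∂(volume.restrict J), ∫ x in S, f (x, y) ∂(volume.restrict I) = 0 := by
    refine ae_eq_zero_of_forall_test hJ hfS.integral_prod_right fun ψ hψ => ?_
    have hi : Integrable (fun p => f p * ψ p.2)
        (((volume.restrict I).restrict S).prod (volume.restrict J)) :=
      (hψi ψ hψ).mono_measure hle
    have e1 := integral_prod_symm _ hi
    have e2 := integral_prod _ hi
    simp only [integral_mul_const] at e1
    rw [← e1, e2]
    exact integral_eq_zero_of_ae (ae_restrict_of_ae (hA ψ hψ))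
  rw [← Measure.prod_restrict, integral_prod_symm]
  · exact integral_eq_zero_of_ae (ae_restrict_of_ae hB)
  · rw [Measure.prod_restrict]
    exact hf.mono_measure Measure.restrict_le_self

/-- Bounded kernels `A x s` that are continuous in `x` for almost all `s`. -/
structure IsBddKernel (A : ℝ → ℝ → ℝ) (C : ℝ) : Prop where
  measurable : Measurable (Function.uncurry A)
  bound : ∀ x s, |A x s| ≤ C
  continuousAt : ∀ x, ∀ᵐ s, ContinuousAt (fun x => A x s) x

section Kernel

variable {I J : Set ℝ} {A B : ℝ → ℝ → ℝ} {C : ℝ} {g : ℝ × ℝ → ℝ}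

theorem IsBddKernel.abs_mul_le (hA : IsBddKernel A C) (hB : IsBddKernel B C) (p z : ℝ × ℝ) :
    |g z * (A p.1 z.1 * B p.2 z.2)| ≤ C ^ 2 * |g z| := by
  rw [abs_mul, abs_mul, sq, mul_comm]
  have := hA.bound p.1 z.1
  have := hB.bound p.2 z.2
  gcongr
  exact (abs_nonneg _).trans (hA.bound 0 0)

/-- A kernel may jump in x, but for fixed x only on a null set of s. Hence dominated convergence
still yields a continuous potential. -/
theorem IsBddKernel.continuous_integral (hA : IsBddKernel A C) (hB : IsBddKernel B C)
    (hg : IntegrableOn g (I ×ˢ J)) :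
    Continuous fun p : ℝ × ℝ => ∫ z in I ×ˢ J, g z * (A p.1 z.1 * B p.2 z.2) := by
  have hmA : ∀ x, Measurable fun z : ℝ × ℝ => A x z.1 := fun x =>
    hA.measurable.comp (measurable_const.prodMk measurable_fst)
  have hmB : ∀ x, Measurable fun z : ℝ × ℝ => B x z.2 := fun x =>
    hB.measurable.comp (measurable_const.prodMk measurable_snd)
  refine continuous_iff_continuousAt.2 fun p => ?_
  refine continuousAt_of_dominated (bound := fun z => C ^ 2 * |g z|)
    (Filter.Eventually.of_forall fun q => ?_) (Filter.Eventually.of_forall fun q =>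
      Filter.Eventually.of_forall fun z => hA.abs_mul_le hB q z) (hg.abs.const_mul _) ?_
  · exact hg.aestronglyMeasurable.mul ((hmA _).mul (hmB _)).aestronglyMeasurable
  · rw [volume_restrict_prod]
    have h1 : ∀ᵐ z ∂((volume.restrict I).prod (volume.restrict J)),
        ContinuousAt (fun x => A x z.1) p.1 :=
      Measure.quasiMeasurePreserving_fst.ae (ae_restrict_of_ae (hA.continuousAt p.1))
    have h2 : ∀ᵐ z ∂((volume.restrict I).prod (volume.restrict J)),
        ContinuousAt (fun x => B x z.2) p.2 :=
      Measure.quasiMeasurePreserving_snd.ae (ae_restrict_of_ae (hB.continuousAt p.2))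
    filter_upwards [h1, h2] with z h1 h2
    exact continuousAt_const.mul ((h1.comp continuousAt_fst).mul (h2.comp continuousAt_snd))

theorem IsBddKernel.abs_integral_le (hA : IsBddKernel A C) (hB : IsBddKernel B C)
    (hg : IntegrableOn g (I ×ˢ J)) (p : ℝ × ℝ) :
    |∫ z in I ×ˢ J, g z * (A p.1 z.1 * B p.2 z.2)| ≤ C ^ 2 * ∫ z in I ×ˢ J, |g z| := by
  rw [← integral_const_mul]
  exact norm_integral_le_of_norm_le (f := fun z => g z * (A p.1 z.1 * B p.2 z.2))
    (hg.abs.const_mul _) (Filter.Eventually.of_forall fun z => hA.abs_mul_le hB p z)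

theorem IsBddKernel.integral_integral_mul {a b c d : ℝ} (hA : IsBddKernel A C)
    (hB : IsBddKernel B C) (hg : IntegrableOn g (Ioo a b ×ˢ Ioo c d)) {φ ψ : ℝ → ℝ}
    (hφ : IsTestFunction (Ioo a b) φ) (hψ : IsTestFunction (Ioo c d) ψ) :
    ∫ p in Ioo a b ×ˢ Ioo c d, (∫ z in Ioo a b ×ˢ Ioo c d, g z * (A p.1 z.1 * B p.2 z.2)) *
        (φ p.1 * ψ p.2) =
      ∫ z in Ioo a b ×ˢ Ioo c d, g z *
        ((∫ x in Ioo a b, A x z.1 * φ x) * ∫ y in Ioo c d, B y z.2 * ψ y) := by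
  obtain ⟨C₁, hC₁⟩ := hφ.exists_bound
  obtain ⟨C₂, hC₂⟩ := hψ.exists_bound
  have : IsFiniteMeasure (volume.restrict (Ioo a b ×ˢ Ioo c d)) := by
    rw [volume_restrict_prod]; infer_instance
  have hmA : Measurable fun w : (ℝ × ℝ) × (ℝ × ℝ) => A w.1.1 w.2.1 :=
    hA.measurable.comp (by fun_prop : Measurable fun w : (ℝ × ℝ) × (ℝ × ℝ) => (w.1.1, w.2.1))
  have hmB : Measurable fun w : (ℝ × ℝ) × (ℝ × ℝ) => B w.1.2 w.2.2 :=
    hB.measurable.comp (by fun_prop : Measurable fun w : (ℝ × ℝ) × (ℝ × ℝ) => (w.1.2, w.2.2))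
  have hmφ : Measurable fun w : (ℝ × ℝ) × (ℝ × ℝ) => φ w.1.1 :=
    (hφ.1.continuous.comp (continuous_fst.comp continuous_fst)).measurable
  have hmψ : Measurable fun w : (ℝ × ℝ) × (ℝ × ℝ) => ψ w.1.2 :=
    (hψ.1.continuous.comp (continuous_snd.comp continuous_fst)).measurable
  have hi : Integrable (Function.uncurry fun (p z : ℝ × ℝ) =>
      g z * ((A p.1 z.1 * B p.2 z.2) * (φ p.1 * ψ p.2)))
      ((volume.restrict (Ioo a b ×ˢ Ioo c d)).prod (volume.restrict (Ioo a b ×ˢ Ioo c d))) := by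
    refine (Integrable.comp_snd hg _).mul_bdd (c := C * C * (C₁ * C₂))
      ((hmA.mul hmB).mul (hmφ.mul hmψ)).aestronglyMeasurable
      (Filter.Eventually.of_forall fun w => ?_)
    have h0 : 0 ≤ C := (abs_nonneg _).trans (hA.bound 0 0)
    have h1 : 0 ≤ C₁ := (norm_nonneg _).trans (hC₁ 0)
    simp only [norm_mul]
    gcongr
    · exact hA.bound _ _
    · exact hB.bound _ _
    · exact hC₁ _
    · exact hC₂ _
  have hsw := integral_integral_swap hi
  calc _ = ∫ p in Ioo a b ×ˢ Ioo c d, ∫ z in Ioo a b ×ˢ Ioo c d,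
        g z * ((A p.1 z.1 * B p.2 z.2) * (φ p.1 * ψ p.2)) := by
        refine integral_congr_ae (Filter.Eventually.of_forall fun p => ?_)
        simp only [← integral_mul_const, mul_assoc]
    _ = _ := hsw
    _ = _ := by
        refine integral_congr_ae (Filter.Eventually.of_forall fun z => ?_)
        simp only [integral_const_mul]
        congr 1
        rw [Measure.volume_eq_prod, ← setIntegral_prod_mul (fun x => A x z.1 * φ x)
          fun y => B y z.2 * ψ y]
        refine integral_congr_ae (Filter.Eventually.of_forall fun p => ?_)
        simp only
        ring

end Kernel

theorem IsBddKernel.mono {A : ℝ → ℝ → ℝ} {C C' : ℝ} (h : IsBddKernel A C) (hC : C ≤ C') :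
    IsBddKernel A C' :=
  ⟨h.measurable, fun x s => (h.bound x s).trans hC, h.continuousAt⟩

/-- The kernel of the formula f(x) = ∫ f η + ∫ k(x, s) f'(s) ds with k(x, s) = ∫_a^s η - 1_{x ≤ s}.
In dual form, φ = (∫ φ) η - K' with a test function K, a primitive of a function of zero mean, and K
is the potential of φ under k. The dual form suits weak derivatives, since it only tests with K. -/
theorem exists_primitive_kernel {a b : ℝ} (hab : a < b) :
    ∃ (η : ℝ → ℝ) (k : ℝ → ℝ → ℝ) (C : ℝ), IsTestFunction (Ioo a b) η ∧
      (∫ x in Ioo a b, η x = 1) ∧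
      IsBddKernel (fun _ s => η s) C ∧ IsBddKernel k C ∧
      ∀ φ, IsTestFunction (Ioo a b) φ → ∃ K, IsTestFunction (Ioo a b) K ∧
        (∀ s, deriv K s = (∫ x in Ioo a b, φ x) * η s - φ s) ∧
        ∀ s ∈ Ioo a b, ∫ x in Ioo a b, k x s * φ x = K s := by
  obtain ⟨η, hη, hη1⟩ := exists_isTestFunction_integral_eq_one hab
  obtain ⟨C₀, hC₀⟩ := hη.exists_bound
  have hηc := hη.1.continuous
  have hηi : Integrable η := hηc.integrable_of_hasCompactSupport hη.2.1
  set H : ℝ → ℝ := fun s => ∫ x in a..s, η x with hH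
  have hHd : ∀ s, HasDerivAt H (η s) s := hasDerivAt_primitive hηc a
  have hHc : Continuous H := continuous_iff_continuousAt.2 fun s => (hHd s).continuousAt
  have hHb : ∀ s, |H s| ≤ ∫ x, ‖η x‖ := fun s =>
    intervalIntegral.norm_integral_le_integral_norm_uIoc.trans
      (setIntegral_le_integral hηi.norm (Filter.Eventually.of_forall fun x => norm_nonneg _))
  have hpos : 0 ≤ ∫ x, ‖η x‖ := integral_nonneg fun x => norm_nonneg _
  have hC₀pos : 0 ≤ C₀ := (norm_nonneg _).trans (hC₀ 0)
  refine ⟨η, fun x s => H s - (Iic s).indicator 1 x, C₀ + (∫ x, ‖η x‖) + 1, hη, ?_, ?_, ?_, ?_⟩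
  · rw [← integral_Ioc_eq_integral_Ioo, ← intervalIntegral.integral_of_le hab.le, hη1]
  · exact ⟨hηc.measurable.comp measurable_snd, fun x s => by
      have : |η s| ≤ C₀ := hC₀ s
      linarith, fun x => Filter.Eventually.of_forall fun s => continuousAt_const⟩
  · refine ⟨?_, fun x s => ?_, fun x => ?_⟩
    · refine (hHc.measurable.comp measurable_snd).sub ?_
      have : MeasurableSet {p : ℝ × ℝ | p.1 ≤ p.2} := measurableSet_le measurable_fst measurable_snd
      have e : (fun p : ℝ × ℝ => (Iic p.2).indicator (1 : ℝ → ℝ) p.1) =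
          {p : ℝ × ℝ | p.1 ≤ p.2}.indicator 1 := by
        ext p
        simp [indicator]
      exact e ▸ measurable_one.indicator this
    · have h1 : |(Iic s).indicator (1 : ℝ → ℝ) x| ≤ 1 := by
        by_cases hx : x ≤ s <;> simp [indicator, hx]
      have := abs_sub (H s) ((Iic s).indicator (1 : ℝ → ℝ) x)
      linarith [hHb s]
    -- As a function of x, the kernel jumps only at x = s.
    · have hne : ∀ᵐ s : ℝ, s ≠ x := by simp [ae_iff]
      filter_upwards [hne] with s hs
      refine continuousAt_const.sub ?_
      rcases lt_or_gt_of_ne hs with h | h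
      · refine (continuousAt_const (y := (0 : ℝ))).congr ?_
        filter_upwards [lt_mem_nhds h] with y hy
        simp [indicator, not_le.2 hy]
      · refine (continuousAt_const (y := (1 : ℝ))).congr ?_
        filter_upwards [gt_mem_nhds h] with y hy
        simp [indicator, hy.le]
  · intro φ hφ
    set c := ∫ x in Ioo a b, φ x with hc
    have hφc := hφ.1.continuous
    have hφi : Integrable φ := hφc.integrable_of_hasCompactSupport hφ.2.1
    have hψ : IsTestFunction (Ioo a b) (c • η - φ) := (hη.const_smul c).sub hφ
    have hc' : ∫ x in a..b, φ x = c := by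
      rw [intervalIntegral.integral_of_le hab.le, integral_Ioc_eq_integral_Ioo]
    have hsplit : ∀ s, ∫ x in a..s, (c • η - φ) x = c * H s - ∫ x in a..s, φ x := by
      intro s
      simp only [Pi.sub_apply, Pi.smul_apply, smul_eq_mul]
      rw [intervalIntegral.integral_sub ((hηc.intervalIntegrable _ _).const_mul c)
        (hφc.intervalIntegrable _ _), intervalIntegral.integral_const_mul]
    refine ⟨_, hψ.primitive hab ?_, fun s => ?_, fun s hs => ?_⟩
    · rw [hsplit, hc', hH]
      simp only [hη1]
      ring
    · rw [(hasDerivAt_primitive hψ.1.continuous a s).deriv]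
      simp
    · rw [hsplit]
      simp only [sub_mul]
      have hind : ∀ x, (Iic s).indicator (1 : ℝ → ℝ) x * φ x = (Iic s).indicator φ x := by
        intro x
        by_cases hx : x ∈ Iic s <;> simp [hx]
      simp only [hind]
      rw [integral_sub (hφi.integrableOn.const_mul _)
        ((hφi.indicator measurableSet_Iic).integrableOn), integral_const_mul, ← hc,
        integral_indicator measurableSet_Iic, Measure.restrict_restrict measurableSet_Iic,
        intervalIntegral.integral_of_le hs.1.le, mul_comm]
      congr 3
      ext x
      simp only [mem_inter_iff, mem_Iic, mem_Ioo, mem_Ioc]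
      constructor
      · rintro ⟨h1, h2, h3⟩
        exact ⟨h2, h1⟩
      · rintro ⟨h1, h2⟩
        exact ⟨h2, h1, h2.trans_lt hs.2⟩

theorem integrableOn_mul_prod_test {I J : Set ℝ} {f : ℝ × ℝ → ℝ} (hf : IntegrableOn f (I ×ˢ J))
    {φ ψ : ℝ → ℝ} (hφ : IsTestFunction I φ) (hψ : IsTestFunction J ψ) :
    IntegrableOn (fun p => f p * (φ p.1 * ψ p.2)) (I ×ˢ J) := by
  obtain ⟨C, hC⟩ := (hφ.prod_mul hψ).exists_bound
  exact hf.mul_bdd (hφ.prod_mul hψ).1.continuous.aestronglyMeasurable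
    (Filter.Eventually.of_forall hC)

/-- Functions on a rectangle whose derivatives `f_x`, `f_t`, `f_xt` are integrable have a
continuous representative, bounded by the `L¹` norms. -/
theorem exists_continuous_representative {a b c d : ℝ} (hab : a < b) (hcd : c < d) :
    ∃ C : ℝ, 0 < C ∧ ∀ f fx ft fxt : ℝ × ℝ → ℝ,
      IntegrableOn f (Ioo a b ×ˢ Ioo c d) → IntegrableOn fx (Ioo a b ×ˢ Ioo c d) →
      IntegrableOn ft (Ioo a b ×ˢ Ioo c d) → IntegrableOn fxt (Ioo a b ×ˢ Ioo c d) →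
      (∀ φ ψ, IsTestFunction (Ioo a b) φ → IsTestFunction (Ioo c d) ψ →
        ∫ p in Ioo a b ×ˢ Ioo c d, f p * (deriv φ p.1 * ψ p.2) =
          -∫ p in Ioo a b ×ˢ Ioo c d, fx p * (φ p.1 * ψ p.2)) →
      (∀ φ ψ, IsTestFunction (Ioo a b) φ → IsTestFunction (Ioo c d) ψ →
        ∫ p in Ioo a b ×ˢ Ioo c d, f p * (φ p.1 * deriv ψ p.2) =
          -∫ p in Ioo a b ×ˢ Ioo c d, ft p * (φ p.1 * ψ p.2)) →
      (∀ φ ψ, IsTestFunction (Ioo a b) φ → IsTestFunction (Ioo c d) ψ →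
        ∫ p in Ioo a b ×ˢ Ioo c d, fx p * (φ p.1 * deriv ψ p.2) =
          -∫ p in Ioo a b ×ˢ Ioo c d, fxt p * (φ p.1 * ψ p.2)) →
      ∃ U : ℝ × ℝ → ℝ, Continuous U ∧ f =ᵐ[volume.restrict (Ioo a b ×ˢ Ioo c d)] U ∧
        ∀ p, |U p| ≤ C * ((∫ z in Ioo a b ×ˢ Ioo c d, |f z|) +
          (∫ z in Ioo a b ×ˢ Ioo c d, |fx z|) + (∫ z in Ioo a b ×ˢ Ioo c d, |ft z|) +
          ∫ z in Ioo a b ×ˢ Ioo c d, |fxt z|) := by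
  obtain ⟨η₁, k₁, C₁, hη₁, -, hA₁', hk₁', hK₁⟩ := exists_primitive_kernel hab
  obtain ⟨η₂, k₂, C₂, hη₂, -, hA₂', hk₂', hK₂⟩ := exists_primitive_kernel hcd
  set C := max (max C₁ C₂) 1
  have hA₁ := hA₁'.mono (show C₁ ≤ C from (le_max_left _ _).trans (le_max_left _ _))
  have hA₂ := hA₂'.mono (show C₂ ≤ C from (le_max_right _ _).trans (le_max_left _ _))
  have hk₁ := hk₁'.mono (show C₁ ≤ C from (le_max_left _ _).trans (le_max_left _ _))
  have hk₂ := hk₂'.mono (show C₂ ≤ C from (le_max_right _ _).trans (le_max_left _ _))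
  have hC : 0 < C := lt_of_lt_of_le one_pos (le_max_right _ _)
  refine ⟨C ^ 2, by positivity, fun f fx ft fxt hf hfx hft hfxt hx ht hxt => ?_⟩
  set Ω := Ioo a b ×ˢ Ioo c d
  -- The tensor product of the one-dimensional representation formulas in x and t: each variable
  -- contributes either the mean against η or the derivative against k, which gives four terms.
  set U₀ : ℝ × ℝ → ℝ := fun p =>
    ∫ z in Ω, f z * ((fun _ s => η₁ s) p.1 z.1 * (fun _ s => η₂ s) p.2 z.2) with hU₀
  set U₁ : ℝ × ℝ → ℝ := fun p =>
    ∫ z in Ω, fx z * (k₁ p.1 z.1 * (fun _ s => η₂ s) p.2 z.2) with hU₁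
  set U₂ : ℝ × ℝ → ℝ := fun p =>
    ∫ z in Ω, ft z * ((fun _ s => η₁ s) p.1 z.1 * k₂ p.2 z.2) with hU₂
  set U₃ : ℝ × ℝ → ℝ := fun p => ∫ z in Ω, fxt z * (k₁ p.1 z.1 * k₂ p.2 z.2) with hU₃
  have c₀ : Continuous U₀ := hA₁.continuous_integral hA₂ hf
  have c₁ : Continuous U₁ := hk₁.continuous_integral hA₂ hfx
  have c₂ : Continuous U₂ := hA₁.continuous_integral hk₂ hft
  have c₃ : Continuous U₃ := hk₁.continuous_integral hk₂ hfxt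
  have b₀ := hA₁.abs_integral_le hA₂ hf
  have b₁ := hk₁.abs_integral_le hA₂ hfx
  have b₂ := hA₁.abs_integral_le hk₂ hft
  have b₃ := hk₁.abs_integral_le hk₂ hfxt
  have hfin : IsFiniteMeasure (volume.restrict Ω) := by
    rw [volume_restrict_prod]; infer_instance
  have i₀ : IntegrableOn U₀ Ω := Integrable.of_bound c₀.aestronglyMeasurable _
    (Filter.Eventually.of_forall b₀)
  have i₁ : IntegrableOn U₁ Ω := Integrable.of_bound c₁.aestronglyMeasurable _
    (Filter.Eventually.of_forall b₁)
  have i₂ : IntegrableOn U₂ Ω := Integrable.of_bound c₂.aestronglyMeasurable _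
    (Filter.Eventually.of_forall b₂)
  have i₃ : IntegrableOn U₃ Ω := Integrable.of_bound c₃.aestronglyMeasurable _
    (Filter.Eventually.of_forall b₃)
  refine ⟨fun p => U₀ p + U₁ p + U₂ p + U₃ p, ((c₀.add c₁).add c₂).add c₃, ?_, fun p => ?_⟩
  swap
  · refine ((abs_add_le _ _).trans (add_le_add_left ((abs_add_le _ _).trans
      (add_le_add_left (abs_add_le _ _) _)) _)).trans ?_
    have := b₀ p
    have := b₁ p
    have := b₂ p
    have := b₃ p
    simp only [hU₀, hU₁, hU₂, hU₃]
    linarith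
  have key := ae_eq_zero_of_forall_test_prod isOpen_Ioo isOpen_Ioo
    (f := fun p => f p - (U₀ p + U₁ p + U₂ p + U₃ p))
    (hf.sub (((i₀.add i₁).add i₂).add i₃)) fun φ ψ hφ hψ => ?_
  · filter_upwards [key] with p hp
    exact sub_eq_zero.1 hp
  obtain ⟨K₁, tK₁, dK₁, eK₁⟩ := hK₁ φ hφ
  obtain ⟨K₂, tK₂, dK₂, eK₂⟩ := hK₂ ψ hψ
  set m₁ := ∫ x in Ioo a b, φ x
  set m₂ := ∫ x in Ioo c d, ψ x
  have hm : MeasurableSet Ω := measurableSet_Ioo.prod measurableSet_Ioo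
  have e₀ : ∫ p in Ω, U₀ p * (φ p.1 * ψ p.2) = m₁ * (m₂ * ∫ z in Ω, f z * (η₁ z.1 * η₂ z.2)) := by
    rw [hU₀, hA₁.integral_integral_mul hA₂ hf hφ hψ]
    simp only [integral_const_mul]
    rw [← integral_const_mul, ← integral_const_mul]
    congr 1
    ext z
    ring
  have e₁ : ∫ p in Ω, U₁ p * (φ p.1 * ψ p.2) = m₂ * ∫ z in Ω, fx z * (K₁ z.1 * η₂ z.2) := by
    rw [hU₁, hk₁.integral_integral_mul hA₂ hfx hφ hψ, ← integral_const_mul]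
    refine setIntegral_congr_fun hm fun z hz => ?_
    simp only [integral_const_mul, eK₁ z.1 hz.1]
    ring
  have e₂ : ∫ p in Ω, U₂ p * (φ p.1 * ψ p.2) = m₁ * ∫ z in Ω, ft z * (η₁ z.1 * K₂ z.2) := by
    rw [hU₂, hA₁.integral_integral_mul hk₂ hft hφ hψ, ← integral_const_mul]
    refine setIntegral_congr_fun hm fun z hz => ?_
    simp only [integral_const_mul, eK₂ z.2 hz.2]
    ring
  have e₃ : ∫ p in Ω, U₃ p * (φ p.1 * ψ p.2) = ∫ z in Ω, fxt z * (K₁ z.1 * K₂ z.2) := by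
    rw [hU₃, hk₁.integral_integral_mul hk₂ hfxt hφ hψ]
    refine setIntegral_congr_fun hm fun z hz => ?_
    simp only [eK₁ z.1 hz.1, eK₂ z.2 hz.2]
  -- one integration by parts in each variable
  have stepx : ∀ g gx : ℝ × ℝ → ℝ, IntegrableOn g Ω → ∀ χ, IsTestFunction (Ioo c d) χ →
      ∫ p in Ω, g p * (deriv K₁ p.1 * χ p.2) = -∫ p in Ω, gx p * (K₁ p.1 * χ p.2) →
      ∫ p in Ω, g p * (φ p.1 * χ p.2) = m₁ * (∫ p in Ω, g p * (η₁ p.1 * χ p.2)) +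
        ∫ p in Ω, gx p * (K₁ p.1 * χ p.2) := by
    intro g gx hg χ hχ h
    have e : ∀ p : ℝ × ℝ, g p * (deriv K₁ p.1 * χ p.2) =
        m₁ * (g p * (η₁ p.1 * χ p.2)) - g p * (φ p.1 * χ p.2) := by
      intro p; rw [dK₁]; ring
    simp only [e] at h
    rw [integral_sub ((integrableOn_mul_prod_test hg hη₁ hχ).const_mul _)
      (integrableOn_mul_prod_test hg hφ hχ), integral_const_mul] at h
    linarith
  have stept : ∀ g gt : ℝ × ℝ → ℝ, IntegrableOn g Ω → ∀ χ, IsTestFunction (Ioo a b) χ →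
      ∫ p in Ω, g p * (χ p.1 * deriv K₂ p.2) = -∫ p in Ω, gt p * (χ p.1 * K₂ p.2) →
      ∫ p in Ω, g p * (χ p.1 * ψ p.2) = m₂ * (∫ p in Ω, g p * (χ p.1 * η₂ p.2)) +
        ∫ p in Ω, gt p * (χ p.1 * K₂ p.2) := by
    intro g gx hg χ hχ h
    have e : ∀ p : ℝ × ℝ, g p * (χ p.1 * deriv K₂ p.2) =
        m₂ * (g p * (χ p.1 * η₂ p.2)) - g p * (χ p.1 * ψ p.2) := by
      intro p; rw [dK₂]; ring
    simp only [e] at h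
    rw [integral_sub ((integrableOn_mul_prod_test hg hχ hη₂).const_mul _)
      (integrableOn_mul_prod_test hg hχ hψ), integral_const_mul] at h
    linarith
  -- The x-formula is applied to f, then the t-formula to both resulting terms, with f and f_x
  -- respectively.
  have main : ∫ p in Ω, f p * (φ p.1 * ψ p.2) =
      m₁ * (m₂ * ∫ z in Ω, f z * (η₁ z.1 * η₂ z.2)) + m₁ * (∫ z in Ω, ft z * (η₁ z.1 * K₂ z.2)) +
      m₂ * (∫ z in Ω, fx z * (K₁ z.1 * η₂ z.2)) + ∫ z in Ω, fxt z * (K₁ z.1 * K₂ z.2) := by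
    rw [stepx f fx hf ψ hψ (hx K₁ ψ tK₁ hψ), stept f ft hf η₁ hη₁ (ht η₁ K₂ hη₁ tK₂),
      stept fx fxt hfx K₁ tK₁ (hxt K₁ K₂ tK₁ tK₂)]
    ring
  simp only [sub_mul, add_mul]
  have j₀ := integrableOn_mul_prod_test i₀ hφ hψ
  have j₁ := integrableOn_mul_prod_test i₁ hφ hψ
  have j₂ := integrableOn_mul_prod_test i₂ hφ hψ
  have j₃ := integrableOn_mul_prod_test i₃ hφ hψ
  have j₀₁ : IntegrableOn (fun p => U₀ p * (φ p.1 * ψ p.2) + U₁ p * (φ p.1 * ψ p.2)) Ω :=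
    j₀.add j₁
  have j₀₂ : IntegrableOn (fun p => U₀ p * (φ p.1 * ψ p.2) + U₁ p * (φ p.1 * ψ p.2) +
    U₂ p * (φ p.1 * ψ p.2)) Ω := j₀₁.add j₂
  have j₀₃ : IntegrableOn (fun p => U₀ p * (φ p.1 * ψ p.2) + U₁ p * (φ p.1 * ψ p.2) +
    U₂ p * (φ p.1 * ψ p.2) + U₃ p * (φ p.1 * ψ p.2)) Ω := j₀₂.add j₃
  rw [integral_sub (integrableOn_mul_prod_test hf hφ hψ) j₀₃,
    integral_add j₀₂ j₃, integral_add j₀₁ j₂, integral_add j₀ j₁, e₀, e₁, e₂, e₃, main]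
  ring

/-! ### From weak to classical derivatives. -/

theorem eqOn_Icc_of_ae_eq_Ioo {a b : ℝ} (hab : a < b) {f g : ℝ → ℝ} (hf : Continuous f)
    (hg : Continuous g) (h : f =ᵐ[volume.restrict (Ioo a b)] g) : EqOn f g (Icc a b) := by
  rw [Measure.restrict_congr_set Ioo_ae_eq_Icc] at h
  exact Measure.eqOn_Icc_of_ae_eq volume hab.ne h hf.continuousOn hg.continuousOn

theorem setIntegral_Ioo_eq_intervalIntegral {a b : ℝ} (hab : a ≤ b) (f : ℝ → ℝ) :
    ∫ x in Ioo a b, f x = ∫ x in a..b, f x := by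
  rw [intervalIntegral.integral_of_le hab, integral_Ioc_eq_integral_Ioo]

theorem Continuous.integrableOn_Ioo {a b : ℝ} {f : ℝ → ℝ} (hf : Continuous f) :
    IntegrableOn f (Ioo a b) :=
  (hf.integrableOn_Icc).mono_set Ioo_subset_Icc_self

theorem deriv_eq_dirDeriv {φ : ℝ → ℝ} : deriv φ = dirDeriv (1 : ℝ) φ := by
  ext x
  simp [dirDeriv]

theorem IsTestFunction.deriv {I : Set ℝ} {φ : ℝ → ℝ} (hφ : IsTestFunction I φ) :
    IsTestFunction I (deriv φ) :=
  deriv_eq_dirDeriv ▸ hφ.dirDeriv (1 : ℝ)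

theorem IsTestFunction.hasDerivAt {I : Set ℝ} {φ : ℝ → ℝ} (hφ : IsTestFunction I φ) (x : ℝ) :
    HasDerivAt φ (_root_.deriv φ x) x :=
  (hφ.1.differentiable (by simp) x).hasDerivAt

/-- The du Bois-Reymond lemma. -/
theorem eq_const_of_forall_integral_mul_deriv_eq_zero {a b : ℝ} (hab : a < b) {W : ℝ → ℝ}
    (hW : Continuous W) (h : ∀ φ, IsTestFunction (Ioo a b) φ → ∫ x in Ioo a b, W x * deriv φ x = 0) :
    ∃ c, ∀ x ∈ Icc a b, W x = c := by
  obtain ⟨η, k, C, hη, -, -, -, hK⟩ := exists_primitive_kernel hab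
  refine ⟨∫ x in Ioo a b, W x * η x, ?_⟩
  set c := ∫ x in Ioo a b, W x * η x
  refine eqOn_Icc_of_ae_eq_Ioo hab hW continuous_const ?_
  have := ae_eq_zero_of_forall_test (I := Ioo a b) isOpen_Ioo (g := fun x => W x - c)
    (hW.sub continuous_const).integrableOn_Ioo fun φ hφ => ?_
  · filter_upwards [this] with x hx
    exact sub_eq_zero.1 hx
  obtain ⟨K, tK, dK, -⟩ := hK φ hφ
  -- Since K' = (∫ φ) η - φ, testing with K says exactly that ∫ W φ = c ∫ φ.
  have h0 := h K tK
  simp only [dK, mul_sub] at h0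
  have hc := hφ.1.continuous
  have hηc := hη.1.continuous
  rw [integral_sub (by fun_prop : Continuous _).integrableOn_Ioo
    (by fun_prop : Continuous _).integrableOn_Ioo] at h0
  simp only [mul_left_comm (W _), integral_const_mul] at h0
  simp only [sub_mul]
  rw [integral_sub (by fun_prop : Continuous _).integrableOn_Ioo
    (by fun_prop : Continuous _).integrableOn_Ioo, integral_const_mul]
  linarith

/-- A continuous function with a continuous weak `x`-derivative satisfies the fundamental theorem
of calculus on every horizontal segment. -/
theorem eq_add_integral_of_forall_prod_test {a b c d : ℝ} (hab : a < b) (hcd : c < d)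
    {U V : ℝ × ℝ → ℝ} (hU : Continuous U) (hV : Continuous V)
    (h : ∀ φ ψ, IsTestFunction (Ioo a b) φ → IsTestFunction (Ioo c d) ψ →
        ∫ p in Ioo a b ×ˢ Ioo c d, U p * (deriv φ p.1 * ψ p.2) =
          -∫ p in Ioo a b ×ˢ Ioo c d, V p * (φ p.1 * ψ p.2))
    {t : ℝ} (ht : t ∈ Icc c d) {x : ℝ} (hx : x ∈ Icc a b) :
    U (x, t) = U (a, t) + ∫ s in a..x, V (s, t) := by
  have hfin : IsFiniteMeasure ((volume : Measure (ℝ × ℝ)).restrict (Ioo a b ×ˢ Ioo c d)) := by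
    rw [volume_restrict_prod]; infer_instance
  have hint : ∀ {f : ℝ × ℝ → ℝ}, Continuous f → IntegrableOn f (Ioo a b ×ˢ Ioo c d) := by
    intro f hf
    exact (hf.continuousOn.integrableOn_compact (isCompact_Icc.prod isCompact_Icc)).mono_set
      (prod_mono Ioo_subset_Icc_self Ioo_subset_Icc_self)
  -- The identity on one fixed horizontal line. As ψ is arbitrary it holds for almost every t, and
  -- then for every t, including the end points, by continuity.
  have hG : ∀ φ, IsTestFunction (Ioo a b) φ →
      ∫ x in Ioo a b, (U (x, t) * deriv φ x + V (x, t) * φ x) = 0 := by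
    intro φ hφ
    have hφc := hφ.1.continuous
    have hφc' := hφ.deriv.1.continuous
    have hGc : Continuous fun t => ∫ x in a..b, (U (x, t) * deriv φ x + V (x, t) * φ x) := by
      apply intervalIntegral.continuous_parametric_intervalIntegral_of_continuous'
      simp only [Function.uncurry_def]
      fun_prop
    rw [setIntegral_Ioo_eq_intervalIntegral hab.le]
    refine eqOn_Icc_of_ae_eq_Ioo hcd hGc continuous_const ?_ ht
    refine ae_eq_zero_of_forall_test isOpen_Ioo hGc.integrableOn_Ioo fun ψ hψ => ?_
    have hψc := hψ.1.continuous
    have e := h φ ψ hφ hψ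
    rw [← add_eq_zero_iff_eq_neg, ← integral_add (hint (by fun_prop)) (hint (by fun_prop)),
      Measure.volume_eq_prod, ← Measure.prod_restrict, integral_prod_symm] at e
    · rw [← e]
      congr 1
      ext y
      rw [← setIntegral_Ioo_eq_intervalIntegral hab.le, ← integral_mul_const]
      congr 1
      ext z
      ring
    · rw [Measure.prod_restrict, ← Measure.volume_eq_prod]
      exact hint (by fun_prop)
  have hVt : Continuous fun s => V (s, t) := by fun_prop
  have hPd := hasDerivAt_primitive hVt a
  have hPc : Continuous fun x => ∫ s in a..x, V (s, t) :=
    continuous_iff_continuousAt.2 fun x => (hPd x).continuousAt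
  -- The difference of U and the primitive of V has zero weak derivative, hence is constant.
  obtain ⟨c₀, hc₀⟩ := eq_const_of_forall_integral_mul_deriv_eq_zero hab
    (W := fun x => U (x, t) - ∫ s in a..x, V (s, t)) (by fun_prop) fun φ hφ => by
      have hφc := hφ.1.continuous
      have hφc' := hφ.deriv.1.continuous
      have e := hG φ hφ
      rw [integral_add (by fun_prop : Continuous _).integrableOn_Ioo
        (by fun_prop : Continuous _).integrableOn_Ioo] at e
      simp only [sub_mul]
      rw [integral_sub (by fun_prop : Continuous _).integrableOn_Ioo
        (by fun_prop : Continuous _).integrableOn_Ioo]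
      have ibp := intervalIntegral.integral_mul_deriv_eq_deriv_mul (a := a) (b := b)
        (fun x _ => hPd x) (fun x _ => hφ.hasDerivAt x) (hVt.intervalIntegrable _ _)
        (hφc'.intervalIntegrable _ _)
      rw [hφ.eq_zero_of_notMem (p := a) (by simp), hφ.eq_zero_of_notMem (p := b) (by simp)] at ibp
      simp only [setIntegral_Ioo_eq_intervalIntegral hab.le] at e ⊢
      linarith
  have h1 := hc₀ x hx
  have h2 := hc₀ a (left_mem_Icc.2 hab.le)
  simp only [intervalIntegral.integral_same] at h1 h2
  linarith

theorem hasDerivAt_of_eq_add_integral {a b : ℝ} {u v : ℝ → ℝ} (hv : Continuous v)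
    (h : ∀ x ∈ Icc a b, u x = u a + ∫ s in a..x, v s) {x : ℝ} (hx : x ∈ Ioo a b) :
    HasDerivAt u (v x) x := by
  refine ((hasDerivAt_primitive hv a x).const_add (u a)).congr_of_eventuallyEq ?_
  filter_upwards [Ioo_mem_nhds hx.1 hx.2] with y hy
  exact h y (Ioo_subset_Icc_self hy)

theorem IsWeakDeriv.integral_fst {I J : Set ℝ} {f g : ℝ × ℝ → ℝ}
    (h : IsWeakDeriv (I ×ˢ J) [((1, 0) : ℝ × ℝ)] f g) {φ ψ : ℝ → ℝ} (hφ : IsTestFunction I φ)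
    (hψ : IsTestFunction J ψ) :
    ∫ p in I ×ˢ J, f p * (deriv φ p.1 * ψ p.2) = -∫ p in I ×ˢ J, g p * (φ p.1 * ψ p.2) := by
  have := h.2.2 _ (hφ.prod_mul hψ)
  simpa [dirDeriv_fst_prod_mul hφ.1 hψ.1] using this

theorem IsWeakDeriv.integral_snd {I J : Set ℝ} {f g : ℝ × ℝ → ℝ}
    (h : IsWeakDeriv (I ×ˢ J) [((0, 1) : ℝ × ℝ)] f g) {φ ψ : ℝ → ℝ} (hφ : IsTestFunction I φ)
    (hψ : IsTestFunction J ψ) :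
    ∫ p in I ×ˢ J, f p * (φ p.1 * deriv ψ p.2) = -∫ p in I ×ˢ J, g p * (φ p.1 * ψ p.2) := by
  have := h.2.2 _ (hφ.prod_mul hψ)
  simpa [dirDeriv_snd_prod_mul hφ.1 hψ.1] using this

theorem IsWeakDeriv.hasDerivAt_fst {a b c d : ℝ} (hab : a < b) (hcd : c < d)
    {U V : ℝ × ℝ → ℝ} (hU : Continuous U) (hV : Continuous V)
    (h : IsWeakDeriv (Ioo a b ×ˢ Ioo c d) [((1, 0) : ℝ × ℝ)] U V) {x t : ℝ}
    (hx : x ∈ Ioo a b) (ht : t ∈ Icc c d) : HasDerivAt (fun s => U (s, t)) (V (x, t)) x :=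
  hasDerivAt_of_eq_add_integral (v := fun s => V (s, t)) (by fun_prop) (fun _ hy =>
    eq_add_integral_of_forall_prod_test hab hcd hU hV (fun _ _ => h.integral_fst) ht hy) hx

theorem IsWeakDeriv.hasDerivAt_snd {a b c d : ℝ} (hab : a < b) (hcd : c < d)
    {U V : ℝ × ℝ → ℝ} (hU : Continuous U) (hV : Continuous V)
    (h : IsWeakDeriv (Ioo a b ×ˢ Ioo c d) [((0, 1) : ℝ × ℝ)] U V) {x t : ℝ}
    (hx : x ∈ Icc a b) (ht : t ∈ Ioo c d) : HasDerivAt (fun s => U (x, s)) (V (x, t)) t := by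
  refine hasDerivAt_of_eq_add_integral (v := fun s => V (x, s)) (by fun_prop) (fun y hy =>
    eq_add_integral_of_forall_prod_test (U := fun p => U p.swap) (V := fun p => V p.swap)
      hcd hab (by fun_prop) (by fun_prop) (fun φ ψ hφ hψ => ?_) hx hy) ht
  have e := h.integral_snd hψ hφ
  have sw : ∀ f : ℝ × ℝ → ℝ, ∫ z in Ioo c d ×ˢ Ioo a b, f z.swap = ∫ z in Ioo a b ×ˢ Ioo c d, f z :=
    fun f => setIntegral_prod_swap _ _ f
  rw [← sw, ← sw fun p => V p * (ψ p.1 * φ p.2)] at e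
  simpa only [Prod.fst_swap, Prod.snd_swap, mul_comm (ψ _)] using e

/-! ### The space `H^k` -/

section SobolevSpace

variable {k : ℕ} {Ω : Set (ℝ × ℝ)} {q q' : ℝ × ℝ → ℝ}

theorem mem_multiIndices {a : ℕ × ℕ} : a ∈ multiIndices k ↔ a.1 + a.2 ≤ k := by
  simp only [multiIndices, Finset.mem_filter, Finset.mem_product, Finset.mem_range]
  omega

theorem MemH.isWeakDeriv (h : MemH k Ω q) {i j : ℕ} (hij : i + j ≤ k) :
    IsWeakDeriv Ω (dirs i j) q (weakDeriv Ω (dirs i j) q) := by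
  obtain ⟨g, -, hg⟩ := h (i, j) (mem_multiIndices.2 hij)
  exact hg.isWeakDeriv_weakDeriv

theorem MemH.memLp (hΩ : IsOpen Ω) (h : MemH k Ω q) {i j : ℕ} (hij : i + j ≤ k) :
    MemLp (weakDeriv Ω (dirs i j) q) 2 (volume.restrict Ω) := by
  obtain ⟨g, hg2, hg⟩ := h (i, j) (mem_multiIndices.2 hij)
  exact (memLp_congr_ae (hg.weakDeriv_ae_eq hΩ)).2 hg2

theorem MemH.integrable_sq (hΩ : IsOpen Ω) (h : MemH k Ω q) {i j : ℕ} (hij : i + j ≤ k) :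
    Integrable (fun p => weakDeriv Ω (dirs i j) q p ^ 2) (volume.restrict Ω) :=
  (h.memLp hΩ hij).integrable_sq

theorem normH_nonneg : 0 ≤ normH k Ω q := Real.sqrt_nonneg _

theorem normH_sq :
    normH k Ω q ^ 2 = ∑ a ∈ multiIndices k, ∫ p in Ω, (weakDeriv Ω (dirs a.1 a.2) q p) ^ 2 :=
  Real.sq_sqrt (Finset.sum_nonneg fun _ _ => integral_nonneg fun _ => sq_nonneg _)

theorem integral_sq_le_normH_sq {i j : ℕ} (hij : i + j ≤ k) :
    ∫ p in Ω, (weakDeriv Ω (dirs i j) q p) ^ 2 ≤ normH k Ω q ^ 2 := by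
  rw [normH_sq]
  exact Finset.single_le_sum
    (f := fun a : ℕ × ℕ => ∫ p in Ω, (weakDeriv Ω (dirs a.1 a.2) q p) ^ 2)
    (fun _ _ => integral_nonneg fun _ => sq_nonneg _) (mem_multiIndices (a := (i, j)).2 hij)

theorem MemH.add (h : MemH k Ω q) (h' : MemH k Ω q') : MemH k Ω (q + q') := by
  intro a ha
  obtain ⟨g, hg2, hg⟩ := h a ha
  obtain ⟨g', hg2', hg'⟩ := h' a ha
  exact ⟨g + g', hg2.add hg2', hg.add hg'⟩

theorem MemH.const_smul (h : MemH k Ω q) (c : ℝ) : MemH k Ω (c • q) := by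
  intro a ha
  obtain ⟨g, hg2, hg⟩ := h a ha
  exact ⟨c • g, hg2.const_smul c, hg.const_smul c⟩

theorem MemH.weakDeriv_add (hΩ : IsOpen Ω) (h : MemH k Ω q) (h' : MemH k Ω q') {i j : ℕ}
    (hij : i + j ≤ k) : weakDeriv Ω (dirs i j) (q + q') =ᵐ[volume.restrict Ω]
      weakDeriv Ω (dirs i j) q + weakDeriv Ω (dirs i j) q' :=
  ((h.isWeakDeriv hij).add (h'.isWeakDeriv hij)).weakDeriv_ae_eq hΩ

theorem MemH.weakDeriv_const_smul (hΩ : IsOpen Ω) (h : MemH k Ω q) (c : ℝ) {i j : ℕ}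
    (hij : i + j ≤ k) : weakDeriv Ω (dirs i j) (c • q) =ᵐ[volume.restrict Ω]
      c • weakDeriv Ω (dirs i j) q :=
  ((h.isWeakDeriv hij).const_smul c).weakDeriv_ae_eq hΩ

theorem MemH.sub (h : MemH k Ω q) (h' : MemH k Ω q') : MemH k Ω (q - q') := by
  rw [sub_eq_add_neg, ← neg_one_smul ℝ q']
  exact h.add (h'.const_smul _)

theorem MemH.weakDeriv_sub (hΩ : IsOpen Ω) (h : MemH k Ω q) (h' : MemH k Ω q') {i j : ℕ}
    (hij : i + j ≤ k) : weakDeriv Ω (dirs i j) (q - q') =ᵐ[volume.restrict Ω]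
      weakDeriv Ω (dirs i j) q - weakDeriv Ω (dirs i j) q' := by
  rw [sub_eq_add_neg q, ← neg_one_smul ℝ q']
  refine (h.weakDeriv_add hΩ (h'.const_smul _) hij).trans ?_
  filter_upwards [h'.weakDeriv_const_smul hΩ (-1) hij] with p hp
  rw [Pi.add_apply, hp]
  simp [sub_eq_add_neg]

theorem MemH.isWeakDeriv_fst (h : MemH k Ω q) {i j : ℕ} (hij : i + j + 1 ≤ k) :
    IsWeakDeriv Ω [((1, 0) : ℝ × ℝ)] (weakDeriv Ω (dirs i j) q) (weakDeriv Ω (dirs (i + 1) j) q) :=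
  (h.isWeakDeriv (by omega : i + j ≤ k)).cons (h.isWeakDeriv (by omega : i + 1 + j ≤ k))

theorem MemH.isWeakDeriv_snd (h : MemH k Ω q) {i j : ℕ} (hij : i + j + 1 ≤ k) :
    IsWeakDeriv Ω [((0, 1) : ℝ × ℝ)] (weakDeriv Ω (dirs i j) q) (weakDeriv Ω (dirs i (j + 1)) q) :=
  (h.isWeakDeriv (by omega : i + j ≤ k)).cons
    (isWeakDeriv_append_cons.1 (h.isWeakDeriv (by omega : i + (j + 1) ≤ k)))

/-- The parallelogram law of `H^k`. -/
theorem MemH.parallelogram (hΩ : IsOpen Ω) (h : MemH k Ω q) (h' : MemH k Ω q') :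
    normH k Ω (q + q') ^ 2 + normH k Ω (q - q') ^ 2 =
      2 * normH k Ω q ^ 2 + 2 * normH k Ω q' ^ 2 := by
  simp only [normH_sq, Finset.mul_sum, ← Finset.sum_add_distrib]
  refine Finset.sum_congr rfl fun a ha => ?_
  have hij := mem_multiIndices.1 ha
  rw [← integral_add ((h.add h').integrable_sq hΩ hij) ((h.sub h').integrable_sq hΩ hij),
    ← integral_const_mul, ← integral_const_mul,
    ← integral_add ((h.integrable_sq hΩ hij).const_mul _) ((h'.integrable_sq hΩ hij).const_mul _)]
  refine integral_congr_ae ?_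
  filter_upwards [h.weakDeriv_add hΩ h' hij, h.weakDeriv_sub hΩ h' hij] with p h1 h2
  simp only [h1, h2, Pi.add_apply, Pi.sub_apply]
  ring

theorem MemH.normH_const_smul (hΩ : IsOpen Ω) (h : MemH k Ω q) (c : ℝ) :
    normH k Ω (c • q) = |c| * normH k Ω q := by
  rw [← abs_of_nonneg (normH_nonneg (q := c • q)), ← abs_of_nonneg (normH_nonneg (q := q)),
    ← abs_mul, ← sq_eq_sq_iff_abs_eq_abs, mul_pow, normH_sq, normH_sq, Finset.mul_sum]
  refine Finset.sum_congr rfl fun a ha => ?_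
  have hij := mem_multiIndices.1 ha
  rw [← integral_const_mul]
  refine integral_congr_ae ?_
  filter_upwards [h.weakDeriv_const_smul hΩ c hij] with p h1
  simp [h1, mul_pow]

/-- The triangle inequality for sums of squares of `L²` norms. -/
theorem sqrt_sum_integral_sq_add_le {α ι : Type*} [MeasurableSpace α] {μ : Measure α}
    {s : Finset ι} {f g : ι → α → ℝ} (hf : ∀ i ∈ s, MemLp (f i) 2 μ)
    (hg : ∀ i ∈ s, MemLp (g i) 2 μ) :
    √(∑ i ∈ s, ∫ x, (f i x + g i x) ^ 2 ∂μ) ≤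
      √(∑ i ∈ s, ∫ x, f i x ^ 2 ∂μ) + √(∑ i ∈ s, ∫ x, g i x ^ 2 ∂μ) := by
  set F := ∑ i ∈ s, ∫ x, f i x ^ 2 ∂μ with hF
  set G := ∑ i ∈ s, ∫ x, g i x ^ 2 ∂μ with hG
  set X := ∑ i ∈ s, ∫ x, f i x * g i x ∂μ with hX
  have hF0 : 0 ≤ F := Finset.sum_nonneg fun _ _ => integral_nonneg fun _ => sq_nonneg _
  have hG0 : 0 ≤ G := Finset.sum_nonneg fun _ _ => integral_nonneg fun _ => sq_nonneg _
  have hquad : ∀ c d : ℝ, ∑ i ∈ s, ∫ x, (c * f i x + d * g i x) ^ 2 ∂μ =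
      c ^ 2 * F + 2 * c * d * X + d ^ 2 * G := by
    intro c d
    rw [hF, hG, hX, Finset.mul_sum, Finset.mul_sum, Finset.mul_sum, ← Finset.sum_add_distrib,
      ← Finset.sum_add_distrib]
    refine Finset.sum_congr rfl fun i hi => ?_
    have h1 := (hf i hi).integrable_sq
    have h2 := (hg i hi).integrable_sq
    have h3 : Integrable (fun x => f i x * g i x) μ := (hf i hi).integrable_mul (hg i hi)
    rw [← integral_const_mul, ← integral_const_mul, ← integral_const_mul,
      ← integral_add (h1.const_mul _) (h3.const_mul _),
      ← integral_add (by exact (h1.const_mul _).add (h3.const_mul _)) (h2.const_mul _)]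
    congr 1
    ext x
    ring
  have hnn : ∀ c d : ℝ, 0 ≤ c ^ 2 * F + 2 * c * d * X + d ^ 2 * G := fun c d => by
    rw [← hquad]
    exact Finset.sum_nonneg fun _ _ => integral_nonneg fun _ => sq_nonneg _
  have h11 := hquad 1 1
  simp only [one_mul] at h11
  rw [h11]
  apply Real.sqrt_le_iff.2 ⟨by positivity, ?_⟩
  -- Cauchy–Schwarz, from the discriminant of the nonnegative polynomial c ↦ F c² + 2 X c + G.
  have hX' : X ≤ √F * √G := by
    rw [← Real.sqrt_mul hF0]
    apply Real.le_sqrt_of_sq_le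
    have hd := discrim_le_zero (a := F) (b := 2 * X) (c := G) fun c => by
      have := hnn c 1
      nlinarith
    rw [discrim] at hd
    nlinarith
  have e1 := Real.sq_sqrt hF0
  have e2 := Real.sq_sqrt hG0
  nlinarith

theorem MemH.normH_add_le (hΩ : IsOpen Ω) (h : MemH k Ω q) (h' : MemH k Ω q') :
    normH k Ω (q + q') ≤ normH k Ω q + normH k Ω q' := by
  have := sqrt_sum_integral_sq_add_le (μ := volume.restrict Ω) (s := multiIndices k)
    (f := fun a => weakDeriv Ω (dirs a.1 a.2) q) (g := fun a => weakDeriv Ω (dirs a.1 a.2) q')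
    (fun a ha => h.memLp hΩ (mem_multiIndices.1 ha))
    (fun a ha => h'.memLp hΩ (mem_multiIndices.1 ha))
  refine le_trans (le_of_eq ?_) this
  rw [normH]
  congr 1
  refine Finset.sum_congr rfl fun a ha => integral_congr_ae ?_
  filter_upwards [h.weakDeriv_add hΩ h' (mem_multiIndices.1 ha)] with p hp
  simp [hp]

theorem MemH.normH_sub_rev (hΩ : IsOpen Ω) (h : MemH k Ω q) (h' : MemH k Ω q') :
    normH k Ω (q - q') = normH k Ω (q' - q) := by
  have := (h'.sub h).normH_const_smul hΩ (-1)
  simpa using this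

end SobolevSpace

/-! ### Classical derivatives of functions of class `H⁵` -/

/-- The projection onto the closed rectangle `[ε, M] × [0, T]`. -/
noncomputable def projRect (ε M T : ℝ) (p : ℝ × ℝ) : ℝ × ℝ :=
  (max ε (min M p.1), max 0 (min T p.2))

/-- `u i j = ∂_x^i ∂_t^j u 0 0` on the closed rectangle `[ε, M] × [0, T]`, for `i + j ≤ 3`. Outside of
the rectangle, the functions are constant along the fibres of the projection. -/
structure IsC3 (ε M T : ℝ) (u : ℕ → ℕ → ℝ × ℝ → ℝ) : Prop where
  continuous : ∀ {i j}, i + j ≤ 3 → Continuous (u i j)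
  hasDerivAt_x : ∀ {i j}, i + j ≤ 2 → ∀ {x t}, x ∈ Ioo ε M → t ∈ Icc 0 T →
    HasDerivAt (fun s => u i j (s, t)) (u (i + 1) j (x, t)) x
  hasDerivAt_t : ∀ {i j}, i + j ≤ 2 → ∀ {x t}, x ∈ Icc ε M → t ∈ Ioo 0 T →
    HasDerivAt (fun s => u i j (x, s)) (u i (j + 1) (x, t)) t
  apply_projRect : ∀ {i j}, i + j ≤ 3 → ∀ p, u i j (projRect ε M T p) = u i j p

/-- `u i j` represents `∂_x^i ∂_t^j q`, for `i + j ≤ 3`. -/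
structure IsC3Rep (ε M T : ℝ) (q : ℝ × ℝ → ℝ) (u : ℕ → ℕ → ℝ × ℝ → ℝ) : Prop
    extends IsC3 ε M T u where
  memH : MemH 5 (OmegaT ε M T) q
  ae_eq : ∀ {i j}, i + j ≤ 3 →
    weakDeriv (OmegaT ε M T) (dirs i j) q =ᵐ[volume.restrict (OmegaT ε M T)] u i j

section Representative

variable {ε M T : ℝ}

theorem isOpen_OmegaT : IsOpen (OmegaT ε M T) := isOpen_Ioo.prod isOpen_Ioo

instance isFiniteMeasure_restrict_OmegaT : IsFiniteMeasure (volume.restrict (OmegaT ε M T)) := by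
  rw [OmegaT, volume_restrict_prod]
  infer_instance

theorem closure_OmegaT (hM : ε < M) (hT : 0 < T) :
    closure (OmegaT ε M T) = Icc ε M ×ˢ Icc 0 T := by
  rw [OmegaT, closure_prod_eq, closure_Ioo hM.ne, closure_Ioo hT.ne]

theorem projRect_mem (hM : ε < M) (hT : 0 < T) (p : ℝ × ℝ) :
    projRect ε M T p ∈ Icc ε M ×ˢ Icc 0 T :=
  ⟨⟨le_max_left _ _, max_le hM.le (min_le_left _ _)⟩,
    ⟨le_max_left _ _, max_le hT.le (min_le_left _ _)⟩⟩

theorem projRect_eq_self {p : ℝ × ℝ} (hp : p ∈ Icc ε M ×ˢ Icc 0 T) : projRect ε M T p = p := by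
  ext
  · simp [projRect, min_eq_right hp.1.2, max_eq_right hp.1.1]
  · simp [projRect, min_eq_right hp.2.2, max_eq_right hp.2.1]

theorem continuous_projRect : Continuous (projRect ε M T) := by
  unfold projRect
  fun_prop

theorem Continuous.integrableOn_OmegaT {f : ℝ × ℝ → ℝ} (hf : Continuous f) :
    IntegrableOn f (OmegaT ε M T) :=
  (hf.continuousOn.integrableOn_compact (isCompact_Icc.prod isCompact_Icc)).mono_set
    (prod_mono Ioo_subset_Icc_self Ioo_subset_Icc_self)

/-- Pointwise |g| ≤ N + g²/N, so no Hölder inequality is needed; this accounts for the constant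
μ(univ) + 1. The case N = 0 is separate because of the division. -/
theorem integral_abs_le {α : Type*} [MeasurableSpace α] {μ : Measure α} [IsFiniteMeasure μ]
    {g : α → ℝ} (hg : MemLp g 2 μ) {N : ℝ} (hN : 0 ≤ N) (h : ∫ x, g x ^ 2 ∂μ ≤ N ^ 2) :
    ∫ x, |g x| ∂μ ≤ (μ.real univ + 1) * N := by
  rcases hN.eq_or_lt with rfl | hN'
  · have h0 : ∫ x, g x ^ 2 ∂μ = 0 :=
      le_antisymm (by simpa using h) (integral_nonneg fun _ => sq_nonneg _)
    rw [integral_eq_zero_iff_of_nonneg (fun _ => sq_nonneg _) hg.integrable_sq] at h0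
    refine le_of_eq ?_
    rw [mul_zero]
    refine integral_eq_zero_of_ae ?_
    filter_upwards [h0] with x hx
    simpa using hx
  have hi : Integrable (fun x => |g x|) μ := (hg.integrable one_le_two).abs
  have h1 : ∫ x, |g x| ∂μ ≤ ∫ x, (N + N⁻¹ * g x ^ 2) ∂μ := by
    refine integral_mono hi ((integrable_const N).add (hg.integrable_sq.const_mul _)) fun x => ?_
    have := mul_inv_cancel₀ hN'.ne'
    have e : N + N⁻¹ * g x ^ 2 - |g x| = N⁻¹ * ((|g x| - N / 2) ^ 2 + 3 / 4 * N ^ 2) := by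
      rw [← sq_abs (g x)]
      field_simp
      ring
    have : 0 ≤ N⁻¹ * ((|g x| - N / 2) ^ 2 + 3 / 4 * N ^ 2) := by positivity
    simp only
    linarith
  rw [integral_add (integrable_const N) (hg.integrable_sq.const_mul _), integral_const_mul] at h1
  have h2 : N⁻¹ * ∫ x, g x ^ 2 ∂μ ≤ N := by
    calc N⁻¹ * ∫ x, g x ^ 2 ∂μ ≤ N⁻¹ * N ^ 2 := by gcongr
      _ = N := by field_simp
  simp only [integral_const, smul_eq_mul] at h1
  linarith

/-- The embedding of `H⁵` into `C³`. -/
theorem exists_isC3Rep (hM : ε < M) (hT : 0 < T) :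
    ∃ C : ℝ, 0 < C ∧ ∀ q, MemH 5 (OmegaT ε M T) q → ∃ u, IsC3Rep ε M T q u ∧
      ∀ {i j}, i + j ≤ 3 → ∀ p, |u i j p| ≤ C * normH 5 (OmegaT ε M T) q := by
  obtain ⟨C, hC, hrep⟩ := exists_continuous_representative hM hT
  set A := (volume.restrict (OmegaT ε M T)).real univ + 1 with hA
  have hA0 : 0 < A := by positivity
  refine ⟨C * (4 * A), by positivity, fun q hq => ?_⟩
  have hΩ : IsOpen (OmegaT ε M T) := isOpen_OmegaT
  have hint : ∀ {i j}, i + j ≤ 5 → IntegrableOn (weakDeriv (OmegaT ε M T) (dirs i j) q)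
      (OmegaT ε M T) := fun hij => (hq.memLp hΩ hij).integrable one_le_two
  have hL1 : ∀ {i j}, i + j ≤ 5 → ∫ p in OmegaT ε M T, |weakDeriv (OmegaT ε M T) (dirs i j) q p| ≤
      A * normH 5 (OmegaT ε M T) q := fun hij =>
    integral_abs_le (hq.memLp hΩ hij) normH_nonneg (integral_sq_le_normH_sq hij)
  have hex : ∀ i j, ∃ U : ℝ × ℝ → ℝ, i + j ≤ 3 → Continuous U ∧
      weakDeriv (OmegaT ε M T) (dirs i j) q =ᵐ[volume.restrict (OmegaT ε M T)] U ∧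
      ∀ p, |U p| ≤ C * (4 * A) * normH 5 (OmegaT ε M T) q := by
    intro i j
    by_cases hij : i + j ≤ 3
    -- The continuity of a derivative of order i + j costs one more derivative in each variable.
    -- With i + j ≤ 3 this uses order 5.
    · obtain ⟨U, hU1, hU2, hU3⟩ := hrep _ _ _ _ (hint (by omega : i + j ≤ 5))
        (hint (by omega : (i + 1) + j ≤ 5)) (hint (by omega : i + (j + 1) ≤ 5))
        (hint (by omega : (i + 1) + (j + 1) ≤ 5))
        (fun φ ψ => (hq.isWeakDeriv_fst (by omega)).integral_fst)
        (fun φ ψ => (hq.isWeakDeriv_snd (by omega)).integral_snd)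
        (fun φ ψ => (hq.isWeakDeriv_snd (by omega)).integral_snd)
      refine ⟨U, fun _ => ⟨hU1, hU2, fun p => (hU3 p).trans ?_⟩⟩
      rw [mul_assoc]
      refine mul_le_mul_of_nonneg_left ?_ hC.le
      have h1 := hL1 (by omega : i + j ≤ 5)
      have h2 := hL1 (by omega : (i + 1) + j ≤ 5)
      have h3 := hL1 (by omega : i + (j + 1) ≤ 5)
      have h4 := hL1 (by omega : (i + 1) + (j + 1) ≤ 5)
      simp only [OmegaT] at h1 h2 h3 h4 ⊢
      linarith
    · exact ⟨0, fun h => absurd h hij⟩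
  choose u hu using hex
  -- Composition with the projection keeps the functions globally continuous and fixes their values
  -- outside the rectangle, where the almost everywhere equality says nothing.
  refine ⟨fun i j p => u i j (projRect ε M T p), ⟨⟨fun hij => (hu _ _ hij).1.comp
    continuous_projRect, fun {i j} hij x t hx ht => ?_, fun {i j} hij x t hx ht => ?_,
    fun hij p => ?_⟩, hq, fun hij => ?_⟩, fun hij p => (hu _ _ hij).2.2 _⟩
  · have h0 := hu i j (by omega)
    have h1 := hu (i + 1) j (by omega)
    simp only [projRect_eq_self (show (x, t) ∈ _ from ⟨Ioo_subset_Icc_self hx, ht⟩)]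
    refine (((hq.isWeakDeriv_fst (by omega)).congr h0.2.1 h1.2.1).hasDerivAt_fst hM hT h0.1 h1.1
      hx ht).congr_of_eventuallyEq ?_
    filter_upwards [Ioo_mem_nhds hx.1 hx.2] with s hs
    rw [projRect_eq_self (show (s, t) ∈ _ from ⟨Ioo_subset_Icc_self hs, ht⟩)]
  · have h0 := hu i j (by omega)
    have h1 := hu i (j + 1) (by omega)
    simp only [projRect_eq_self (show (x, t) ∈ _ from ⟨hx, Ioo_subset_Icc_self ht⟩)]
    refine (((hq.isWeakDeriv_snd (by omega)).congr h0.2.1 h1.2.1).hasDerivAt_snd hM hT h0.1 h1.1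
      hx ht).congr_of_eventuallyEq ?_
    filter_upwards [Ioo_mem_nhds ht.1 ht.2] with s hs
    rw [projRect_eq_self (show (x, s) ∈ _ from ⟨hx, Ioo_subset_Icc_self hs⟩)]
  · rw [projRect_eq_self (projRect_mem hM hT p)]
  · refine (hu _ _ hij).2.1.trans ((ae_restrict_iff' hΩ.measurableSet).2
      (Filter.Eventually.of_forall fun p hp => ?_))
    exact congrArg _
      (projRect_eq_self ⟨Ioo_subset_Icc_self hp.1, Ioo_subset_Icc_self hp.2⟩).symm

theorem eqOn_closure_OmegaT {f g : ℝ × ℝ → ℝ}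
    (hf : ContinuousOn f (closure (OmegaT ε M T))) (hg : ContinuousOn g (closure (OmegaT ε M T)))
    (h : f =ᵐ[volume.restrict (OmegaT ε M T)] g) : EqOn f g (closure (OmegaT ε M T)) :=
  (Measure.eqOn_open_of_ae_eq h isOpen_OmegaT (hf.mono subset_closure)
    (hg.mono subset_closure)).of_subset_closure hf hg subset_closure subset_rfl

theorem contRep_eq {f g : ℝ × ℝ → ℝ} (hg : Continuous g)
    (h : f =ᵐ[volume.restrict (OmegaT ε M T)] g) :
    EqOn (contRep (OmegaT ε M T) f) g (closure (OmegaT ε M T)) := by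
  have hex : ∃ g : ℝ × ℝ → ℝ, ContinuousOn g (closure (OmegaT ε M T)) ∧
    f =ᵐ[volume.restrict (OmegaT ε M T)] g := ⟨g, hg.continuousOn, h⟩
  rw [contRep, dif_pos hex]
  exact eqOn_closure_OmegaT hex.choose_spec.1 hg.continuousOn (hex.choose_spec.2.symm.trans h)

namespace IsC3Rep

variable {q q' : ℝ × ℝ → ℝ} {u u' : ℕ → ℕ → ℝ × ℝ → ℝ}

theorem ae_eq_self (h : IsC3Rep ε M T q u) : q =ᵐ[volume.restrict (OmegaT ε M T)] u 0 0 :=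
  (ae_eq_of_isWeakDeriv_nil isOpen_OmegaT (h.memH.isWeakDeriv (by norm_num : 0 + 0 ≤ 5))).trans
    (h.ae_eq (by norm_num))

theorem val_eq (h : IsC3Rep ε M T q u) (hM : ε < M) (hT : 0 < T) {x t : ℝ} (hx : x ∈ Icc ε M)
    (ht : t ∈ Icc 0 T) : val ε M T q x t = u 0 0 (x, t) :=
  contRep_eq (h.continuous (by norm_num)) h.ae_eq_self
    (by rw [closure_OmegaT hM hT]; exact ⟨hx, ht⟩)

theorem valX_eq (h : IsC3Rep ε M T q u) (hM : ε < M) (hT : 0 < T) {x t : ℝ} (hx : x ∈ Icc ε M)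
    (ht : t ∈ Icc 0 T) : valX ε M T q x t = u 1 0 (x, t) :=
  contRep_eq (h.continuous (by norm_num)) (h.ae_eq (by norm_num))
    (by rw [closure_OmegaT hM hT]; exact ⟨hx, ht⟩)

/-- Values on the closed rectangle are forced by continuity, all others by the projection. Thus
representatives obtained from different choices may be interchanged. -/
theorem unique (h : IsC3Rep ε M T q u) (h' : IsC3Rep ε M T q u') (hM : ε < M) (hT : 0 < T)
    {i j : ℕ} (hij : i + j ≤ 3) : u i j = u' i j := by
  ext p
  rw [← h.apply_projRect hij, ← h'.apply_projRect hij]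
  exact eqOn_closure_OmegaT (h.continuous hij).continuousOn (h'.continuous hij).continuousOn
    ((h.ae_eq hij).symm.trans (h'.ae_eq hij))
    (by rw [closure_OmegaT hM hT]; exact projRect_mem hM hT p)

theorem add (h : IsC3Rep ε M T q u) (h' : IsC3Rep ε M T q' u') :
    IsC3Rep ε M T (q + q') (fun i j => u i j + u' i j) where
  continuous hij := (h.continuous hij).add (h'.continuous hij)
  hasDerivAt_x hij _ _ hx ht := (h.hasDerivAt_x hij hx ht).add (h'.hasDerivAt_x hij hx ht)
  hasDerivAt_t hij _ _ hx ht := (h.hasDerivAt_t hij hx ht).add (h'.hasDerivAt_t hij hx ht)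
  apply_projRect hij p := congrArg₂ (· + ·) (h.apply_projRect hij p) (h'.apply_projRect hij p)
  memH := h.memH.add h'.memH
  ae_eq hij := (h.memH.weakDeriv_add isOpen_OmegaT h'.memH (by omega)).trans
    ((h.ae_eq hij).add (h'.ae_eq hij))

theorem const_smul (h : IsC3Rep ε M T q u) (c : ℝ) :
    IsC3Rep ε M T (c • q) (fun i j => c • u i j) where
  continuous hij := (h.continuous hij).const_smul c
  hasDerivAt_x hij _ _ hx ht := (h.hasDerivAt_x hij hx ht).const_smul c
  hasDerivAt_t hij _ _ hx ht := (h.hasDerivAt_t hij hx ht).const_smul c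
  apply_projRect hij p := congrArg (c • ·) (h.apply_projRect hij p)
  memH := h.memH.const_smul c
  ae_eq hij := (h.memH.weakDeriv_const_smul isOpen_OmegaT c (by omega)).trans
    ((h.ae_eq hij).const_smul c)

theorem sub (h : IsC3Rep ε M T q u) (h' : IsC3Rep ε M T q' u') :
    IsC3Rep ε M T (q - q') (fun i j => u i j - u' i j) where
  continuous hij := (h.continuous hij).sub (h'.continuous hij)
  hasDerivAt_x hij _ _ hx ht := (h.hasDerivAt_x hij hx ht).sub (h'.hasDerivAt_x hij hx ht)
  hasDerivAt_t hij _ _ hx ht := (h.hasDerivAt_t hij hx ht).sub (h'.hasDerivAt_t hij hx ht)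
  apply_projRect hij p := congrArg₂ (· - ·) (h.apply_projRect hij p) (h'.apply_projRect hij p)
  memH := h.memH.sub h'.memH
  ae_eq hij := (h.memH.weakDeriv_sub isOpen_OmegaT h'.memH (by omega)).trans
    ((h.ae_eq hij).sub (h'.ae_eq hij))

/-- Bounds on one system of classical derivatives are bounds on all of them. -/
theorem abs_le (h : IsC3Rep ε M T q u) (hM : ε < M) (hT : 0 < T) {C : ℝ}
    (hC : ∀ q, MemH 5 (OmegaT ε M T) q → ∃ u, IsC3Rep ε M T q u ∧
      ∀ {i j}, i + j ≤ 3 → ∀ p, |u i j p| ≤ C * normH 5 (OmegaT ε M T) q)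
    {i j : ℕ} (hij : i + j ≤ 3) (p : ℝ × ℝ) :
    |u i j p| ≤ C * normH 5 (OmegaT ε M T) q := by
  obtain ⟨u', h', hb⟩ := hC q h.memH
  rw [h.unique h' hM hT hij]
  exact hb hij p

end IsC3Rep

end Representative

/-! ### Completeness of `H^k` -/

theorem IsTestFunction.memLp {E : Type*} [NormedAddCommGroup E] [NormedSpace ℝ E] [MeasurableSpace E]
    [BorelSpace E] [SecondCountableTopology E] {Ω : Set E} {φ : E → ℝ} (hφ : IsTestFunction Ω φ)
    {μ : Measure E} [IsFiniteMeasure μ] : MemLp φ 2 μ := by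
  obtain ⟨C, hC⟩ := hφ.exists_bound
  exact MemLp.of_bound hφ.1.continuous.aestronglyMeasurable C (Filter.Eventually.of_forall hC)

theorem norm_toLp_sq {α : Type*} [MeasurableSpace α] {μ : Measure α} {f : α → ℝ}
    (hf : MemLp f 2 μ) : ‖hf.toLp f‖ ^ 2 = ∫ x, f x ^ 2 ∂μ := by
  rw [← real_inner_self_eq_norm_sq, L2.inner_def]
  refine integral_congr_ae ?_
  filter_upwards [hf.coeFn_toLp] with x hx
  rw [hx, real_inner_self_eq_norm_sq, Real.norm_eq_abs, sq_abs]

theorem inner_toLp {α : Type*} [MeasurableSpace α] {μ : Measure α} {f : α → ℝ}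
    (hf : MemLp f 2 μ) (g : Lp ℝ 2 μ) : inner ℝ (hf.toLp f) g = ∫ x, g x * f x ∂μ := by
  rw [L2.inner_def]
  refine integral_congr_ae ?_
  filter_upwards [hf.coeFn_toLp] with x hx
  rw [hx]
  simp

/-- Each weak derivative converges in L². Pairing with a fixed test function is continuous in L², so
the limits are the weak derivatives of the limit of order zero. -/
theorem exists_tendsto_normH {k : ℕ} {Ω : Set (ℝ × ℝ)} (hΩ : IsOpen Ω)
    [IsFiniteMeasure (volume.restrict Ω)] {q : ℕ → ℝ × ℝ → ℝ} (hq : ∀ n, MemH k Ω (q n))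
    (hc : ∀ r > 0, ∃ N, ∀ m ≥ N, ∀ n ≥ N, normH k Ω (q m - q n) < r) :
    ∃ q' , MemH k Ω q' ∧ Filter.Tendsto (fun n => normH k Ω (q n - q')) Filter.atTop (nhds 0) := by
  have hlim : ∀ i j, ∃ g : Lp ℝ 2 (volume.restrict Ω), ∀ hij : i + j ≤ k,
      Filter.Tendsto (fun n => ((hq n).memLp hΩ hij).toLp) Filter.atTop (nhds g) := by
    intro i j
    by_cases hij : i + j ≤ k
    · have : CauchySeq fun n => ((hq n).memLp hΩ hij).toLp := by
        refine Metric.cauchySeq_iff.2 fun r hr => ?_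
        obtain ⟨N, hN⟩ := hc r hr
        refine ⟨N, fun m hm n hn => ?_⟩
        refine lt_of_le_of_lt ?_ (hN m hm n hn)
        rw [dist_eq_norm, ← MemLp.toLp_sub]
        refine abs_le_of_sq_le_sq' ?_ normH_nonneg |>.2
        rw [norm_toLp_sq]
        refine le_trans (le_of_eq (integral_congr_ae ?_)) (integral_sq_le_normH_sq hij)
        filter_upwards [(hq m).weakDeriv_sub hΩ (hq n) hij] with p hp
        simp [hp]
      obtain ⟨g, hg⟩ := cauchySeq_tendsto_of_complete this
      exact ⟨g, fun _ => hg⟩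
    · exact ⟨0, fun h => absurd h hij⟩
  choose g hg using hlim
  have hloc : ∀ i j, LocallyIntegrableOn (g i j) Ω := fun i j =>
    IntegrableOn.locallyIntegrableOn ((Lp.memLp (g i j)).integrable one_le_two)
  have htest : ∀ i j (hij : i + j ≤ k) φ, IsTestFunction Ω φ →
      Filter.Tendsto (fun n => ∫ p in Ω, weakDeriv Ω (dirs i j) (q n) p * φ p) Filter.atTop
        (nhds (∫ p in Ω, g i j p * φ p)) := by
    intro i j hij φ hφ
    have := (tendsto_const_nhds (x := (hφ.memLp (μ := volume.restrict Ω)).toLp)).inner (𝕜 := ℝ)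
      (hg i j hij)
    rw [inner_toLp] at this
    refine this.congr fun n => ?_
    rw [inner_toLp]
    refine integral_congr_ae ?_
    filter_upwards [((hq n).memLp hΩ hij).coeFn_toLp] with p hp
    rw [hp]
  have hweak : ∀ i j, i + j ≤ k → IsWeakDeriv Ω (dirs i j) (g 0 0) (g i j) := by
    intro i j hij
    refine ⟨hloc 0 0, hloc i j, fun φ hφ => ?_⟩
    refine tendsto_nhds_unique (htest 0 0 (by omega) _ (hφ.foldr_dirDeriv _))
      (((htest i j hij φ hφ).const_mul _).congr fun n => ?_)
    rw [← ((hq n).isWeakDeriv hij).2.2 φ hφ]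
    refine integral_congr_ae ?_
    filter_upwards [ae_eq_of_isWeakDeriv_nil hΩ ((hq n).isWeakDeriv (by omega : 0 + 0 ≤ k))]
      with p hp
    rw [hp]
  have hmem : MemH k Ω (g 0 0) := fun a ha =>
    ⟨g a.1 a.2, Lp.memLp _, hweak _ _ (mem_multiIndices.1 ha)⟩
  refine ⟨g 0 0, hmem, ?_⟩
  have hsq : Filter.Tendsto (fun n => normH k Ω (q n - g 0 0) ^ 2) Filter.atTop (nhds 0) := by
    have : Filter.Tendsto (fun n => ∑ a ∈ multiIndices k,
        ∫ p in Ω, (weakDeriv Ω (dirs a.1 a.2) (q n - g 0 0) p) ^ 2) Filter.atTop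
        (nhds (∑ a ∈ multiIndices k, 0)) := by
      refine tendsto_finsetSum _ fun a ha => ?_
      have hij := mem_multiIndices.1 ha
      have h1 := ((tendsto_iff_norm_sub_tendsto_zero.1 (hg a.1 a.2 hij)).pow 2)
      rw [zero_pow two_ne_zero] at h1
      refine h1.congr fun n => ?_
      rw [← Lp.toLp_coeFn (g a.1 a.2) (Lp.memLp _), ← MemLp.toLp_sub, norm_toLp_sq]
      refine integral_congr_ae ?_
      filter_upwards [(hq n).weakDeriv_sub hΩ hmem hij, (hweak _ _ hij).weakDeriv_ae_eq hΩ]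
        with p h1 h2
      simp [h1, h2]
    simpa [normH_sq] using this
  have := hsq.sqrt
  simpa [Real.sqrt_sq normH_nonneg] using this

/-! ### The functional in terms of classical derivatives -/

/-- The operator F on a family of classical derivatives. It makes sense at every point and is
continuous wherever the trace at t = 0 does not vanish. -/
noncomputable def opC (u : ℕ → ℕ → ℝ × ℝ → ℝ) (p : ℝ × ℝ) : ℝ :=
  u 2 0 p - u 1 1 p / (2 * u 0 0 (p.1, 0) ^ 2) + u 0 1 p * u 1 0 (p.1, 0) / (2 * u 0 0 (p.1, 0) ^ 3)

section Functional

variable {ε M T : ℝ} {q q' : ℝ × ℝ → ℝ} {u u' : ℕ → ℕ → ℝ × ℝ → ℝ}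

theorem ae_restrict_OmegaT {P : ℝ × ℝ → Prop} (h : ∀ p ∈ OmegaT ε M T, P p) :
    ∀ᵐ p ∂(volume.restrict (OmegaT ε M T)), P p :=
  (ae_restrict_iff' isOpen_OmegaT.measurableSet).2 (Filter.Eventually.of_forall h)

theorem IsC3Rep.opF_ae_eq (h : IsC3Rep ε M T q u) (hM : ε < M) (hT : 0 < T) :
    opF ε M T q =ᵐ[volume.restrict (OmegaT ε M T)] opC u := by
  filter_upwards [h.ae_eq (i := 2) (j := 0) (by norm_num), h.ae_eq (i := 1) (j := 1) (by norm_num),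
    h.ae_eq (i := 0) (j := 1) (by norm_num), ae_restrict_OmegaT (fun p hp => hp)] with p h1 h2 h3 hp
  have hx := Ioo_subset_Icc_self hp.1
  have ht : (0 : ℝ) ∈ Icc 0 T := ⟨le_rfl, hT.le⟩
  rw [opF, opC, h1, h2, h3, h.val_eq hM hT hx ht, h.valX_eq hM hT hx ht]

theorem IsC3Rep.funJ_eq (h : IsC3Rep ε M T q u) (hM : ε < M) (hT : 0 < T) (lam α β : ℝ) :
    funJ ε M T lam α β q = (∫ p in OmegaT ε M T,
      Real.exp (-2 * lam * (p.1 + α * p.2)) * opC u p ^ 2) + β * normH 5 (OmegaT ε M T) q ^ 2 := by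
  rw [funJ]
  congr 1
  refine integral_congr_ae ?_
  filter_upwards [h.opF_ae_eq hM hT] with p hp
  rw [hp, sq_abs]

/-- In this form admissibility consists of pointwise affine equations and one pointwise inequality,
so it passes to midpoints, to limits in H⁵ and to shifts of the data. -/
theorem IsC3Rep.mem_admissible_iff (h : IsC3Rep ε M T q u) (hM : ε < M) (hT : 0 < T) {cbar : ℝ}
    {g₀ g₁ : ℝ → ℝ} : q ∈ admissible ε M T cbar g₀ g₁ ↔
      (∀ t ∈ Icc 0 T, u 0 0 (ε, t) = g₀ (t + ε)) ∧
      (∀ t ∈ Icc 0 T, u 1 0 (ε, t) = g₁ (t + ε) + derivWithin g₀ (Icc ε (T + ε)) (t + ε)) ∧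
      (∀ t ∈ Icc 0 T, u 1 0 (M, t) = 0) ∧ ∀ x ∈ Icc ε M, qLower cbar ≤ u 0 0 (x, 0) := by
  have hε : ε ∈ Icc ε M := left_mem_Icc.2 hM.le
  have hM' : M ∈ Icc ε M := right_mem_Icc.2 hM.le
  have h0 : (0 : ℝ) ∈ Icc 0 T := ⟨le_rfl, hT.le⟩
  rw [admissible, mem_ofPred_eq, and_iff_right h.memH]
  refine and_congr (forall₂_congr fun t ht => ?_) (and_congr (forall₂_congr fun t ht => ?_)
    (and_congr (forall₂_congr fun t ht => ?_) (forall₂_congr fun x hx => ?_)))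
  · rw [h.val_eq hM hT hε ht]
  · rw [h.valX_eq hM hT hε ht]
  · rw [h.valX_eq hM hT hM' ht]
  · rw [h.val_eq hM hT hx h0]

end Functional

/-! ### Carleman estimates -/

/-- The Carleman weight. -/
noncomputable def carlemanWeight (lam α : ℝ) (p : ℝ × ℝ) : ℝ :=
  Real.exp (-2 * lam * (p.1 + α * p.2))

section Carleman

variable {ε M T lam α : ℝ}

theorem carlemanWeight_pos (p : ℝ × ℝ) : 0 < carlemanWeight lam α p := Real.exp_pos _

@[fun_prop]
theorem continuous_carlemanWeight : Continuous (carlemanWeight lam α) := by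
  unfold carlemanWeight
  fun_prop

theorem hasDerivAt_carlemanWeight_x (x t : ℝ) :
    HasDerivAt (fun s => carlemanWeight lam α (s, t)) (-2 * lam * carlemanWeight lam α (x, t)) x := by
  have h : HasDerivAt (fun s : ℝ => -2 * lam * (s + α * t)) (-2 * lam * 1) x :=
    ((hasDerivAt_id x).add_const _).const_mul _
  have := h.exp
  simp only [carlemanWeight]
  convert this using 1
  ring

theorem hasDerivAt_carlemanWeight_t (x t : ℝ) :
    HasDerivAt (fun s => carlemanWeight lam α (x, s))
      (-2 * lam * α * carlemanWeight lam α (x, t)) t := by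
  have h : HasDerivAt (fun s : ℝ => -2 * lam * (x + α * s)) (-2 * lam * (α * 1)) t :=
    (((hasDerivAt_id t).const_mul α).const_add x).const_mul _
  have := h.exp
  simp only [carlemanWeight]
  convert this using 1
  ring

theorem carlemanWeight_eq_mul (x t : ℝ) :
    carlemanWeight lam α (x, t) = Real.exp (-2 * lam * α * t) * carlemanWeight lam α (x, 0) := by
  simp only [carlemanWeight, ← Real.exp_add]
  congr 1
  ring

theorem integral_OmegaT_eq (hM : ε < M) (hT : 0 < T) {f : ℝ × ℝ → ℝ} (hf : Continuous f) :
    ∫ p in OmegaT ε M T, f p = ∫ x in ε..M, ∫ t in 0..T, f (x, t) := by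
  have := hf.integrableOn_OmegaT (ε := ε) (M := M) (T := T)
  rw [OmegaT, Measure.volume_eq_prod] at *
  rw [setIntegral_prod _ this, setIntegral_Ioo_eq_intervalIntegral hM.le]
  simp only [setIntegral_Ioo_eq_intervalIntegral hT.le]

theorem integral_OmegaT_eq_swap (hM : ε < M) (hT : 0 < T) {f : ℝ × ℝ → ℝ} (hf : Continuous f) :
    ∫ p in OmegaT ε M T, f p = ∫ t in 0..T, ∫ x in ε..M, f (x, t) := by
  have := hf.integrableOn_OmegaT (ε := ε) (M := M) (T := T)
  rw [OmegaT, IntegrableOn, volume_restrict_prod] at *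
  rw [integral_prod_symm _ this, setIntegral_Ioo_eq_intervalIntegral hT.le]
  simp only [setIntegral_Ioo_eq_intervalIntegral hM.le]

theorem integral_OmegaT_deriv_x (hM : ε < M) (hT : 0 < T) {G g : ℝ × ℝ → ℝ} (hG : Continuous G)
    (hg : Continuous g)
    (h : ∀ x ∈ Ioo ε M, ∀ t ∈ Icc 0 T, HasDerivAt (fun s => G (s, t)) (g (x, t)) x) :
    ∫ p in OmegaT ε M T, g p = ∫ t in 0..T, (G (M, t) - G (ε, t)) := by
  rw [integral_OmegaT_eq_swap hM hT hg]
  refine intervalIntegral.integral_congr fun t ht => ?_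
  rw [uIcc_of_le hT.le] at ht
  exact intervalIntegral.integral_eq_sub_of_hasDerivAt_of_le hM.le (by fun_prop)
    (fun x hx => h x hx t ht) (Continuous.intervalIntegrable (by fun_prop) _ _)

theorem integral_OmegaT_deriv_t (hM : ε < M) (hT : 0 < T) {G g : ℝ × ℝ → ℝ} (hG : Continuous G)
    (hg : Continuous g)
    (h : ∀ x ∈ Icc ε M, ∀ t ∈ Ioo 0 T, HasDerivAt (fun s => G (x, s)) (g (x, t)) t) :
    ∫ p in OmegaT ε M T, g p = ∫ x in ε..M, (G (x, T) - G (x, 0)) := by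
  rw [integral_OmegaT_eq hM hT hg]
  refine intervalIntegral.integral_congr fun x hx => ?_
  rw [uIcc_of_le hM.le] at hx
  exact intervalIntegral.integral_eq_sub_of_hasDerivAt_of_le hT.le (by fun_prop)
    (fun t ht => h x hx t ht) (Continuous.intervalIntegrable (by fun_prop) _ _)

theorem setIntegral_OmegaT_mono {f g : ℝ × ℝ → ℝ} (hf : Continuous f) (hg : Continuous g)
    (h : ∀ p ∈ OmegaT ε M T, f p ≤ g p) :
    ∫ p in OmegaT ε M T, f p ≤ ∫ p in OmegaT ε M T, g p :=
  setIntegral_mono_on hf.integrableOn_OmegaT hg.integrableOn_OmegaT isOpen_OmegaT.measurableSet h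

/-- A weighted Hardy inequality in the `x` variable. -/
theorem sq_mul_integral_carlemanWeight_le (hM : ε < M) (hT : 0 < T) (hlam : 0 < lam)
    {z zx : ℝ × ℝ → ℝ} (hz : Continuous z) (hzx : Continuous zx)
    (hd : ∀ x ∈ Ioo ε M, ∀ t ∈ Icc 0 T, HasDerivAt (fun s => z (s, t)) (zx (x, t)) x)
    (h0 : ∀ t ∈ Icc 0 T, z (ε, t) = 0) :
    lam ^ 2 * ∫ p in OmegaT ε M T, carlemanWeight lam α p * z p ^ 2 ≤
      ∫ p in OmegaT ε M T, carlemanWeight lam α p * zx p ^ 2 := by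
  have h1 := integral_OmegaT_deriv_x hM hT (G := fun p => carlemanWeight lam α p * z p ^ 2)
    (g := fun p => carlemanWeight lam α p * (-2 * lam * z p ^ 2 + 2 * z p * zx p))
    -- Integrate the x-derivative of w z²: the boundary term at x = M is nonnegative and the one at
    -- x = ε vanishes. Completing the square (λz - z_x)² then gives the claim.
    (by fun_prop) (by fun_prop) fun x hx t ht => by
      refine HasDerivAt.congr_deriv ((hasDerivAt_carlemanWeight_x x t).mul ((hd x hx t ht).pow 2)) ?_
      simp
      ring
  have h2 : 0 ≤ ∫ t in 0..T, (carlemanWeight lam α (M, t) * z (M, t) ^ 2 -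
      carlemanWeight lam α (ε, t) * z (ε, t) ^ 2) := by
    refine intervalIntegral.integral_nonneg hT.le fun t ht => ?_
    rw [h0 t ht]
    have := carlemanWeight_pos (lam := lam) (α := α) (M, t)
    simp only [ne_eq, OfNat.ofNat_ne_zero, not_false_eq_true, zero_pow, mul_zero, sub_zero]
    positivity
  have h3 : ∫ p in OmegaT ε M T,
      carlemanWeight lam α p * (-2 * lam * z p ^ 2 + 2 * z p * zx p) ≤
      ∫ p in OmegaT ε M T, (-lam * (carlemanWeight lam α p * z p ^ 2) +
        lam⁻¹ * (carlemanWeight lam α p * zx p ^ 2)) := by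
    refine setIntegral_OmegaT_mono (by fun_prop) (by fun_prop) fun p _ => ?_
    have hp := carlemanWeight_pos (lam := lam) (α := α) p
    have e : -lam * (carlemanWeight lam α p * z p ^ 2) +
        lam⁻¹ * (carlemanWeight lam α p * zx p ^ 2) -
        carlemanWeight lam α p * (-2 * lam * z p ^ 2 + 2 * z p * zx p) =
        carlemanWeight lam α p * lam⁻¹ * (lam * z p - zx p) ^ 2 := by
      field_simp
      ring
    have : 0 ≤ carlemanWeight lam α p * lam⁻¹ * (lam * z p - zx p) ^ 2 := by positivity
    linarith
  rw [integral_add (by fun_prop : Continuous _).integrableOn_OmegaT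
    (by fun_prop : Continuous _).integrableOn_OmegaT, integral_const_mul, integral_const_mul] at h3
  have h4 : 0 ≤ -lam * (∫ p in OmegaT ε M T, carlemanWeight lam α p * z p ^ 2) +
      lam⁻¹ * ∫ p in OmegaT ε M T, carlemanWeight lam α p * zx p ^ 2 := by linarith
  have h5 := mul_nonneg hlam.le h4
  rw [mul_add, ← mul_assoc lam lam⁻¹, mul_inv_cancel₀ hlam.ne'] at h5
  linarith

/-- A weighted Hardy inequality on an interval. -/
theorem sq_mul_intervalIntegral_carlemanWeight_le (hM : ε < M) (hlam : 0 < lam)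
    {z zx : ℝ → ℝ} (hz : Continuous z) (hzx : Continuous zx)
    (hd : ∀ x ∈ Ioo ε M, HasDerivAt z (zx x) x) (h0 : z ε = 0) :
    lam ^ 2 * ∫ x in ε..M, carlemanWeight lam α (x, 0) * z x ^ 2 ≤
      ∫ x in ε..M, carlemanWeight lam α (x, 0) * zx x ^ 2 := by
  have h1 : ∫ x in ε..M, carlemanWeight lam α (x, 0) * (-2 * lam * z x ^ 2 + 2 * z x * zx x) =
      carlemanWeight lam α (M, 0) * z M ^ 2 - carlemanWeight lam α (ε, 0) * z ε ^ 2 := by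
    refine intervalIntegral.integral_eq_sub_of_hasDerivAt_of_le hM.le
      (f := fun x => carlemanWeight lam α (x, 0) * z x ^ 2) (by fun_prop)
      (fun x hx => ?_) (Continuous.intervalIntegrable (by fun_prop) _ _)
    refine HasDerivAt.congr_deriv ((hasDerivAt_carlemanWeight_x x 0).mul ((hd x hx).pow 2)) ?_
    simp
    ring
  have h2 : 0 ≤ carlemanWeight lam α (M, 0) * z M ^ 2 := by
    have := carlemanWeight_pos (lam := lam) (α := α) (M, 0)
    positivity
  have h3 : ∫ x in ε..M, carlemanWeight lam α (x, 0) * (-2 * lam * z x ^ 2 + 2 * z x * zx x) ≤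
      ∫ x in ε..M, (-lam * (carlemanWeight lam α (x, 0) * z x ^ 2) +
        lam⁻¹ * (carlemanWeight lam α (x, 0) * zx x ^ 2)) := by
    refine intervalIntegral.integral_mono_on hM.le
      (Continuous.intervalIntegrable (by fun_prop) _ _)
      (Continuous.intervalIntegrable (by fun_prop) _ _) fun x _ => ?_
    have hp := carlemanWeight_pos (lam := lam) (α := α) (x, 0)
    have e : -lam * (carlemanWeight lam α (x, 0) * z x ^ 2) +
        lam⁻¹ * (carlemanWeight lam α (x, 0) * zx x ^ 2) -
        carlemanWeight lam α (x, 0) * (-2 * lam * z x ^ 2 + 2 * z x * zx x) =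
        carlemanWeight lam α (x, 0) * lam⁻¹ * (lam * z x - zx x) ^ 2 := by
      field_simp
      ring
    have : 0 ≤ carlemanWeight lam α (x, 0) * lam⁻¹ * (lam * z x - zx x) ^ 2 := by positivity
    linarith
  rw [intervalIntegral.integral_add (Continuous.intervalIntegrable (by fun_prop) _ _)
    (Continuous.intervalIntegrable (by fun_prop) _ _), intervalIntegral.integral_const_mul,
    intervalIntegral.integral_const_mul] at h3
  rw [h0] at h1
  have h4 : 0 ≤ -lam * (∫ x in ε..M, carlemanWeight lam α (x, 0) * z x ^ 2) +
      lam⁻¹ * ∫ x in ε..M, carlemanWeight lam α (x, 0) * zx x ^ 2 := by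
    simp only [ne_eq, OfNat.ofNat_ne_zero, not_false_eq_true, zero_pow, mul_zero, sub_zero] at h1
    linarith
  have h5 := mul_nonneg hlam.le h4
  rw [mul_add, ← mul_assoc lam lam⁻¹, mul_inv_cancel₀ hlam.ne'] at h5
  linarith

/-- The Carleman estimate for the transport operator `∂_x - a(x) ∂_t`. -/
theorem carleman_transport (hM : ε < M) (hT : 0 < T) (hlam : 0 < lam) (hα : 0 < α)
    {κ a₀ a₁ D : ℝ} (hκ : 0 < κ) (ha₀ : 0 < a₀) (hlamD : 2 * (α * D) ≤ lam * κ ^ 2)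
    {v vx vt : ℝ × ℝ → ℝ} (hv : Continuous v) (hvx : Continuous vx) (hvt : Continuous vt)
    (hdx : ∀ x ∈ Ioo ε M, ∀ t ∈ Icc 0 T, HasDerivAt (fun s => v (s, t)) (vx (x, t)) x)
    (hdt : ∀ x ∈ Icc ε M, ∀ t ∈ Ioo 0 T, HasDerivAt (fun s => v (x, s)) (vt (x, t)) t)
    (hvε : ∀ t ∈ Icc 0 T, v (ε, t) = 0) (hvM : ∀ t ∈ Icc 0 T, v (M, t) = 0)
    {a a' : ℝ → ℝ} (hac : Continuous a) (hac' : Continuous a')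
    (had : ∀ x ∈ Ioo ε M, HasDerivAt a (a' x) x)
    (haκ : ∀ x, κ ≤ 1 - α * a x) (ha0 : ∀ x, a₀ ≤ a x) (ha1 : ∀ x, a x ≤ a₁)
    (haD : ∀ x, |a' x| ≤ D) :
    lam ^ 2 * κ ^ 2 / 2 * (∫ p in OmegaT ε M T, carlemanWeight lam α p * v p ^ 2) +
        lam * (κ * a₀) * (∫ x in ε..M, carlemanWeight lam α (x, 0) * v (x, 0) ^ 2) ≤
      (∫ p in OmegaT ε M T, carlemanWeight lam α p * (vx p - a p.1 * vt p) ^ 2) +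
        lam * a₁ * (Real.exp (-2 * lam * α * T) *
          ∫ x in ε..M, carlemanWeight lam α (x, 0) * v (x, T) ^ 2) := by
  -- With s = 1 - αa, the x-derivative of w s v² minus the t-derivative of w s a v² equals w (-2λ s²
  -- v² - α a' v² + 2 s v (v_x - a v_t)). The factor s is the rate at which x + αt grows along (1,
  -- -a).
  have h1 := integral_OmegaT_deriv_x hM hT
    (G := fun p => carlemanWeight lam α p * ((1 - α * a p.1) * v p ^ 2))
    (g := fun p => carlemanWeight lam α p * (-2 * lam * (1 - α * a p.1) * v p ^ 2 -
      α * a' p.1 * v p ^ 2 + 2 * (1 - α * a p.1) * v p * vx p))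
    (by fun_prop) (by fun_prop) fun x hx t ht => by
      refine HasDerivAt.congr_deriv ((hasDerivAt_carlemanWeight_x x t).mul
        ((((had x hx).const_mul α).const_sub 1).mul ((hdx x hx t ht).pow 2))) ?_
      simp
      ring
  have h2 := integral_OmegaT_deriv_t hM hT
    (G := fun p => carlemanWeight lam α p * ((1 - α * a p.1) * a p.1 * v p ^ 2))
    (g := fun p => carlemanWeight lam α p * (-2 * lam * α * ((1 - α * a p.1) * a p.1 * v p ^ 2) +
      2 * (1 - α * a p.1) * a p.1 * v p * vt p))
    (by fun_prop) (by fun_prop) fun x hx t ht => by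
      refine HasDerivAt.congr_deriv ((hasDerivAt_carlemanWeight_t x t).mul
        (((hdt x hx t ht).pow 2).const_mul ((1 - α * a x) * a x))) ?_
      simp
      ring
  have h3 : ∫ t in 0..T, (carlemanWeight lam α (M, t) * ((1 - α * a M) * v (M, t) ^ 2) -
      carlemanWeight lam α (ε, t) * ((1 - α * a ε) * v (ε, t) ^ 2)) = 0 := by
    rw [intervalIntegral.integral_congr (g := fun _ => 0)]
    · simp
    · intro t ht
      rw [uIcc_of_le hT.le] at ht
      simp [hvε t ht, hvM t ht]
  -- Here 0 < κ ≤ s ≤ 1. The term at t = 0 has the favourable sign and is kept; the one at t = T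
  -- carries the factor exp(-2λαT).
  have h4 : ∫ x in ε..M, (carlemanWeight lam α (x, T) * ((1 - α * a x) * a x * v (x, T) ^ 2) -
      carlemanWeight lam α (x, 0) * ((1 - α * a x) * a x * v (x, 0) ^ 2)) ≤
      ∫ x in ε..M, (a₁ * Real.exp (-2 * lam * α * T) *
        (carlemanWeight lam α (x, 0) * v (x, T) ^ 2) -
        κ * a₀ * (carlemanWeight lam α (x, 0) * v (x, 0) ^ 2)) := by
    refine intervalIntegral.integral_mono_on hM.le
      (Continuous.intervalIntegrable (by fun_prop) _ _)
      (Continuous.intervalIntegrable (by fun_prop) _ _) fun x _ => ?_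
    have hw := carlemanWeight_pos (lam := lam) (α := α) (x, 0)
    have hE := Real.exp_pos (-2 * lam * α * T)
    have hax := ha0 x
    have hax1 := ha1 x
    have haxκ := haκ x
    have hαa : 0 < α * a x := mul_pos hα (ha₀.trans_le hax)
    have b1 : (1 - α * a x) * a x ≤ a₁ := by nlinarith
    have b2 : κ * a₀ ≤ (1 - α * a x) * a x := by
      apply mul_le_mul haxκ hax ha₀.le; linarith
    rw [carlemanWeight_eq_mul x T]
    have c1 : (1 - α * a x) * a x * (Real.exp (-2 * lam * α * T) * carlemanWeight lam α (x, 0) *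
        v (x, T) ^ 2) ≤ a₁ * (Real.exp (-2 * lam * α * T) * carlemanWeight lam α (x, 0) *
        v (x, T) ^ 2) := mul_le_mul_of_nonneg_right b1 (by positivity)
    have c2 : κ * a₀ * (carlemanWeight lam α (x, 0) * v (x, 0) ^ 2) ≤
        (1 - α * a x) * a x * (carlemanWeight lam α (x, 0) * v (x, 0) ^ 2) :=
      mul_le_mul_of_nonneg_right b2 (by positivity)
    linarith
  have h5 : (∫ p in OmegaT ε M T, carlemanWeight lam α p * (-2 * lam * (1 - α * a p.1) * v p ^ 2 -
      α * a' p.1 * v p ^ 2 + 2 * (1 - α * a p.1) * v p * vx p)) -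
      (∫ p in OmegaT ε M T, carlemanWeight lam α p * (-2 * lam * α *
        ((1 - α * a p.1) * a p.1 * v p ^ 2) + 2 * (1 - α * a p.1) * a p.1 * v p * vt p)) ≤
      ∫ p in OmegaT ε M T, (-(lam * κ ^ 2 / 2) * (carlemanWeight lam α p * v p ^ 2) +
        lam⁻¹ * (carlemanWeight lam α p * (vx p - a p.1 * vt p) ^ 2)) := by
    rw [← integral_sub (by fun_prop : Continuous _).integrableOn_OmegaT
      (by fun_prop : Continuous _).integrableOn_OmegaT]
    refine setIntegral_OmegaT_mono (by fun_prop) (by fun_prop) fun p _ => ?_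
    have hw := carlemanWeight_pos (lam := lam) (α := α) p
    have haxκ := haκ p.1
    have hD := abs_le.1 (haD p.1)
    set s := 1 - α * a p.1 with hs
    have e : -(lam * κ ^ 2 / 2) * (carlemanWeight lam α p * v p ^ 2) +
        lam⁻¹ * (carlemanWeight lam α p * (vx p - a p.1 * vt p) ^ 2) -
        (carlemanWeight lam α p * (-2 * lam * s * v p ^ 2 -
          α * a' p.1 * v p ^ 2 + 2 * s * v p * vx p) -
        carlemanWeight lam α p * (-2 * lam * α * (s * a p.1 * v p ^ 2) +
          2 * s * a p.1 * v p * vt p)) =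
        carlemanWeight lam α p * (lam⁻¹ * (lam * s * v p - (vx p - a p.1 * vt p)) ^ 2 +
          (lam * s ^ 2 + α * a' p.1 - lam * κ ^ 2 / 2) * v p ^ 2) := by
      have hs' : α * a p.1 = 1 - s := by rw [hs]; ring
      field_simp
      linear_combination (-2 * carlemanWeight lam α p * lam ^ 2 * v p ^ 2 * s * 2) * hs'
    -- Young's inequality uses one of the two multiples of λ s²; the hypothesis on λ gives up half
    -- of the other to the term with a'.
    have hk : 0 ≤ lam * s ^ 2 + α * a' p.1 - lam * κ ^ 2 / 2 := by
      have k1 : lam * κ ^ 2 ≤ lam * s ^ 2 := by gcongr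
      have k2 : α * (-D) ≤ α * a' p.1 := mul_le_mul_of_nonneg_left hD.1 hα.le
      linarith
    have : 0 ≤ carlemanWeight lam α p * (lam⁻¹ * (lam * s * v p - (vx p - a p.1 * vt p)) ^ 2 +
          (lam * s ^ 2 + α * a' p.1 - lam * κ ^ 2 / 2) * v p ^ 2) := by positivity
    linarith
  rw [integral_add (by fun_prop : Continuous _).integrableOn_OmegaT
    (by fun_prop : Continuous _).integrableOn_OmegaT, integral_const_mul, integral_const_mul,
    h1, h2, h3] at h5
  have h4' := intervalIntegral.integral_sub (a := ε) (b := M) (μ := volume)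
    (f := fun x => a₁ * Real.exp (-2 * lam * α * T) * (carlemanWeight lam α (x, 0) * v (x, T) ^ 2))
    (g := fun x => κ * a₀ * (carlemanWeight lam α (x, 0) * v (x, 0) ^ 2))
    (Continuous.intervalIntegrable (by fun_prop) _ _)
    (Continuous.intervalIntegrable (by fun_prop) _ _)
  rw [intervalIntegral.integral_const_mul, intervalIntegral.integral_const_mul] at h4'
  rw [h4'] at h4
  have h6 := mul_le_mul_of_nonneg_left (h5.trans' (sub_le_sub_left h4 0)) hlam.le
  rw [mul_add lam, ← mul_assoc lam lam⁻¹, mul_inv_cancel₀ hlam.ne'] at h6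
  linarith

end Carleman

/-! ### The Carleman estimate for the second order operator. -/

section CarlemanEstimate

variable {ε M T α : ℝ} {u : ℕ → ℕ → ℝ × ℝ → ℝ}

/-- Tangential derivatives of a function that vanishes at `x = ε` vanish there. -/
theorem IsC3.deriv_t_eq_zero (hu : IsC3 ε M T u) (hM : ε < M) (hT : 0 < T)
    (h0 : ∀ t ∈ Icc 0 T, u 0 0 (ε, t) = 0) : ∀ t ∈ Icc 0 T, u 0 1 (ε, t) = 0 := by
  have h1 : EqOn (fun t => u 0 1 (ε, t)) (fun _ => 0) (Ioo 0 T) := by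
    intro t ht
    refine (hu.hasDerivAt_t (i := 0) (j := 0) (by norm_num) (left_mem_Icc.2 hM.le) ht).unique
      ((hasDerivAt_const t (0 : ℝ)).congr_of_eventuallyEq ?_)
    filter_upwards [Ioo_mem_nhds ht.1 ht.2] with s hs
    exact h0 s (Ioo_subset_Icc_self hs)
  have hc := hu.continuous (i := 0) (j := 1) (by norm_num)
  have := h1.closure (by fun_prop) continuous_const
  rwa [closure_Ioo hT.ne] at this

/-- The Carleman estimate for the operator `∂_x² - a(x) ∂_x ∂_t`. -/
theorem carleman_estimate (hM : ε < M) (hT : 0 < T) (hα : 0 < α) {κ a₀ a₁ D : ℝ} (hκ : 0 < κ)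
    (ha₀ : 0 < a₀) (ha₁ : 0 ≤ a₁) :
    ∃ lam₀ : ℝ, 1 ≤ lam₀ ∧ ∃ K : ℝ, 0 < K ∧ ∀ lam, lam₀ ≤ lam → ∀ u, IsC3 ε M T u →
      (∀ t ∈ Icc 0 T, u 0 0 (ε, t) = 0) → (∀ t ∈ Icc 0 T, u 1 0 (ε, t) = 0) →
      (∀ t ∈ Icc 0 T, u 1 0 (M, t) = 0) → ∀ a a' : ℝ → ℝ, Continuous a → Continuous a' →
      (∀ x ∈ Ioo ε M, HasDerivAt a (a' x) x) → (∀ x, κ ≤ 1 - α * a x) → (∀ x, a₀ ≤ a x) →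
      (∀ x, a x ≤ a₁) → (∀ x, |a' x| ≤ D) →
      lam ^ 2 * (∫ p in OmegaT ε M T, carlemanWeight lam α p * u 1 0 p ^ 2) +
        lam ^ 2 * (∫ p in OmegaT ε M T, carlemanWeight lam α p * u 0 1 p ^ 2) +
        lam * (∫ x in ε..M, carlemanWeight lam α (x, 0) * u 1 0 (x, 0) ^ 2) ≤
      K * ((∫ p in OmegaT ε M T, carlemanWeight lam α p * (u 2 0 p - a p.1 * u 1 1 p) ^ 2) +
        lam * a₁ * (Real.exp (-2 * lam * α * T) *
          ∫ x in ε..M, carlemanWeight lam α (x, 0) * u 1 0 (x, T) ^ 2)) := by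
  -- The first threshold is that of the transport estimate, the second absorbs the term with a' u_t.
  -- The constant K adds up the bounds for λ² ∫ w u_x², λ² ∫ w u_t² and the trace.
  refine ⟨max 1 (max (2 * (α * D) / κ ^ 2) (8 * D ^ 2 / a₀ ^ 2)), le_max_left _ _,
    2 / κ ^ 2 + (8 / κ ^ 2 + 8) / a₀ ^ 2 + 1 / (κ * a₀), by positivity, ?_⟩
  intro lam hlam u hu h00 h10 h10M a a' hac hac' had haκ ha0 ha1 haD
  have hl1 : 1 ≤ lam := (le_max_left _ _).trans hlam
  have hl2 : 2 * (α * D) / κ ^ 2 ≤ lam := ((le_max_left _ _).trans (le_max_right _ _)).trans hlam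
  have hl3 : 8 * D ^ 2 / a₀ ^ 2 ≤ lam := ((le_max_right _ _).trans (le_max_right _ _)).trans hlam
  have hl0 : 0 < lam := by linarith
  rw [div_le_iff₀ (by positivity)] at hl2 hl3
  have c00 := hu.continuous (i := 0) (j := 0) (by norm_num)
  have c10 := hu.continuous (i := 1) (j := 0) (by norm_num)
  have c01 := hu.continuous (i := 0) (j := 1) (by norm_num)
  have c20 := hu.continuous (i := 2) (j := 0) (by norm_num)
  have c11 := hu.continuous (i := 1) (j := 1) (by norm_num)
  have hD0 : 0 ≤ D := (abs_nonneg _).trans (haD 0)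
  have key := carleman_transport hM hT hl0 hα (a₁ := a₁) hκ ha₀ hl2 c10 c20 c11
    (fun x hx t ht => hu.hasDerivAt_x (i := 1) (j := 0) (by norm_num) hx ht)
    (fun x hx t ht => hu.hasDerivAt_t (i := 1) (j := 0) (by norm_num) hx ht)
    h10 h10M hac hac' had haκ ha0 ha1 haD
  -- The function u_x - a u_t has x-derivative (u_xx - a u_xt) - a' u_t, without any other second
  -- derivative, and vanishes at x = ε. Together with the bound on u_x it controls u_t, because a ≥
  -- a₀ > 0.
  have hardy := sq_mul_integral_carlemanWeight_le (α := α) hM hT hl0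
    (z := fun p => u 1 0 p - a p.1 * u 0 1 p)
    (zx := fun p => (u 2 0 p - a p.1 * u 1 1 p) - a' p.1 * u 0 1 p) (by fun_prop) (by fun_prop)
    (fun x hx t ht => by
      refine HasDerivAt.congr_deriv
        ((hu.hasDerivAt_x (i := 1) (j := 0) (by norm_num) hx ht).sub
          ((had x hx).mul (hu.hasDerivAt_x (i := 0) (j := 1) (by norm_num) hx ht))) ?_
      simp only [Nat.reduceAdd, zero_add]
      ring)
    (fun t ht => by rw [h10 t ht, hu.deriv_t_eq_zero hM hT h00 t ht]; ring)
  have b1 : ∫ p in OmegaT ε M T, carlemanWeight lam α p *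
      ((u 2 0 p - a p.1 * u 1 1 p) - a' p.1 * u 0 1 p) ^ 2 ≤
      ∫ p in OmegaT ε M T, (2 * (carlemanWeight lam α p * (u 2 0 p - a p.1 * u 1 1 p) ^ 2) +
        2 * D ^ 2 * (carlemanWeight lam α p * u 0 1 p ^ 2)) := by
    refine setIntegral_OmegaT_mono (by fun_prop) (by fun_prop) fun p _ => ?_
    have hw := carlemanWeight_pos (lam := lam) (α := α) p
    have hsq : a' p.1 ^ 2 ≤ D ^ 2 := sq_le_sq' (abs_le.1 (haD p.1)).1 (abs_le.1 (haD p.1)).2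
    have k1 : a' p.1 ^ 2 * u 0 1 p ^ 2 ≤ D ^ 2 * u 0 1 p ^ 2 :=
      mul_le_mul_of_nonneg_right hsq (sq_nonneg _)
    have k2 := sq_nonneg ((u 2 0 p - a p.1 * u 1 1 p) + a' p.1 * u 0 1 p)
    have k3 : ((u 2 0 p - a p.1 * u 1 1 p) - a' p.1 * u 0 1 p) ^ 2 ≤
      2 * (u 2 0 p - a p.1 * u 1 1 p) ^ 2 + 2 * D ^ 2 * u 0 1 p ^ 2 := by linarith
    have := mul_le_mul_of_nonneg_left k3 hw.le
    linarith
  have b2 : ∫ p in OmegaT ε M T, a₀ ^ 2 * (carlemanWeight lam α p * u 0 1 p ^ 2) ≤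
      ∫ p in OmegaT ε M T, (2 * (carlemanWeight lam α p * u 1 0 p ^ 2) +
        2 * (carlemanWeight lam α p * (u 1 0 p - a p.1 * u 0 1 p) ^ 2)) := by
    refine setIntegral_OmegaT_mono (by fun_prop) (by fun_prop) fun p _ => ?_
    have hw := carlemanWeight_pos (lam := lam) (α := α) p
    have hsq : a₀ ^ 2 ≤ a p.1 ^ 2 := pow_le_pow_left₀ ha₀.le (ha0 p.1) 2
    have k1 : a₀ ^ 2 * u 0 1 p ^ 2 ≤ a p.1 ^ 2 * u 0 1 p ^ 2 :=
      mul_le_mul_of_nonneg_right hsq (sq_nonneg _)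
    have k2 := sq_nonneg (2 * u 1 0 p - a p.1 * u 0 1 p)
    have k3 : a₀ ^ 2 * u 0 1 p ^ 2 ≤
      2 * u 1 0 p ^ 2 + 2 * (u 1 0 p - a p.1 * u 0 1 p) ^ 2 := by linarith
    have := mul_le_mul_of_nonneg_left k3 hw.le
    linarith
  rw [integral_add (by fun_prop : Continuous _).integrableOn_OmegaT
    (by fun_prop : Continuous _).integrableOn_OmegaT, integral_const_mul, integral_const_mul] at b1
  rw [integral_add (by fun_prop : Continuous _).integrableOn_OmegaT
    (by fun_prop : Continuous _).integrableOn_OmegaT, integral_const_mul, integral_const_mul,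
    integral_const_mul] at b2
  have nn : ∀ f : ℝ × ℝ → ℝ, 0 ≤ ∫ p in OmegaT ε M T, carlemanWeight lam α p * f p ^ 2 :=
    fun f => integral_nonneg fun p => mul_nonneg (carlemanWeight_pos p).le (sq_nonneg _)
  have nn1 : ∀ f : ℝ → ℝ, 0 ≤ ∫ x in ε..M, carlemanWeight lam α (x, 0) * f x ^ 2 :=
    fun f => intervalIntegral.integral_nonneg hM.le fun p _ =>
      mul_nonneg (carlemanWeight_pos _).le (sq_nonneg _)
  set V := ∫ p in OmegaT ε M T, carlemanWeight lam α p * u 1 0 p ^ 2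
  set Y := ∫ p in OmegaT ε M T, carlemanWeight lam α p * u 0 1 p ^ 2
  set Z := ∫ p in OmegaT ε M T, carlemanWeight lam α p * (u 1 0 p - a p.1 * u 0 1 p) ^ 2
  set X := ∫ p in OmegaT ε M T, carlemanWeight lam α p * (u 2 0 p - a p.1 * u 1 1 p) ^ 2
  set V₀ := ∫ x in ε..M, carlemanWeight lam α (x, 0) * u 1 0 (x, 0) ^ 2
  set VT := ∫ x in ε..M, carlemanWeight lam α (x, 0) * u 1 0 (x, T) ^ 2
  set S := X + lam * a₁ * (Real.exp (-2 * lam * α * T) * VT) with hS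
  have nV : 0 ≤ V := nn _
  have nY : 0 ≤ Y := nn _
  have nV₀ : 0 ≤ V₀ := nn1 _
  have nX : 0 ≤ X := nn _
  have nVT : 0 ≤ VT := nn1 _
  have hXS : X ≤ S := by
    rw [hS]
    have : 0 ≤ lam * a₁ * (Real.exp (-2 * lam * α * T) * VT) := by positivity
    linarith
  have e1 : lam ^ 2 * V ≤ 2 / κ ^ 2 * S := by
    rw [div_mul_eq_mul_div, le_div_iff₀ (by positivity)]
    have : 0 ≤ lam * (κ * a₀) * V₀ := by positivity
    linarith
  have e2 : lam * V₀ ≤ 1 / (κ * a₀) * S := by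
    rw [div_mul_eq_mul_div, le_div_iff₀ (by positivity)]
    have : 0 ≤ lam ^ 2 * κ ^ 2 / 2 * V := by positivity
    linarith
  have e3 : lam ^ 2 * Y ≤ (8 / κ ^ 2 + 8) / a₀ ^ 2 * S := by
    rw [div_mul_eq_mul_div, le_div_iff₀ (by positivity)]
    have f1 : lam ^ 2 * (a₀ ^ 2 * Y) ≤ lam ^ 2 * (2 * V + 2 * Z) :=
      mul_le_mul_of_nonneg_left b2 (by positivity)
    have f2 : 8 * D ^ 2 * Y ≤ lam ^ 2 * a₀ ^ 2 * Y := by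
      refine mul_le_mul_of_nonneg_right (hl3.trans ?_) nY
      exact mul_le_mul_of_nonneg_right (by nlinarith) (by positivity)
    have f3 : 8 / κ ^ 2 * S = 4 * (2 / κ ^ 2 * S) := by ring
    rw [add_mul, f3]
    linarith
  rw [add_mul, add_mul]
  linarith

end CarlemanEstimate

/-! ### Midpoint convexity of the functional -/

theorem abs_mul_le_mul_of_abs_le {x y X Y : ℝ} (hx : |x| ≤ X) (hy : |y| ≤ Y) : |x * y| ≤ X * Y := by
  rw [abs_mul]
  exact mul_le_mul hx hy (abs_nonneg _) ((abs_nonneg _).trans hx)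

set_option maxHeartbeats 1000000 in
/-- A pointwise lower bound for the second difference of `q ↦ |F(q)|²`. Here `mᵢⱼ`, `hᵢⱼ` are
the derivatives at `(x, t)`, and `y`, `h` (`y'`, `h'`) are the values (`x`-derivatives)
at `(x, 0)`. -/
theorem second_difference_bound {B q₀ : ℝ} (hB : 0 < B) (hq₀ : 0 < q₀) :
    ∃ K : ℝ, 0 < K ∧ ∀ y h y' h' m₂₀ h₂₀ m₁₁ h₁₁ m₀₁ h₀₁ : ℝ, q₀ ≤ y + h → q₀ ≤ y - h →
      |y'| ≤ B → |h'| ≤ B → |m₂₀| ≤ B → |m₁₁| ≤ B → |m₀₁| ≤ B → |h₀₁| ≤ B →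
      (h₂₀ - (((y + h)⁻¹ ^ 2 + (y - h)⁻¹ ^ 2) / 4) * h₁₁) ^ 2
        - 4 * (m₂₀ - m₁₁ / (2 * y ^ 2) + m₀₁ * y' / (2 * y ^ 3)) *
          (((y + h)⁻¹ ^ 2 - (y - h)⁻¹ ^ 2) / 4) * h₁₁
        - K * (h ^ 2 + h' ^ 2 + h₀₁ ^ 2) ≤
      (m₂₀ + h₂₀ - (m₁₁ + h₁₁) / (2 * (y + h) ^ 2) +
          (m₀₁ + h₀₁) * (y' + h') / (2 * (y + h) ^ 3)) ^ 2 +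
        (m₂₀ - h₂₀ - (m₁₁ - h₁₁) / (2 * (y - h) ^ 2) +
          (m₀₁ - h₀₁) * (y' - h') / (2 * (y - h) ^ 3)) ^ 2 -
        2 * (m₂₀ - m₁₁ / (2 * y ^ 2) + m₀₁ * y' / (2 * y ^ 3)) ^ 2 := by
  set Q := q₀⁻¹ with hQ
  have hQ0 : 0 < Q := inv_pos.2 hq₀
  -- K₁ and K₂ bound the remainders ρ (linear) and σ (quadratic) in terms of h, h', h₀₁, and K₃
  -- bounds F at the midpoint. No bound on h₂₀ or h₁₁ may enter, as the energy does not control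
  -- them.
  set K₁ := B * (4 * Q ^ 3) + (B * B + B * B) * (6 * Q ^ 4) + B * (2 * Q ^ 3) with hK₁
  set K₂ := B * (6 * Q ^ 4) + B * B * (12 * Q ^ 5) + 2 * Q ^ 3 + 6 * Q ^ 4 * B with hK₂
  set K₃ := B + B * Q ^ 2 + B * B * Q ^ 3 with hK₃
  have hK₁0 : 0 < K₁ := by positivity
  have hK₂0 : 0 < K₂ := by positivity
  have hK₃0 : 0 < K₃ := by positivity
  refine ⟨6 * K₁ ^ 2 + 4 * K₃ * K₂, by positivity, ?_⟩
  intro y h y' h' m₂₀ h₂₀ m₁₁ h₁₁ m₀₁ h₀₁ hp hm hy' hh' hm₂₀ hm₁₁ hm₀₁ hh₀₁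
  have hyp : 0 < y + h := by linarith
  have hym : 0 < y - h := by linarith
  have hy : 0 < y := by linarith
  obtain ⟨r, hr⟩ : ∃ r, r = (y + h)⁻¹ := ⟨_, rfl⟩
  obtain ⟨s, hs⟩ : ∃ s, s = (y - h)⁻¹ := ⟨_, rfl⟩
  obtain ⟨w, hw⟩ : ∃ w, w = y⁻¹ := ⟨_, rfl⟩
  have r0 : 0 < r := by rw [hr]; positivity
  have s0 : 0 < s := by rw [hs]; positivity
  have w0 : 0 < w := by rw [hw]; positivity
  have rQ : r ≤ Q := by rw [hr, hQ]; gcongr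
  have sQ : s ≤ Q := by rw [hs, hQ]; gcongr
  have wQ : w ≤ Q := by rw [hw, hQ]; gcongr; linarith
  have er : ∀ z, z / (2 * (y + h) ^ 2) = z * r ^ 2 / 2 := fun z => by rw [hr]; field_simp
  have es : ∀ z, z / (2 * (y - h) ^ 2) = z * s ^ 2 / 2 := fun z => by rw [hs]; field_simp
  have ew : ∀ z, z / (2 * y ^ 2) = z * w ^ 2 / 2 := fun z => by rw [hw]; field_simp
  have er' : ∀ z, z / (2 * (y + h) ^ 3) = z * r ^ 3 / 2 := fun z => by rw [hr]; field_simp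
  have es' : ∀ z, z / (2 * (y - h) ^ 3) = z * s ^ 3 / 2 := fun z => by rw [hs]; field_simp
  have ew' : ∀ z, z / (2 * y ^ 3) = z * w ^ 3 / 2 := fun z => by rw [hw]; field_simp
  have d1 : r - s = -2 * h * (r * s) := by rw [hr, hs]; field_simp; ring
  have d2 : r - w = -h * (r * w) := by rw [hr, hw]; field_simp; ring
  have d3 : s - w = h * (s * w) := by rw [hs, hw]; field_simp; ring
  simp only [er, es, ew, er', es', ew', ← hr, ← hs]
  clear er es ew er' es' ew' hr hs hw
  -- bounds for the differences of the coefficients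
  have p1 : |r ^ 2 - s ^ 2| ≤ 4 * Q ^ 3 * |h| := by
    have : r ^ 2 - s ^ 2 = -(h * (2 * (r * s * (r + s)))) := by linear_combination (r + s) * d1
    rw [this, abs_neg, abs_mul, abs_of_pos (by positivity : 0 < 2 * (r * s * (r + s))), mul_comm]
    refine mul_le_mul_of_nonneg_right ?_ (abs_nonneg h)
    calc 2 * (r * s * (r + s)) ≤ 2 * (Q * Q * (Q + Q)) := by gcongr
      _ = 4 * Q ^ 3 := by ring
  have p2 : |r ^ 3 - s ^ 3| ≤ 6 * Q ^ 4 * |h| := by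
    have : r ^ 3 - s ^ 3 = -(h * (2 * (r * s * (r ^ 2 + r * s + s ^ 2)))) := by
      linear_combination (r ^ 2 + r * s + s ^ 2) * d1
    rw [this, abs_neg, abs_mul,
      abs_of_pos (by positivity : 0 < 2 * (r * s * (r ^ 2 + r * s + s ^ 2))), mul_comm]
    refine mul_le_mul_of_nonneg_right ?_ (abs_nonneg h)
    calc 2 * (r * s * (r ^ 2 + r * s + s ^ 2)) ≤ 2 * (Q * Q * (Q ^ 2 + Q * Q + Q ^ 2)) := by gcongr
      _ = 6 * Q ^ 4 := by ring
  have p3 : |r ^ 3 + s ^ 3| ≤ 2 * Q ^ 3 := by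
    rw [abs_of_pos (by positivity)]
    calc r ^ 3 + s ^ 3 ≤ Q ^ 3 + Q ^ 3 := by gcongr
      _ = 2 * Q ^ 3 := by ring
  -- Compared with twice the value at the midpoint, the first order terms cancel, so the bound is
  -- quadratic in h, unlike those for the differences.
  have p4 : |r ^ 2 + s ^ 2 - 2 * w ^ 2| ≤ 6 * Q ^ 4 * h ^ 2 := by
    have : r ^ 2 + s ^ 2 - 2 * w ^ 2 = 2 * (w * r * s * (r + s + w)) * h ^ 2 := by
      linear_combination (r + w) * d2 + (s + w) * d3 - h * w * (s + r + w) * d1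
    rw [this, abs_of_nonneg (by positivity)]
    refine mul_le_mul_of_nonneg_right ?_ (sq_nonneg h)
    calc 2 * (w * r * s * (r + s + w)) ≤ 2 * (Q * Q * Q * (Q + Q + Q)) := by gcongr
      _ = 6 * Q ^ 4 := by ring
  have p5 : |r ^ 3 + s ^ 3 - 2 * w ^ 3| ≤ 12 * Q ^ 5 * h ^ 2 := by
    have : r ^ 3 + s ^ 3 - 2 * w ^ 3 =
        2 * (w * r * s * (s ^ 2 + s * r + r ^ 2 + w * (s + r) + w ^ 2)) * h ^ 2 := by
      linear_combination (r ^ 2 + r * w + w ^ 2) * d2 + (s ^ 2 + s * w + w ^ 2) * d3 -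
        h * w * (s ^ 2 + s * r + r ^ 2 + w * (s + r) + w ^ 2) * d1
    rw [this, abs_of_nonneg (by positivity)]
    refine mul_le_mul_of_nonneg_right ?_ (sq_nonneg h)
    calc 2 * (w * r * s * (s ^ 2 + s * r + r ^ 2 + w * (s + r) + w ^ 2)) ≤
        2 * (Q * Q * Q * (Q ^ 2 + Q * Q + Q ^ 2 + Q * (Q + Q) + Q ^ 2)) := by gcongr
      _ = 12 * Q ^ 5 := by ring
  obtain ⟨F₀, hF₀⟩ : ∃ F, F = m₂₀ - m₁₁ * w ^ 2 / 2 + m₀₁ * y' * w ^ 3 / 2 := ⟨_, rfl⟩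
  obtain ⟨P, hP⟩ : ∃ P, P = h₂₀ - (r ^ 2 + s ^ 2) / 4 * h₁₁ := ⟨_, rfl⟩
  -- the odd part is `P + ρ`, the even part is `F₀ - d h₁₁ + σ`
  obtain ⟨ρ, hρ⟩ : ∃ ρ, ρ = (-(m₁₁ * (r ^ 2 - s ^ 2)) + (m₀₁ * y' + h₀₁ * h') * (r ^ 3 - s ^ 3) +
    (m₀₁ * h' + h₀₁ * y') * (r ^ 3 + s ^ 3)) / 4 := ⟨_, rfl⟩
  obtain ⟨σ, hσ⟩ : ∃ σ, σ = (-(m₁₁ * (r ^ 2 + s ^ 2 - 2 * w ^ 2)) +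
    m₀₁ * y' * (r ^ 3 + s ^ 3 - 2 * w ^ 3) + h₀₁ * h' * (r ^ 3 + s ^ 3) +
    (m₀₁ * h' + h₀₁ * y') * (r ^ 3 - s ^ 3)) / 4 := ⟨_, rfl⟩
  have hF₀b : |F₀| ≤ K₃ := by
    have w2 : |w ^ 2| ≤ Q ^ 2 := by rw [abs_of_pos (by positivity)]; gcongr
    have w3 : |w ^ 3| ≤ Q ^ 3 := by rw [abs_of_pos (by positivity)]; gcongr
    have a1 := abs_le.1 (abs_mul_le_mul_of_abs_le hm₁₁ w2)
    have a2 := abs_le.1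
      (abs_mul_le_mul_of_abs_le (abs_mul_le_mul_of_abs_le hm₀₁ hy') w3)
    have a3 := abs_le.1 hm₂₀
    have : 0 < B * Q ^ 2 := by positivity
    have : 0 < B * B * Q ^ 3 := by positivity
    rw [hF₀, hK₃, abs_le]
    constructor <;> linarith [a1.1, a1.2, a2.1, a2.2, a3.1, a3.2]
  have hh0 := abs_nonneg h
  have hh1 := abs_nonneg h'
  have hh2 := abs_nonneg h₀₁
  have hcross : |m₀₁ * h' + h₀₁ * y'| ≤ B * (|h'| + |h₀₁|) := by
    refine (abs_add_le _ _).trans ?_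
    have a1 := abs_mul_le_mul_of_abs_le hm₀₁ (le_refl |h'|)
    have a2 := abs_mul_le_mul_of_abs_le (le_refl |h₀₁|) hy'
    linarith
  have hρb : |ρ| ≤ K₁ * (|h| + |h'| + |h₀₁|) := by
    have a1 := abs_le.1 (abs_mul_le_mul_of_abs_le hm₁₁ p1)
    have a2 := abs_le.1 (abs_mul_le_mul_of_abs_le ((abs_add_le _ _).trans
      (add_le_add (abs_mul_le_mul_of_abs_le hm₀₁ hy') (abs_mul_le_mul_of_abs_le hh₀₁ hh'))) p2)
    have a3 := abs_le.1 (abs_mul_le_mul_of_abs_le hcross p3)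
    have b1 : 0 ≤ B * (4 * Q ^ 3) * |h| := by positivity
    have b2 : 0 ≤ (B * B + B * B) * (6 * Q ^ 4) * |h| := by positivity
    have b3 : 0 ≤ B * (2 * Q ^ 3) * |h| := by positivity
    have b4 : 0 ≤ B * (4 * Q ^ 3) * (|h'| + |h₀₁|) := by positivity
    have b5 : 0 ≤ (B * B + B * B) * (6 * Q ^ 4) * (|h'| + |h₀₁|) := by positivity
    have b6 : 0 ≤ B * (2 * Q ^ 3) * (|h'| + |h₀₁|) := by positivity
    have e : K₁ * (|h| + |h'| + |h₀₁|) = B * (4 * Q ^ 3) * |h| +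
      (B * B + B * B) * (6 * Q ^ 4) * |h| + B * (2 * Q ^ 3) * |h| +
      B * (4 * Q ^ 3) * (|h'| + |h₀₁|) + (B * B + B * B) * (6 * Q ^ 4) * (|h'| + |h₀₁|) +
      B * (2 * Q ^ 3) * (|h'| + |h₀₁|) := by rw [hK₁]; ring
    rw [hρ, e, abs_le]
    constructor <;> linarith [a1.1, a1.2, a2.1, a2.2, a3.1, a3.2]
  have hσb : |σ| ≤ K₂ * (h ^ 2 + h' ^ 2 + h₀₁ ^ 2) := by
    have a1 := abs_le.1 (abs_mul_le_mul_of_abs_le hm₁₁ p4)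
    have a2 := abs_le.1 (abs_mul_le_mul_of_abs_le (abs_mul_le_mul_of_abs_le hm₀₁ hy') p5)
    have a3 := abs_le.1 (abs_mul_le_mul_of_abs_le
      (abs_mul_le_mul_of_abs_le (le_refl |h₀₁|) (le_refl |h'|)) p3)
    have a4 := abs_le.1 (abs_mul_le_mul_of_abs_le hcross p2)
    have c1 : |h₀₁| * |h'| ≤ h ^ 2 + h' ^ 2 + h₀₁ ^ 2 := by
      rw [← sq_abs h', ← sq_abs h₀₁]
      linarith [sq_nonneg (|h₀₁| - |h'|), sq_nonneg h, sq_nonneg |h'|, sq_nonneg |h₀₁|]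
    have c2 : (|h'| + |h₀₁|) * |h| ≤ h ^ 2 + h' ^ 2 + h₀₁ ^ 2 := by
      rw [← sq_abs h', ← sq_abs h₀₁, ← sq_abs h]
      linarith [sq_nonneg (|h₀₁| - |h|), sq_nonneg (|h'| - |h|), sq_nonneg |h'|, sq_nonneg |h₀₁|]
    have c3 : h ^ 2 ≤ h ^ 2 + h' ^ 2 + h₀₁ ^ 2 := by linarith [sq_nonneg h', sq_nonneg h₀₁]
    set N := h ^ 2 + h' ^ 2 + h₀₁ ^ 2 with hN
    have hN0 : 0 ≤ N := by positivity
    have f1 : B * (6 * Q ^ 4) * h ^ 2 ≤ B * (6 * Q ^ 4) * N := by gcongr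
    have f2 : B * B * (12 * Q ^ 5) * h ^ 2 ≤ B * B * (12 * Q ^ 5) * N := by gcongr
    have f3 : 2 * Q ^ 3 * (|h₀₁| * |h'|) ≤ 2 * Q ^ 3 * N := by gcongr
    have f4 : 6 * Q ^ 4 * B * ((|h'| + |h₀₁|) * |h|) ≤ 6 * Q ^ 4 * B * N := by gcongr
    have g1 : 0 ≤ B * (6 * Q ^ 4) * N := by positivity
    have g2 : 0 ≤ B * B * (12 * Q ^ 5) * N := by positivity
    have g3 : 0 ≤ 2 * Q ^ 3 * N := by positivity
    have g4 : 0 ≤ 6 * Q ^ 4 * B * N := by positivity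
    have e : K₂ * N = B * (6 * Q ^ 4) * N + B * B * (12 * Q ^ 5) * N + 2 * Q ^ 3 * N +
      6 * Q ^ 4 * B * N := by rw [hK₂]; ring
    rw [hσ, e, abs_le]
    constructor <;> linarith [a1.1, a1.2, a2.1, a2.2, a3.1, a3.2, a4.1, a4.2]
  have hρ2 : ρ ^ 2 ≤ 3 * K₁ ^ 2 * (h ^ 2 + h' ^ 2 + h₀₁ ^ 2) := by
    rw [← sq_abs ρ]
    have s1 : |ρ| ^ 2 ≤ (K₁ * (|h| + |h'| + |h₀₁|)) ^ 2 := by gcongr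
    have s2 : (|h| + |h'| + |h₀₁|) ^ 2 ≤ 3 * (h ^ 2 + h' ^ 2 + h₀₁ ^ 2) := by
      rw [← sq_abs h, ← sq_abs h', ← sq_abs h₀₁]
      linarith [sq_nonneg (|h| - |h'|), sq_nonneg (|h| - |h₀₁|), sq_nonneg (|h'| - |h₀₁|)]
    have s3 := mul_le_mul_of_nonneg_left s2 (sq_nonneg K₁)
    rw [mul_pow] at s1
    linarith
  have hFσ : -(K₃ * (K₂ * (h ^ 2 + h' ^ 2 + h₀₁ ^ 2))) ≤ F₀ * σ :=
    (abs_le.1 (abs_mul_le_mul_of_abs_le hF₀b hσb)).1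
  have ep : m₂₀ + h₂₀ - (m₁₁ + h₁₁) * r ^ 2 / 2 + (m₀₁ + h₀₁) * (y' + h') * r ^ 3 / 2 =
      (F₀ + (σ - (r ^ 2 - s ^ 2) / 4 * h₁₁)) + (P + ρ) := by
    rw [hF₀, hσ, hP, hρ]; ring
  have em : m₂₀ - h₂₀ - (m₁₁ - h₁₁) * s ^ 2 / 2 + (m₀₁ - h₀₁) * (y' - h') * s ^ 3 / 2 =
      (F₀ + (σ - (r ^ 2 - s ^ 2) / 4 * h₁₁)) - (P + ρ) := by
    rw [hF₀, hσ, hP, hρ]; ring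
  rw [ep, em, ← hF₀, ← hP]
  clear ep em hP hF₀ hρ hσ hρb hσb
  -- With X = σ - d h₁₁, the second difference is 2 (P + ρ)² + 4 F₀ X + 2 X². Here 2 (P + ρ)² = P² +
  -- (P + 2ρ)² - 2ρ² and X² is dropped, which disposes of the square of h₁₁.
  have k1 := sq_nonneg (P + 2 * ρ)
  have k2 := sq_nonneg (σ - (r ^ 2 - s ^ 2) / 4 * h₁₁)
  linarith

theorem abs_inv_sq_sub_inv_sq_le {q₀ y h : ℝ} (hq₀ : 0 < q₀) (hp : q₀ ≤ y + h) (hm : q₀ ≤ y - h) :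
    |(y + h)⁻¹ ^ 2 - (y - h)⁻¹ ^ 2| ≤ 4 * q₀⁻¹ ^ 3 * |h| := by
  have hyp : 0 < y + h := by linarith
  have hym : 0 < y - h := by linarith
  have r0 : 0 < (y + h)⁻¹ := by positivity
  have s0 : 0 < (y - h)⁻¹ := by positivity
  have rQ : (y + h)⁻¹ ≤ q₀⁻¹ := by gcongr
  have sQ : (y - h)⁻¹ ≤ q₀⁻¹ := by gcongr
  have d1 : (y + h)⁻¹ - (y - h)⁻¹ = -2 * h * ((y + h)⁻¹ * (y - h)⁻¹) := by field_simp; ring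
  set r := (y + h)⁻¹
  set s := (y - h)⁻¹
  have : r ^ 2 - s ^ 2 = -(h * (2 * (r * s * (r + s)))) := by linear_combination (r + s) * d1
  rw [this, abs_neg, abs_mul, abs_of_pos (by positivity : 0 < 2 * (r * s * (r + s))), mul_comm]
  refine mul_le_mul_of_nonneg_right ?_ (abs_nonneg h)
  calc 2 * (r * s * (r + s)) ≤ 2 * (q₀⁻¹ * q₀⁻¹ * (q₀⁻¹ + q₀⁻¹)) := by gcongr
    _ = 4 * q₀⁻¹ ^ 3 := by ring

/-! ### Integrating the second difference against the Carleman weight. -/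

section SecondDifference

variable {ε M T lam α : ℝ}

/-- The weight decays like exp(-2λαt), so for functions of x alone the integral over Ω_T gains a
factor 1/(2λα) over the trace. This makes the nonlocal terms h(x,0) and h_x(x,0) of lower order. -/
theorem integral_carlemanWeight_fst_le (hM : ε < M) (hT : 0 < T) {f : ℝ → ℝ} (hf : Continuous f) :
    2 * lam * α * ∫ p in OmegaT ε M T, carlemanWeight lam α p * f p.1 ^ 2 ≤
      ∫ x in ε..M, carlemanWeight lam α (x, 0) * f x ^ 2 := by
  have h1 := integral_OmegaT_deriv_t hM hT
    (G := fun p => -(carlemanWeight lam α p * f p.1 ^ 2))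
    (g := fun p => 2 * lam * α * (carlemanWeight lam α p * f p.1 ^ 2))
    (by fun_prop) (by fun_prop) fun x hx t ht => by
      refine HasDerivAt.congr_deriv
        ((hasDerivAt_carlemanWeight_t x t).mul_const (f x ^ 2)).neg ?_
      ring
  rw [← integral_const_mul, h1]
  refine intervalIntegral.integral_mono_on hM.le (Continuous.intervalIntegrable (by fun_prop) _ _)
    (Continuous.intervalIntegrable (by fun_prop) _ _) fun x _ => ?_
  have := mul_nonneg (carlemanWeight_pos (lam := lam) (α := α) (x, T)).le (sq_nonneg (f x))
  simp only
  linarith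

/-- Integration by parts in `t` in the term that carries the mixed second derivative. -/
theorem integral_carlemanWeight_mixed_le (hM : ε < M) (hT : 0 < T) (hlam : 1 ≤ lam) (hα : 0 < α)
    {F Ft v vt : ℝ × ℝ → ℝ} {d h : ℝ → ℝ} {K L : ℝ} (hL : 0 ≤ L)
    (cF : Continuous F) (cFt : Continuous Ft) (cv : Continuous v) (cvt : Continuous vt)
    (cd : Continuous d) (ch : Continuous h)
    (hF : ∀ x ∈ Icc ε M, ∀ t ∈ Ioo 0 T, HasDerivAt (fun s => F (x, s)) (Ft (x, t)) t)
    (hv : ∀ x ∈ Icc ε M, ∀ t ∈ Ioo 0 T, HasDerivAt (fun s => v (x, s)) (vt (x, t)) t)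
    (bF : ∀ p, |F p| ≤ K) (bFt : ∀ p, |Ft p| ≤ K) (bd : ∀ x, |d x| ≤ L * |h x|) :
    ∫ p in OmegaT ε M T, carlemanWeight lam α p * (F p * d p.1 * vt p) ≤
      K * L * (Real.exp (-2 * lam * α * T) *
          ∫ x in ε..M, carlemanWeight lam α (x, 0) * v (x, T) ^ 2) +
        2 * (K * L) * (∫ x in ε..M, carlemanWeight lam α (x, 0) * h x ^ 2) +
        K * L * (∫ x in ε..M, carlemanWeight lam α (x, 0) * v (x, 0) ^ 2) +
        K * L * (2 * α + 1) * (lam * (∫ p in OmegaT ε M T, carlemanWeight lam α p * h p.1 ^ 2) +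
          lam * ∫ p in OmegaT ε M T, carlemanWeight lam α p * v p ^ 2) := by
  have hK : 0 ≤ K := (abs_nonneg _).trans (bF 0)
  have hl0 : 0 < lam := by linarith
  have prod_le : ∀ a b : ℝ, |a| * |b| ≤ a ^ 2 + b ^ 2 := fun a b => by
    rw [← sq_abs a, ← sq_abs b]
    nlinarith [sq_nonneg (|a| - |b|), sq_nonneg |a|, sq_nonneg |b|]
  have bnd : ∀ (A w : ℝ) (x : ℝ), |A| ≤ K → |A * d x * w| ≤ K * L * (h x ^ 2 + w ^ 2) := by
    intro A w x hA
    calc |A * d x * w| ≤ K * (L * |h x|) * |w| :=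
          abs_mul_le_mul_of_abs_le (abs_mul_le_mul_of_abs_le hA (bd x)) le_rfl
      _ = K * L * (|h x| * |w|) := by ring
      _ ≤ _ := by gcongr; exact prod_le _ _
  -- The derivative falls on the weight, on F or on v, never on d. The first two amount to at most
  -- λ(2α + 1)K, since λ ≥ 1.
  have h1 := integral_OmegaT_deriv_t hM hT
    (G := fun p => carlemanWeight lam α p * (F p * d p.1 * v p))
    (g := fun p => carlemanWeight lam α p * ((-2 * lam * α * F p + Ft p) * d p.1 * v p) +
      carlemanWeight lam α p * (F p * d p.1 * vt p))
    (by fun_prop) (by fun_prop) fun x hx t ht => by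
      refine HasDerivAt.congr_deriv ((hasDerivAt_carlemanWeight_t x t).mul
        (((hF x hx t ht).mul_const (d x)).mul (hv x hx t ht))) ?_
      simp
      ring
  rw [integral_add (by fun_prop : Continuous _).integrableOn_OmegaT
    (by fun_prop : Continuous _).integrableOn_OmegaT] at h1
  have h2 : ∫ x in ε..M, (carlemanWeight lam α (x, T) * (F (x, T) * d x * v (x, T)) -
      carlemanWeight lam α (x, 0) * (F (x, 0) * d x * v (x, 0))) ≤
      ∫ x in ε..M, (K * L * Real.exp (-2 * lam * α * T) *
        (carlemanWeight lam α (x, 0) * v (x, T) ^ 2) +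
        2 * (K * L) * (carlemanWeight lam α (x, 0) * h x ^ 2) +
        K * L * (carlemanWeight lam α (x, 0) * v (x, 0) ^ 2)) := by
    refine intervalIntegral.integral_mono_on hM.le
      (Continuous.intervalIntegrable (by fun_prop) _ _)
      (Continuous.intervalIntegrable (by fun_prop) _ _) fun x _ => ?_
    have hw := carlemanWeight_pos (lam := lam) (α := α) (x, 0)
    have hE := Real.exp_pos (-2 * lam * α * T)
    -- The term h² at t = T is simply bounded by its value at t = 0, hence the factor 2 in front of
    -- the trace of h.
    have hE1 : Real.exp (-2 * lam * α * T) ≤ 1 := by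
      rw [Real.exp_le_one_iff]
      have : 0 < lam * α * T := by positivity
      linarith
    rw [carlemanWeight_eq_mul x T]
    have b1 := (abs_le.1 (bnd (F (x, T)) (v (x, T)) x (bF _))).2
    have b2 := (abs_le.1 (bnd (F (x, 0)) (v (x, 0)) x (bF _))).1
    have c1 := mul_le_mul_of_nonneg_left b1 (mul_pos hE hw).le
    have c2 := mul_le_mul_of_nonneg_left b2 hw.le
    have c3 : Real.exp (-2 * lam * α * T) * (carlemanWeight lam α (x, 0) * (K * L * h x ^ 2)) ≤
      1 * (carlemanWeight lam α (x, 0) * (K * L * h x ^ 2)) :=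
      mul_le_mul_of_nonneg_right hE1 (by positivity)
    linarith
  have h3 : ∫ p in OmegaT ε M T,
      (-K * L * (2 * α + 1) * lam * (carlemanWeight lam α p * h p.1 ^ 2) +
        -K * L * (2 * α + 1) * lam * (carlemanWeight lam α p * v p ^ 2)) ≤
      ∫ p in OmegaT ε M T, carlemanWeight lam α p * ((-2 * lam * α * F p + Ft p) * d p.1 * v p) := by
    refine setIntegral_OmegaT_mono (by fun_prop) (by fun_prop) fun p _ => ?_
    have hw := carlemanWeight_pos (lam := lam) (α := α) p
    have b1 := (abs_le.1 (bnd (F p) (v p) p.1 (bF _))).2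
    have b2 := (abs_le.1 (bnd (Ft p) (v p) p.1 (bFt _))).1
    have b3 := mul_le_mul_of_nonneg_left b1 (by positivity : 0 ≤ 2 * lam * α)
    have b4 : 1 * (K * L * (h p.1 ^ 2 + v p ^ 2)) ≤ lam * (K * L * (h p.1 ^ 2 + v p ^ 2)) :=
      mul_le_mul_of_nonneg_right hlam (by positivity)
    have b5 : -(lam * (K * L * (2 * α + 1) * (h p.1 ^ 2 + v p ^ 2))) ≤
      (-2 * lam * α * F p + Ft p) * d p.1 * v p := by linarith
    have := mul_le_mul_of_nonneg_left b5 hw.le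
    linarith
  rw [integral_add (by fun_prop : Continuous _).integrableOn_OmegaT
    (by fun_prop : Continuous _).integrableOn_OmegaT, integral_const_mul, integral_const_mul] at h3
  rw [intervalIntegral.integral_add (Continuous.intervalIntegrable (by fun_prop) _ _)
    (Continuous.intervalIntegrable (by fun_prop) _ _),
    intervalIntegral.integral_add (Continuous.intervalIntegrable (by fun_prop) _ _)
    (Continuous.intervalIntegrable (by fun_prop) _ _), intervalIntegral.integral_const_mul,
    intervalIntegral.integral_const_mul, intervalIntegral.integral_const_mul] at h2
  linarith

end SecondDifference

section SecondDifference

variable {ε M T α : ℝ}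

theorem continuous_opC {u : ℕ → ℕ → ℝ × ℝ → ℝ} (hu : IsC3 ε M T u)
    (h0 : ∀ x, u 0 0 (x, 0) ≠ 0) : Continuous (opC u) := by
  have c00 := hu.continuous (i := 0) (j := 0) (by norm_num)
  have c10 := hu.continuous (i := 1) (j := 0) (by norm_num)
  have c01 := hu.continuous (i := 0) (j := 1) (by norm_num)
  have c20 := hu.continuous (i := 2) (j := 0) (by norm_num)
  have c11 := hu.continuous (i := 1) (j := 1) (by norm_num)
  unfold opC
  refine (c20.sub (c11.div (by fun_prop) fun p => ?_)).add
    ((c01.mul (by fun_prop)).div (by fun_prop) fun p => ?_)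
  · exact mul_ne_zero two_ne_zero (pow_ne_zero _ (h0 _))
  · exact mul_ne_zero two_ne_zero (pow_ne_zero _ (h0 _))

/-- Stated for free numbers because it serves twice: ∂_t F(m) has the same form as F(m), with one
more t-derivative on each factor that depends on t. -/
theorem abs_opC_le {B q₀ y y' a b c : ℝ} (hq₀ : 0 < q₀) (hy : q₀ ≤ y) (ha : |a| ≤ B) (hb : |b| ≤ B)
    (hc : |c| ≤ B) (hy' : |y'| ≤ B) :
    |a - b / (2 * y ^ 2) + c * y' / (2 * y ^ 3)| ≤ B + B * q₀⁻¹ ^ 2 + B * B * q₀⁻¹ ^ 3 := by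
  have hy0 : 0 < y := by linarith
  have hB : 0 ≤ B := (abs_nonneg _).trans ha
  have e1 : b / (2 * y ^ 2) = b * y⁻¹ ^ 2 / 2 := by field_simp
  have e2 : c * y' / (2 * y ^ 3) = c * y' * y⁻¹ ^ 3 / 2 := by field_simp
  have w2 : |y⁻¹ ^ 2| ≤ q₀⁻¹ ^ 2 := by rw [abs_of_pos (by positivity)]; gcongr
  have w3 : |y⁻¹ ^ 3| ≤ q₀⁻¹ ^ 3 := by rw [abs_of_pos (by positivity)]; gcongr
  have a1 := abs_le.1 (abs_mul_le_mul_of_abs_le hb w2)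
  have a2 := abs_le.1 (abs_mul_le_mul_of_abs_le (abs_mul_le_mul_of_abs_le hc hy') w3)
  have a3 := abs_le.1 ha
  have : 0 ≤ B * q₀⁻¹ ^ 2 := by positivity
  have : 0 ≤ B * B * q₀⁻¹ ^ 3 := by positivity
  rw [e1, e2, abs_le]
  constructor <;> linarith [a1.1, a1.2, a2.1, a2.2, a3.1, a3.2]

theorem hasDerivAt_inv_sq {y : ℝ → ℝ} {y' x : ℝ} (h : HasDerivAt y y' x) (h0 : y x ≠ 0) :
    HasDerivAt (fun x => (y x)⁻¹ ^ 2) (-2 * (y' * (y x)⁻¹ ^ 3)) x := by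
  refine HasDerivAt.congr_deriv ((h.inv h0).pow 2) ?_
  simp only [Pi.inv_apply]
  push_cast
  ring

/-- The absorption of the lower order terms for large `lam`. -/
theorem second_difference_absorb {lam α K K₁ K₄ a₁ X N V Y Z I₀ I₁ H₀ V₀ ET : ℝ} (hα : 0 < α)
    (hK : 0 < K) (hK₁ : 0 < K₁) (hK₄ : 0 < K₄) (hl1 : 1 ≤ lam)
    (hl2 : 2 * (K₁ / α + K₁ + 3 * K₄ + K₄ * (2 * α + 1) / (2 * α) + K₄ * (2 * α + 1)) * K ≤ lam)
    (nV : 0 ≤ V) (nY : 0 ≤ Y) (nZ : 0 ≤ Z) (nI₀ : 0 ≤ I₀) (nI₁ : 0 ≤ I₁) (nH₀ : 0 ≤ H₀)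
    (nV₀ : 0 ≤ V₀) (nE : 0 ≤ ET) (hI0 : 2 * lam * α * I₀ ≤ H₀) (hI1 : 2 * lam * α * I₁ ≤ V₀)
    (hH0 : lam ^ 2 * H₀ ≤ V₀) (hZ : lam ^ 2 * Z ≤ V)
    (hmix : 4 * N ≤ K₄ * ET + 2 * (K₄ * H₀) + K₄ * V₀ + K₄ * (2 * α + 1) * (lam * I₀ + lam * V))
    (hcar : lam ^ 2 * V + lam ^ 2 * Y + lam * V₀ ≤ K * (X + lam * a₁ * ET)) :
    1 / (4 * K) * (Z + V + Y + H₀ + V₀) - (a₁ + K₄) * lam * ET ≤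
      X - 4 * N - (K₁ * I₀ + K₁ * I₁ + K₁ * Y) := by
  obtain ⟨K₆, hK₆⟩ : ∃ K₆, K₆ =
    K₁ / α + K₁ + 3 * K₄ + K₄ * (2 * α + 1) / (2 * α) + K₄ * (2 * α + 1) := ⟨_, rfl⟩
  rw [← hK₆] at hl2
  have hK₆0 : 0 < K₆ := by rw [hK₆]; positivity
  have hlsq : 1 ≤ lam ^ 2 := one_le_pow₀ hl1
  have hH0' : H₀ ≤ V₀ := (le_mul_of_one_le_left nH₀ hlsq).trans hH0
  have hZ' : Z ≤ V := (le_mul_of_one_le_left nZ hlsq).trans hZ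
  have hlI0 : lam * I₀ ≤ V₀ / (2 * α) := by
    rw [le_div_iff₀ (by positivity)]; linarith
  have hI0' : I₀ ≤ V₀ / (2 * α) := (le_mul_of_one_le_left nI₀ hl1).trans hlI0
  have hI1' : I₁ ≤ V₀ / (2 * α) := by
    refine (le_mul_of_one_le_left nI₁ hl1).trans ?_
    rw [le_div_iff₀ (by positivity)]; linarith
  obtain ⟨S, hS⟩ : ∃ S, S = X + lam * a₁ * ET := ⟨_, rfl⟩
  rw [← hS] at hcar
  have hsmall : lam * (V₀ + Y + lam * V) ≤ K * S := by
    have : lam * Y ≤ lam ^ 2 * Y := mul_le_mul_of_nonneg_right (by nlinarith) nY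
    linarith
  have hW0 : 0 ≤ V₀ + Y + lam * V := by positivity
  -- All errors are multiples of V₀ + Y + λV, which the Carleman estimate bounds by K S/λ. For λ ≥ 2
  -- K₆ K they use up only half of S.
  have herr : K₆ * (V₀ + Y + lam * V) ≤ S / 2 := by
    have h1 := mul_le_mul_of_nonneg_right hl2 hW0
    have h2 : K * (2 * (K₆ * (V₀ + Y + lam * V))) ≤ K * S := by linarith
    have := le_of_mul_le_mul_left h2 hK
    linarith
  have e₁ : K₁ * I₀ ≤ K₁ * (V₀ / (2 * α)) := mul_le_mul_of_nonneg_left hI0' hK₁.le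
  have e₂ : K₁ * I₁ ≤ K₁ * (V₀ / (2 * α)) := mul_le_mul_of_nonneg_left hI1' hK₁.le
  have e₃ : K₄ * H₀ ≤ K₄ * V₀ := mul_le_mul_of_nonneg_left hH0' hK₄.le
  have e₄ : K₄ * (2 * α + 1) * (lam * I₀) ≤ K₄ * (2 * α + 1) * (V₀ / (2 * α)) :=
    mul_le_mul_of_nonneg_left hlI0 (by positivity)
  have e₅ : 4 * N ≤ K₄ * ET + 3 * (K₄ * V₀) + K₄ * (2 * α + 1) * (V₀ / (2 * α)) +
      K₄ * (2 * α + 1) * (lam * V) := by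
    linarith
  have e₆ : K₆ * (V₀ + Y + lam * V) = 2 * (K₁ * (V₀ / (2 * α))) + K₁ * V₀ + 3 * (K₄ * V₀) +
      K₄ * (2 * α + 1) * (V₀ / (2 * α)) + K₄ * (2 * α + 1) * V₀ + K₆ * Y + K₆ * (lam * V) := by
    rw [hK₆]
    field_simp
  have e₇ : K₁ * Y ≤ K₆ * Y := by
    refine mul_le_mul_of_nonneg_right ?_ nY
    have : 0 ≤ K₁ / α + 3 * K₄ + K₄ * (2 * α + 1) / (2 * α) + K₄ * (2 * α + 1) := by positivity
    rw [hK₆]; linarith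
  have e₈ : K₄ * (2 * α + 1) * (lam * V) ≤ K₆ * (lam * V) := by
    refine mul_le_mul_of_nonneg_right ?_ (by positivity)
    have : 0 ≤ K₁ / α + K₁ + 3 * K₄ + K₄ * (2 * α + 1) / (2 * α) := by positivity
    rw [hK₆]; linarith
  have e₉ : 0 ≤ K₁ * V₀ := by positivity
  have e₁₀ : 0 ≤ K₄ * (2 * α + 1) * V₀ := by positivity
  have e₁₁ : K₄ * ET ≤ K₄ * (lam * ET) := mul_le_mul_of_nonneg_left
    (le_mul_of_one_le_left nE hl1) hK₄.le
  -- The other half of S pays for the energy; Z ≤ V and H₀ ≤ V₀ explain the constant 1/(4K).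
  have e₁₂ : 1 / (4 * K) * (Z + V + Y + H₀ + V₀) ≤ S / 2 := by
    rw [div_mul_eq_mul_div, div_le_iff₀ (by positivity)]
    have f1 : V ≤ lam ^ 2 * V := le_mul_of_one_le_left nV hlsq
    have f2 : Y ≤ lam ^ 2 * Y := le_mul_of_one_le_left nY hlsq
    have f3 : V₀ ≤ lam * V₀ := le_mul_of_one_le_left nV₀ hl1
    have f4 : S / 2 * (4 * K) = 2 * (K * S) := by ring
    rw [f4]
    linarith only [f1, f2, f3, hcar, hZ', hH0', nY]
  have e₁₃ : (a₁ + K₄) * lam * ET = lam * a₁ * ET + K₄ * (lam * ET) := by ring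
  rw [e₁₃]
  linarith only [herr, e₁, e₂, e₅, e₆, e₇, e₈, e₉, e₁₀, e₁₁, e₁₂, hS]

set_option maxHeartbeats 1000000 in
/-- A lower bound for the second difference of the weighted `L²` norm of `F(q)`. -/
theorem integral_second_difference_ge (hM : ε < M) (hT : 0 < T) (hα : 0 < α) {B q₀ : ℝ}
    (hB : 0 < B) (hq₀ : 0 < q₀) (hαq : α * q₀⁻¹ ^ 2 / 2 < 1) :
    ∃ lam₀ : ℝ, 1 ≤ lam₀ ∧ ∃ c₀ : ℝ, 0 < c₀ ∧ ∃ K : ℝ, 0 < K ∧ ∀ lam, lam₀ ≤ lam →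
      ∀ m h : ℕ → ℕ → ℝ × ℝ → ℝ, IsC3 ε M T m → IsC3 ε M T h →
      (∀ {i j}, i + j ≤ 3 → ∀ p, |m i j p| ≤ B) → (∀ {i j}, i + j ≤ 3 → ∀ p, |h i j p| ≤ B) →
      (∀ x, q₀ ≤ m 0 0 (x, 0) + h 0 0 (x, 0)) → (∀ x, q₀ ≤ m 0 0 (x, 0) - h 0 0 (x, 0)) →
      (∀ t ∈ Icc 0 T, h 0 0 (ε, t) = 0) → (∀ t ∈ Icc 0 T, h 1 0 (ε, t) = 0) →
      (∀ t ∈ Icc 0 T, h 1 0 (M, t) = 0) →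
      c₀ * ((∫ p in OmegaT ε M T, carlemanWeight lam α p * h 0 0 p ^ 2) +
          (∫ p in OmegaT ε M T, carlemanWeight lam α p * h 1 0 p ^ 2) +
          (∫ p in OmegaT ε M T, carlemanWeight lam α p * h 0 1 p ^ 2) +
          (∫ x in ε..M, carlemanWeight lam α (x, 0) * h 0 0 (x, 0) ^ 2) +
          ∫ x in ε..M, carlemanWeight lam α (x, 0) * h 1 0 (x, 0) ^ 2) -
        K * lam * (Real.exp (-2 * lam * α * T) *
          ∫ x in ε..M, carlemanWeight lam α (x, 0) * h 1 0 (x, T) ^ 2) ≤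
      ∫ p in OmegaT ε M T, carlemanWeight lam α p * (opC (fun i j => m i j + h i j) p ^ 2 +
        opC (fun i j => m i j - h i j) p ^ 2 - 2 * opC m p ^ 2) := by
  set Q := q₀⁻¹ with hQ
  have hQ0 : 0 < Q := inv_pos.2 hq₀
  obtain ⟨K₁, hK₁, hpt⟩ := second_difference_bound hB hq₀
  set K₃ := B + B * Q ^ 2 + B * B * Q ^ 3 with hK₃
  have hK₃0 : 0 < K₃ := by positivity
  -- The coefficient is a = ((y + h)⁻² + (y - h)⁻²)/4 with q₀ ≤ y ± h ≤ 2B and x-derivatives of y ±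
  -- h bounded by 2B. This yields 1/(8B²) ≤ a ≤ Q²/2 and |a'| ≤ 2BQ³.
  obtain ⟨l₀, hl₀, K, hK, hcar⟩ := carleman_estimate hM hT hα (κ := 1 - α * Q ^ 2 / 2)
    (a₀ := 1 / (8 * B ^ 2)) (a₁ := Q ^ 2 / 2) (D := 2 * B * Q ^ 3) (by linarith) (by positivity)
    (by positivity)
  set K₄ := 4 * (K₃ * Q ^ 3) with hK₄
  have hK₄0 : 0 < K₄ := by positivity
  set K₆ := K₁ / α + K₁ + 3 * K₄ + K₄ * (2 * α + 1) / (2 * α) + K₄ * (2 * α + 1) with hK₆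
  have hK₆0 : 0 < K₆ := by positivity
  refine ⟨max l₀ (2 * K₆ * K), hl₀.trans (le_max_left _ _), 1 / (4 * K), by positivity,
    Q ^ 2 / 2 + K₄, by positivity, ?_⟩
  intro lam hlam m h hm hh bm bh hp hn h00 h10 h10M
  have hl1 : 1 ≤ lam := hl₀.trans ((le_max_left _ _).trans hlam)
  have hl2 : 2 * K₆ * K ≤ lam := (le_max_right _ _).trans hlam
  have hl0 : 0 < lam := by linarith
  have cm : ∀ {i j}, i + j ≤ 3 → Continuous (m i j) := hm.continuous
  have m00 := cm (i := 0) (j := 0) (by norm_num)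
  have m10 := cm (i := 1) (j := 0) (by norm_num)
  have m01 := cm (i := 0) (j := 1) (by norm_num)
  have m20 := cm (i := 2) (j := 0) (by norm_num)
  have m11 := cm (i := 1) (j := 1) (by norm_num)
  have m02 := cm (i := 0) (j := 2) (by norm_num)
  have m21 := cm (i := 2) (j := 1) (by norm_num)
  have m12 := cm (i := 1) (j := 2) (by norm_num)
  have c00 := hh.continuous (i := 0) (j := 0) (by norm_num)
  have c10 := hh.continuous (i := 1) (j := 0) (by norm_num)
  have c01 := hh.continuous (i := 0) (j := 1) (by norm_num)
  have c20 := hh.continuous (i := 2) (j := 0) (by norm_num)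
  have c11 := hh.continuous (i := 1) (j := 1) (by norm_num)
  have hy : ∀ x, q₀ ≤ m 0 0 (x, 0) := fun x => by linarith [hp x, hn x]
  have hp0 : ∀ x, m 0 0 (x, 0) + h 0 0 (x, 0) ≠ 0 := fun x => (hq₀.trans_le (hp x)).ne'
  have hn0 : ∀ x, m 0 0 (x, 0) - h 0 0 (x, 0) ≠ 0 := fun x => (hq₀.trans_le (hn x)).ne'
  have hy0 : ∀ x, m 0 0 (x, 0) ≠ 0 := fun x => (hq₀.trans_le (hy x)).ne'
  have cr : Continuous fun x => (m 0 0 (x, 0) + h 0 0 (x, 0))⁻¹ :=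
    Continuous.inv₀ (by fun_prop) hp0
  have cs : Continuous fun x => (m 0 0 (x, 0) - h 0 0 (x, 0))⁻¹ :=
    Continuous.inv₀ (by fun_prop) hn0
  have rpos : ∀ x, 0 < (m 0 0 (x, 0) + h 0 0 (x, 0))⁻¹ := fun x => inv_pos.2 (hq₀.trans_le (hp x))
  have spos : ∀ x, 0 < (m 0 0 (x, 0) - h 0 0 (x, 0))⁻¹ := fun x => inv_pos.2 (hq₀.trans_le (hn x))
  have rQ : ∀ x, (m 0 0 (x, 0) + h 0 0 (x, 0))⁻¹ ≤ Q := fun x => by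
    rw [hQ]; exact inv_anti₀ hq₀ (hp x)
  have sQ : ∀ x, (m 0 0 (x, 0) - h 0 0 (x, 0))⁻¹ ≤ Q := fun x => by
    rw [hQ]; exact inv_anti₀ hq₀ (hn x)
  have rB : ∀ x, (2 * B)⁻¹ ≤ (m 0 0 (x, 0) + h 0 0 (x, 0))⁻¹ := fun x => by
    refine inv_anti₀ (hq₀.trans_le (hp x)) ?_
    linarith [(abs_le.1 (bm (i := 0) (j := 0) (by norm_num) (x, 0))).2,
      (abs_le.1 (bh (i := 0) (j := 0) (by norm_num) (x, 0))).2]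
  have sB : ∀ x, (2 * B)⁻¹ ≤ (m 0 0 (x, 0) - h 0 0 (x, 0))⁻¹ := fun x => by
    refine inv_anti₀ (hq₀.trans_le (hn x)) ?_
    linarith [(abs_le.1 (bm (i := 0) (j := 0) (by norm_num) (x, 0))).2,
      (abs_le.1 (bh (i := 0) (j := 0) (by norm_num) (x, 0))).1]
  have a_le : ∀ x, ((m 0 0 (x, 0) + h 0 0 (x, 0))⁻¹ ^ 2 + (m 0 0 (x, 0) - h 0 0 (x, 0))⁻¹ ^ 2) / 4 ≤
      Q ^ 2 / 2 := fun x => by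
    have h1 := pow_le_pow_left₀ (rpos x).le (rQ x) 2
    have h2 := pow_le_pow_left₀ (spos x).le (sQ x) 2
    linarith
  have ht0 : (0 : ℝ) ∈ Icc 0 T := ⟨le_rfl, hT.le⟩
  have hcar' := hcar lam ((le_max_left _ _).trans hlam) h hh h00 h10 h10M
    (fun x => ((m 0 0 (x, 0) + h 0 0 (x, 0))⁻¹ ^ 2 + (m 0 0 (x, 0) - h 0 0 (x, 0))⁻¹ ^ 2) / 4)
    (fun x => -((m 1 0 (x, 0) + h 1 0 (x, 0)) * (m 0 0 (x, 0) + h 0 0 (x, 0))⁻¹ ^ 3 +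
      (m 1 0 (x, 0) - h 1 0 (x, 0)) * (m 0 0 (x, 0) - h 0 0 (x, 0))⁻¹ ^ 3) / 2)
    (by fun_prop) (by fun_prop)
    (fun x hx => by
      have d1 := hm.hasDerivAt_x (i := 0) (j := 0) (by norm_num) hx ht0
      have d2 := hh.hasDerivAt_x (i := 0) (j := 0) (by norm_num) hx ht0
      refine HasDerivAt.congr_deriv (((hasDerivAt_inv_sq (d1.add d2) (hp0 x)).add
        (hasDerivAt_inv_sq (d1.sub d2) (hn0 x))).div_const 4) ?_
      simp only [zero_add, Pi.add_apply, Pi.sub_apply]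
      ring)
    (fun x => by
      have := mul_le_mul_of_nonneg_left (a_le x) hα.le
      linarith)
    (fun x => by
      have h1 := pow_le_pow_left₀ (by positivity) (rB x) 2
      have h2 := pow_le_pow_left₀ (by positivity) (sB x) 2
      have e : 1 / (8 * B ^ 2) = ((2 * B)⁻¹ ^ 2 + (2 * B)⁻¹ ^ 2) / 4 := by field_simp; ring
      rw [e]
      linarith)
    a_le
    (fun x => by
      have h1 : |(m 0 0 (x, 0) + h 0 0 (x, 0))⁻¹ ^ 3| ≤ Q ^ 3 := by
        rw [abs_of_pos (pow_pos (rpos x) 3)]; exact pow_le_pow_left₀ (rpos x).le (rQ x) 3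
      have h2 : |(m 0 0 (x, 0) - h 0 0 (x, 0))⁻¹ ^ 3| ≤ Q ^ 3 := by
        rw [abs_of_pos (pow_pos (spos x) 3)]; exact pow_le_pow_left₀ (spos x).le (sQ x) 3
      have b1 := bm (i := 1) (j := 0) (by norm_num) (x, 0)
      have b2 := bh (i := 1) (j := 0) (by norm_num) (x, 0)
      have k1 := abs_le.1 (abs_mul_le_mul_of_abs_le ((abs_add_le _ _).trans (add_le_add b1 b2)) h1)
      have k2 := abs_le.1 (abs_mul_le_mul_of_abs_le ((abs_sub _ _).trans (add_le_add b1 b2)) h2)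
      rw [abs_le]
      constructor <;> linarith [k1.1, k1.2, k2.1, k2.2])
  -- the term with the mixed derivative
  have cF : Continuous (opC m) := continuous_opC hm hy0
  -- This is ∂_t F(m). It contains m_xxt and m_xtt, so the third derivatives of m must be continuous
  -- and bounded.
  have cFt : Continuous fun p : ℝ × ℝ => m 2 1 p - m 1 2 p / (2 * m 0 0 (p.1, 0) ^ 2) +
      m 0 2 p * m 1 0 (p.1, 0) / (2 * m 0 0 (p.1, 0) ^ 3) := by
    refine (m21.sub (m12.div (by fun_prop) fun p => ?_)).add
      ((m02.mul (by fun_prop)).div (by fun_prop) fun p => ?_)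
    · exact mul_ne_zero two_ne_zero (pow_ne_zero _ (hy0 _))
    · exact mul_ne_zero two_ne_zero (pow_ne_zero _ (hy0 _))
  have cd : Continuous fun x => ((m 0 0 (x, 0) + h 0 0 (x, 0))⁻¹ ^ 2 -
    (m 0 0 (x, 0) - h 0 0 (x, 0))⁻¹ ^ 2) / 4 := by fun_prop
  have ch : Continuous fun x : ℝ => h 0 0 (x, 0) := by fun_prop
  have ch' : Continuous fun x : ℝ => h 1 0 (x, 0) := by fun_prop
  have hmix := integral_carlemanWeight_mixed_le hM hT hl1 hα (L := Q ^ 3) (K := K₃) (by positivity)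
    cF cFt c10 c11 cd ch
    (fun x hx t ht => by
      have d1 := hm.hasDerivAt_t (i := 2) (j := 0) (by norm_num) hx ht
      have d2 := hm.hasDerivAt_t (i := 1) (j := 1) (by norm_num) hx ht
      have d3 := hm.hasDerivAt_t (i := 0) (j := 1) (by norm_num) hx ht
      exact (d1.sub (d2.div_const (2 * m 0 0 (x, 0) ^ 2))).add
        ((d3.mul_const (m 1 0 (x, 0))).div_const (2 * m 0 0 (x, 0) ^ 3)))
    (fun x hx t ht => hh.hasDerivAt_t (i := 1) (j := 0) (by norm_num) hx ht)
    (fun p => abs_opC_le hq₀ (hy p.1) (bm (by norm_num) _) (bm (by norm_num) _) (bm (by norm_num) _)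
      (bm (by norm_num) _))
    (fun p => abs_opC_le hq₀ (hy p.1) (bm (by norm_num) _) (bm (by norm_num) _) (bm (by norm_num) _)
      (bm (by norm_num) _))
    (fun x => by
      rw [abs_div, abs_of_pos (four_pos : (0 : ℝ) < 4), div_le_iff₀ four_pos]
      have := abs_inv_sq_sub_inv_sq_le hq₀ (hp x) (hn x)
      linarith)
  have hI0 := integral_carlemanWeight_fst_le (lam := lam) (α := α) hM hT ch
  have hI1 := integral_carlemanWeight_fst_le (lam := lam) (α := α) hM hT ch'
  have hH0 := sq_mul_intervalIntegral_carlemanWeight_le (α := α) hM hl0 ch ch'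
    (fun x hx => hh.hasDerivAt_x (i := 0) (j := 0) (by norm_num) hx ht0) (h00 0 ht0)
  have hZ := sq_mul_integral_carlemanWeight_le (α := α) hM hT hl0 c00 c10
    (fun x hx t ht => hh.hasDerivAt_x (i := 0) (j := 0) (by norm_num) hx ht) h00
  -- the pointwise bound, integrated
  have cFp : Continuous (opC fun i j => m i j + h i j) := continuous_opC (ε := ε) (M := M) (T := T)
    ⟨fun hij => (hm.continuous hij).add (hh.continuous hij),
      fun hij _ _ hx ht => (hm.hasDerivAt_x hij hx ht).add (hh.hasDerivAt_x hij hx ht),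
      fun hij _ _ hx ht => (hm.hasDerivAt_t hij hx ht).add (hh.hasDerivAt_t hij hx ht),
      fun hij p => congrArg₂ (· + ·) (hm.apply_projRect hij p) (hh.apply_projRect hij p)⟩ hp0
  have cFn : Continuous (opC fun i j => m i j - h i j) := continuous_opC (ε := ε) (M := M) (T := T)
    ⟨fun hij => (hm.continuous hij).sub (hh.continuous hij),
      fun hij _ _ hx ht => (hm.hasDerivAt_x hij hx ht).sub (hh.hasDerivAt_x hij hx ht),
      fun hij _ _ hx ht => (hm.hasDerivAt_t hij hx ht).sub (hh.hasDerivAt_t hij hx ht),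
      fun hij p => congrArg₂ (· - ·) (hm.apply_projRect hij p) (hh.apply_projRect hij p)⟩ hn0
  have cA : Continuous fun p : ℝ × ℝ => ((m 0 0 (p.1, 0) + h 0 0 (p.1, 0))⁻¹ ^ 2 +
      (m 0 0 (p.1, 0) - h 0 0 (p.1, 0))⁻¹ ^ 2) / 4 :=
    (((cr.pow 2).add (cs.pow 2)).div_const 4).comp continuous_fst
  have cw : Continuous (carlemanWeight lam α) := by fun_prop
  have cX : Continuous fun p : ℝ × ℝ => carlemanWeight lam α p *
      (h 2 0 p - ((m 0 0 (p.1, 0) + h 0 0 (p.1, 0))⁻¹ ^ 2 +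
        (m 0 0 (p.1, 0) - h 0 0 (p.1, 0))⁻¹ ^ 2) / 4 * h 1 1 p) ^ 2 :=
    cw.mul ((c20.sub (cA.mul c11)).pow 2)
  have cN : Continuous fun p : ℝ × ℝ => 4 * (carlemanWeight lam α p * (opC m p * (((m 0 0 (p.1, 0) + h 0 0 (p.1, 0))⁻¹ ^ 2 -
        (m 0 0 (p.1, 0) - h 0 0 (p.1, 0))⁻¹ ^ 2) / 4) * h 1 1 p)) :=
    (cw.mul ((cF.mul (cd.comp continuous_fst)).mul c11)).const_mul 4
  have cI₀ : Continuous fun p : ℝ × ℝ => K₁ * (carlemanWeight lam α p * h 0 0 (p.1, 0) ^ 2) := by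
    fun_prop
  have cI₁ : Continuous fun p : ℝ × ℝ => K₁ * (carlemanWeight lam α p * h 1 0 (p.1, 0) ^ 2) := by
    fun_prop
  have cY : Continuous fun p : ℝ × ℝ => K₁ * (carlemanWeight lam α p * h 0 1 p ^ 2) := by
    fun_prop
  have cII : Continuous fun p : ℝ × ℝ => K₁ * (carlemanWeight lam α p * h 0 0 (p.1, 0) ^ 2) +
    K₁ * (carlemanWeight lam α p * h 1 0 (p.1, 0) ^ 2) := cI₀.add cI₁
  have cIIY : Continuous fun p : ℝ × ℝ => K₁ * (carlemanWeight lam α p * h 0 0 (p.1, 0) ^ 2) +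
    K₁ * (carlemanWeight lam α p * h 1 0 (p.1, 0) ^ 2) +
    K₁ * (carlemanWeight lam α p * h 0 1 p ^ 2) := cII.add cY
  have cXN : Continuous fun p : ℝ × ℝ => carlemanWeight lam α p *
      (h 2 0 p - ((m 0 0 (p.1, 0) + h 0 0 (p.1, 0))⁻¹ ^ 2 +
        (m 0 0 (p.1, 0) - h 0 0 (p.1, 0))⁻¹ ^ 2) / 4 * h 1 1 p) ^ 2 -
      4 * (carlemanWeight lam α p * (opC m p * (((m 0 0 (p.1, 0) + h 0 0 (p.1, 0))⁻¹ ^ 2 -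
        (m 0 0 (p.1, 0) - h 0 0 (p.1, 0))⁻¹ ^ 2) / 4) * h 1 1 p)) := cX.sub cN
  have hmain : ∫ p in OmegaT ε M T, (carlemanWeight lam α p *
      (h 2 0 p - ((m 0 0 (p.1, 0) + h 0 0 (p.1, 0))⁻¹ ^ 2 +
        (m 0 0 (p.1, 0) - h 0 0 (p.1, 0))⁻¹ ^ 2) / 4 * h 1 1 p) ^ 2 -
      4 * (carlemanWeight lam α p * (opC m p * (((m 0 0 (p.1, 0) + h 0 0 (p.1, 0))⁻¹ ^ 2 -
        (m 0 0 (p.1, 0) - h 0 0 (p.1, 0))⁻¹ ^ 2) / 4) * h 1 1 p)) -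
      (K₁ * (carlemanWeight lam α p * h 0 0 (p.1, 0) ^ 2) +
        K₁ * (carlemanWeight lam α p * h 1 0 (p.1, 0) ^ 2) +
        K₁ * (carlemanWeight lam α p * h 0 1 p ^ 2))) ≤
      ∫ p in OmegaT ε M T, carlemanWeight lam α p * (opC (fun i j => m i j + h i j) p ^ 2 +
        opC (fun i j => m i j - h i j) p ^ 2 - 2 * opC m p ^ 2) := by
    refine setIntegral_OmegaT_mono (cXN.sub cIIY)
      (by fun_prop) fun p _ => ?_
    have hw := carlemanWeight_pos (lam := lam) (α := α) p
    have := hpt (m 0 0 (p.1, 0)) (h 0 0 (p.1, 0)) (m 1 0 (p.1, 0)) (h 1 0 (p.1, 0)) (m 2 0 p)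
      (h 2 0 p) (m 1 1 p) (h 1 1 p) (m 0 1 p) (h 0 1 p) (hp _) (hn _) (bm (by norm_num) _)
      (bh (by norm_num) _) (bm (by norm_num) _) (bm (by norm_num) _) (bm (by norm_num) _)
      (bh (by norm_num) _)
    have := mul_le_mul_of_nonneg_left this hw.le
    refine le_trans (le_of_eq ?_) this
    simp only [opC]
    ring
  rw [integral_sub cXN.integrableOn_OmegaT cIIY.integrableOn_OmegaT,
    integral_sub cX.integrableOn_OmegaT cN.integrableOn_OmegaT,
    integral_add cII.integrableOn_OmegaT cY.integrableOn_OmegaT,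
    integral_add cI₀.integrableOn_OmegaT cI₁.integrableOn_OmegaT, integral_const_mul, integral_const_mul,
    integral_const_mul, integral_const_mul] at hmain
  have nn : ∀ f : ℝ × ℝ → ℝ, 0 ≤ ∫ p in OmegaT ε M T, carlemanWeight lam α p * f p ^ 2 :=
    fun f => integral_nonneg fun p => mul_nonneg (carlemanWeight_pos p).le (sq_nonneg _)
  have nn1 : ∀ f : ℝ → ℝ, 0 ≤ ∫ x in ε..M, carlemanWeight lam α (x, 0) * f x ^ 2 :=
    fun f => intervalIntegral.integral_nonneg hM.le fun p _ =>
      mul_nonneg (carlemanWeight_pos _).le (sq_nonneg _)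
  refine le_trans ?_ hmain
  clear hmain hpt hcar
  have nV := nn (h 1 0)
  have nY := nn (h 0 1)
  have nZ := nn (h 0 0)
  have nI0 := nn fun p => h 0 0 (p.1, 0)
  have nI1 := nn fun p => h 1 0 (p.1, 0)
  have nH0 := nn1 fun x => h 0 0 (x, 0)
  have nV0 := nn1 fun x => h 1 0 (x, 0)
  have nVT := nn1 fun x => h 1 0 (x, T)
  generalize (∫ p in OmegaT ε M T, carlemanWeight lam α p *
      (h 2 0 p - ((m 0 0 (p.1, 0) + h 0 0 (p.1, 0))⁻¹ ^ 2 +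
        (m 0 0 (p.1, 0) - h 0 0 (p.1, 0))⁻¹ ^ 2) / 4 * h 1 1 p) ^ 2) = X at *
  generalize (∫ p in OmegaT ε M T, carlemanWeight lam α p * (opC m p *
    (((m 0 0 (p.1, 0) + h 0 0 (p.1, 0))⁻¹ ^ 2 -
        (m 0 0 (p.1, 0) - h 0 0 (p.1, 0))⁻¹ ^ 2) / 4) * h 1 1 p)) = N at *
  generalize (∫ p in OmegaT ε M T, carlemanWeight lam α p * h 1 0 p ^ 2) = V at *
  generalize (∫ p in OmegaT ε M T, carlemanWeight lam α p * h 0 1 p ^ 2) = Y at *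
  generalize (∫ p in OmegaT ε M T, carlemanWeight lam α p * h 0 0 p ^ 2) = Z at *
  generalize (∫ p in OmegaT ε M T, carlemanWeight lam α p * h 0 0 (p.1, 0) ^ 2) = I₀ at *
  generalize (∫ p in OmegaT ε M T, carlemanWeight lam α p * h 1 0 (p.1, 0) ^ 2) = I₁ at *
  generalize (∫ x in ε..M, carlemanWeight lam α (x, 0) * h 0 0 (x, 0) ^ 2) = H₀ at *
  generalize (∫ x in ε..M, carlemanWeight lam α (x, 0) * h 1 0 (x, 0) ^ 2) = V₀ at *
  have nE := mul_nonneg (Real.exp_pos (-2 * lam * α * T)).le nVT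
  generalize Real.exp (-2 * lam * α * T) *
    (∫ x in ε..M, carlemanWeight lam α (x, 0) * h 1 0 (x, T) ^ 2) = ET at *
  exact second_difference_absorb hα hK hK₁ hK₄0 hl1 hl2 nV nY nZ nI0 nI1 nH0 nV0 nE hI0 hI1 hH0 hZ
    (by rw [hK₄]; linarith) hcar'

end SecondDifference

/-- The weighted energy of `h` that the Carleman estimate controls. -/
noncomputable def weightedEnergy (ε M T lam α : ℝ) (h : ℕ → ℕ → ℝ × ℝ → ℝ) : ℝ :=
  (∫ p in OmegaT ε M T, carlemanWeight lam α p * h 0 0 p ^ 2) +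
    (∫ p in OmegaT ε M T, carlemanWeight lam α p * h 1 0 p ^ 2) +
    (∫ p in OmegaT ε M T, carlemanWeight lam α p * h 0 1 p ^ 2) +
    (∫ x in ε..M, carlemanWeight lam α (x, 0) * h 0 0 (x, 0) ^ 2) +
    ∫ x in ε..M, carlemanWeight lam α (x, 0) * h 1 0 (x, 0) ^ 2

/-! ### Strong convexity of J. -/

section Convexity

variable {ε M T α cbar R : ℝ}

theorem weightedEnergy_nonneg (hM : ε < M) {lam : ℝ} {h : ℕ → ℕ → ℝ × ℝ → ℝ} :
    0 ≤ weightedEnergy ε M T lam α h := by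
  have nn : ∀ f : ℝ × ℝ → ℝ, 0 ≤ ∫ p in OmegaT ε M T, carlemanWeight lam α p * f p ^ 2 :=
    fun f => integral_nonneg fun p => mul_nonneg (carlemanWeight_pos p).le (sq_nonneg _)
  have nn1 : ∀ f : ℝ → ℝ, 0 ≤ ∫ x in ε..M, carlemanWeight lam α (x, 0) * f x ^ 2 :=
    fun f => intervalIntegral.integral_nonneg hM.le fun p _ =>
      mul_nonneg (carlemanWeight_pos _).le (sq_nonneg _)
  have := nn (h 0 0)
  have := nn (h 1 0)
  have := nn (h 0 1)
  have := nn1 fun x => h 0 0 (x, 0)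
  have := nn1 fun x => h 1 0 (x, 0)
  unfold weightedEnergy
  positivity

theorem qLower_pos (hc : 0 < cbar) : 0 < qLower cbar := by
  unfold qLower
  positivity

/-- The bound on α enters here: the lower bound of q(x,0) makes the transport speed at most 2√c̄, so
the weight decreases along the characteristic direction (1, -a). -/
theorem mul_inv_qLower_sq_lt (hc : 0 < cbar) (hα' : α < 1 / (2 * √cbar)) :
    α * (qLower cbar)⁻¹ ^ 2 / 2 < 1 := by
  have h1 : (cbar ^ (1 / 4 : ℝ)) ^ 2 = √cbar := by
    rw [← Real.rpow_natCast, ← Real.rpow_mul hc.le, Real.sqrt_eq_rpow]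
    norm_num
  have h2 : (qLower cbar)⁻¹ ^ 2 = 4 * √cbar := by
    rw [qLower, one_div, inv_inv, mul_pow, h1]
    norm_num
  have hs : 0 < √cbar := Real.sqrt_pos.2 hc
  rw [lt_div_iff₀ (by positivity)] at hα'
  rw [h2]
  linarith

/-- Outside the rectangle the functions repeat boundary values. With the bound for all x, the
quotients in F are continuous on the whole plane. -/
theorem IsC3.le_apply_zero {u : ℕ → ℕ → ℝ × ℝ → ℝ} (hu : IsC3 ε M T u) (hM : ε < M) (hT : 0 < T)
    {q₀ : ℝ} (h : ∀ x ∈ Icc ε M, q₀ ≤ u 0 0 (x, 0)) (x : ℝ) : q₀ ≤ u 0 0 (x, 0) := by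
  rw [← hu.apply_projRect (by norm_num)]
  have h2 : (projRect ε M T (x, 0)).2 = 0 := by simp [projRect, hT.le]
  have h1 : projRect ε M T (x, 0) = ((projRect ε M T (x, 0)).1, 0) := Prod.ext rfl h2
  rw [h1]
  exact h _ (projRect_mem hM hT _).1

theorem midpoint_mem_admissible (hM : ε < M) (hT : 0 < T) {g₀ g₁ : ℝ → ℝ} {q q' : ℝ × ℝ → ℝ}
    (hq : q ∈ admissible ε M T cbar g₀ g₁) (hq' : q' ∈ admissible ε M T cbar g₀ g₁) :
    (1 / 2 : ℝ) • (q + q') ∈ admissible ε M T cbar g₀ g₁ := by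
  obtain ⟨C, -, hC⟩ := exists_isC3Rep hM hT
  obtain ⟨u, hu, -⟩ := hC q hq.1
  obtain ⟨u', hu', -⟩ := hC q' hq'.1
  rw [hu.mem_admissible_iff hM hT] at hq
  rw [hu'.mem_admissible_iff hM hT] at hq'
  rw [((hu.add hu').const_smul (1 / 2)).mem_admissible_iff hM hT]
  simp only [Pi.smul_apply, Pi.add_apply, smul_eq_mul]
  refine ⟨fun t ht => ?_, fun t ht => ?_, fun t ht => ?_, fun x hx => ?_⟩
  · rw [hq.1 t ht, hq'.1 t ht]; ring
  · rw [hq.2.1 t ht, hq'.2.1 t ht]; ring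
  · rw [hq.2.2.1 t ht, hq'.2.2.1 t ht]; ring
  · linarith [hq.2.2.2 x hx, hq'.2.2.2 x hx]

theorem midpoint_mem_closedB {q q' : ℝ × ℝ → ℝ} (hq : q ∈ closedB ε M T R)
    (hq' : q' ∈ closedB ε M T R) : (1 / 2 : ℝ) • (q + q') ∈ closedB ε M T R := by
  refine ⟨(hq.1.add hq'.1).const_smul _, ?_⟩
  rw [(hq.1.add hq'.1).normH_const_smul isOpen_OmegaT, abs_of_pos (by norm_num)]
  linarith [hq.1.normH_add_le isOpen_OmegaT hq'.1, hq.2, hq'.2]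

theorem intervalIntegral_carlemanWeight_le (hε : 0 < ε) (hM : ε < M) {lam b : ℝ} (hl : 0 ≤ lam)
    {f : ℝ → ℝ} (hf : ∀ x, |f x| ≤ b) :
    ∫ x in ε..M, carlemanWeight lam α (x, 0) * f x ^ 2 ≤ b ^ 2 * (M - ε) := by
  refine (le_abs_self _).trans ?_
  rw [← abs_of_pos (sub_pos.2 hM)]
  refine intervalIntegral.norm_integral_le_of_norm_le_const (E := ℝ) fun x hx => ?_
  rw [uIoc_of_le hM.le] at hx
  have hx0 : 0 < x := hε.trans hx.1
  have hw : carlemanWeight lam α (x, 0) ≤ 1 := by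
    rw [carlemanWeight, Real.exp_le_one_iff]
    have := mul_nonneg hl hx0.le
    simp only [mul_zero, add_zero]
    linarith
  have hf2 : f x ^ 2 ≤ b ^ 2 := sq_le_sq.2 ((hf x).trans (le_abs_self _))
  rw [Real.norm_eq_abs, abs_of_nonneg (mul_nonneg (carlemanWeight_pos _).le (sq_nonneg _))]
  exact (mul_le_of_le_one_left (sq_nonneg _) hw).trans hf2

/-- From exp(z) ≥ z²/2 for z ≥ 0. With s = αT this lets the penalty β = 2 exp(-λαT) dominate the
boundary term at t = T. -/
theorem mul_exp_neg_two_le {D s lam : ℝ} (hs : 0 < s) (hl0 : 0 ≤ lam) (hl : 2 * D / s ^ 2 ≤ lam) :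
    D * lam * Real.exp (-2 * (lam * s)) ≤ Real.exp (-(lam * s)) := by
  have h1 : D * lam ≤ Real.exp (lam * s) := by
    have := Real.quadratic_le_exp_of_nonneg (mul_nonneg hl0 hs.le)
    rw [div_le_iff₀ (by positivity)] at hl
    have h2 := mul_le_mul_of_nonneg_right hl hl0
    have h3 : 0 ≤ lam * s := by positivity
    linarith
  have h2 : Real.exp (-(lam * s)) = Real.exp (lam * s) * Real.exp (-2 * (lam * s)) := by
    rw [← Real.exp_add]; ring_nf
  rw [h2]
  exact mul_le_mul_of_nonneg_right h1 (Real.exp_pos _).le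

/-- Strong convexity of the functional `J`, at midpoints. -/
theorem funJ_midpoint_convex (hε : 0 < ε) (hM : ε < M) (hT : 0 < T) (hα : 0 < α) (hc : 0 < cbar)
    (hα' : α < 1 / (2 * √cbar)) (hR : 0 < R) :
    ∃ lam₁ : ℝ, 1 ≤ lam₁ ∧ ∃ c₀ : ℝ, 0 < c₀ ∧ ∀ lam, lam₁ ≤ lam → ∀ g₀ g₁ : ℝ → ℝ,
      ∀ q ∈ closedB ε M T R ∩ admissible ε M T cbar g₀ g₁,
      ∀ q' ∈ closedB ε M T R ∩ admissible ε M T cbar g₀ g₁,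
      ∀ u, IsC3Rep ε M T ((1 / 2 : ℝ) • (q - q')) u → ∀ β, β = 2 * Real.exp (-lam * α * T) →
      c₀ * weightedEnergy ε M T lam α u +
          β * normH 5 (OmegaT ε M T) ((1 / 2 : ℝ) • (q - q')) ^ 2 ≤
        funJ ε M T lam α β q + funJ ε M T lam α β q' -
          2 * funJ ε M T lam α β ((1 / 2 : ℝ) • (q + q')) := by
  obtain ⟨C, hC0, hC⟩ := exists_isC3Rep hM hT
  obtain ⟨lam₀, hlam₀, c₀, hc₀, K, hK, hconv⟩ := integral_second_difference_ge hM hT hα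
    (mul_pos hC0 hR) (qLower_pos hc) (mul_inv_qLower_sq_lt hc hα')
  have hαT : 0 < α * T := mul_pos hα hT
  -- The boundary term at t = T is K λ exp(-2λαT) times an integral of at most C²(M - ε)[h]². The
  -- second threshold makes it smaller than (β/2)[h]².
  refine ⟨max lam₀ (2 * (K * (C ^ 2 * (M - ε))) / (α * T) ^ 2), hlam₀.trans (le_max_left _ _), c₀,
    hc₀, ?_⟩
  intro lam hlam g₀ g₁ q hq q' hq' uh huh β hβ
  have hl1 : 1 ≤ lam := hlam₀.trans ((le_max_left _ _).trans hlam)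
  have hΩ : IsOpen (OmegaT ε M T) := isOpen_OmegaT
  obtain ⟨um, hum, -⟩ := hC _ ((hq.1.1.add hq'.1.1).const_smul (1 / 2))
  set h := (1 / 2 : ℝ) • (q - q') with hh
  set m := (1 / 2 : ℝ) • (q + q') with hm
  have hmh : m + h = q := by rw [hh, hm]; module
  have hmh' : m - h = q' := by rw [hh, hm]; module
  have hup : IsC3Rep ε M T q fun i j => um i j + uh i j := by
    have := hum.add huh; rwa [hmh] at this
  have hun : IsC3Rep ε M T q' fun i j => um i j - uh i j := by
    have := hum.sub huh; rwa [hmh'] at this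
  have nm : normH 5 (OmegaT ε M T) m ≤ R := (midpoint_mem_closedB hq.1 hq'.1).2
  have nh : normH 5 (OmegaT ε M T) h ≤ R := by
    rw [hh, (hq.1.1.sub hq'.1.1).normH_const_smul hΩ, abs_of_pos (by norm_num)]
    have := hq.1.1.normH_add_le hΩ (hq'.1.1.const_smul (-1))
    rw [hq'.1.1.normH_const_smul hΩ, neg_one_smul, ← sub_eq_add_neg] at this
    norm_num at this
    linarith [hq.1.2, hq'.1.2]
  have hAp := (hup.mem_admissible_iff hM hT).1 hq.2
  have hAn := (hun.mem_admissible_iff hM hT).1 hq'.2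
  simp only [Pi.add_apply] at hAp
  simp only [Pi.sub_apply] at hAn
  have key := hconv lam ((le_max_left _ _).trans hlam) um uh hum.toIsC3 huh.toIsC3
    (fun hij p => (hum.abs_le hM hT hC hij p).trans (mul_le_mul_of_nonneg_left nm hC0.le))
    (fun hij p => (huh.abs_le hM hT hC hij p).trans (mul_le_mul_of_nonneg_left nh hC0.le))
    (hup.toIsC3.le_apply_zero hM hT hAp.2.2.2) (hun.toIsC3.le_apply_zero hM hT hAn.2.2.2)
    (fun t ht => by linarith [hAp.1 t ht, hAn.1 t ht])
    (fun t ht => by linarith [hAp.2.1 t ht, hAn.2.1 t ht])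
    (fun t ht => by linarith [hAp.2.2.1 t ht, hAn.2.2.1 t ht])
  have hVT := intervalIntegral_carlemanWeight_le (α := α) (lam := lam) hε hM (by linarith)
    fun x => huh.abs_le hM hT hC (i := 1) (j := 0) (by norm_num) (x, T)
  -- The penalty alone contributes 2β[h]² to the second difference, so β[h]² is left after the
  -- absorption.
  have hpar := hum.memH.parallelogram hΩ huh.memH
  rw [hmh, hmh'] at hpar
  have hF : ∀ {v : ℕ → ℕ → ℝ × ℝ → ℝ} {z}, IsC3Rep ε M T z v →
      (∀ x ∈ Icc ε M, qLower cbar ≤ v 0 0 (x, 0)) →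
      IntegrableOn (fun p => carlemanWeight lam α p * opC v p ^ 2) (OmegaT ε M T) := by
    intro v z hv hl
    have := continuous_opC hv.toIsC3 fun x =>
      ((qLower_pos hc).trans_le (hv.toIsC3.le_apply_zero hM hT hl x)).ne'
    exact Continuous.integrableOn_OmegaT (by fun_prop)
  have hAm := (hum.mem_admissible_iff hM hT).1 (midpoint_mem_admissible hM hT hq.2 hq'.2)
  have i₁ := hF hup hAp.2.2.2
  have i₂ := hF hun hAn.2.2.2
  have i₃ := hF hum hAm.2.2.2
  have hsplit : ∫ p in OmegaT ε M T, carlemanWeight lam α p *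
      (opC (fun i j => um i j + uh i j) p ^ 2 + opC (fun i j => um i j - uh i j) p ^ 2 -
        2 * opC um p ^ 2) =
      (∫ p in OmegaT ε M T, carlemanWeight lam α p * opC (fun i j => um i j + uh i j) p ^ 2) +
      (∫ p in OmegaT ε M T, carlemanWeight lam α p * opC (fun i j => um i j - uh i j) p ^ 2) -
      2 * ∫ p in OmegaT ε M T, carlemanWeight lam α p * opC um p ^ 2 := by
    rw [← integral_const_mul, ← integral_add i₁ i₂]
    refine Eq.trans (integral_congr_ae (Filter.Eventually.of_forall fun p => ?_))
      (integral_sub (i₁.add i₂) (i₃.const_mul 2))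
    dsimp only
    ring
  rw [hup.funJ_eq hM hT, hun.funJ_eq hM hT, hum.funJ_eq hM hT]
  rw [hsplit] at key
  simp only [carlemanWeight] at key hVT
  have hexp := mul_exp_neg_two_le hαT (by linarith) ((le_max_right _ _).trans hlam)
  have hβ' : Real.exp (-(lam * (α * T))) = β / 2 := by
    rw [hβ, show -lam * α * T = -(lam * (α * T)) by ring]; ring
  rw [hβ'] at hexp
  have hE : Real.exp (-2 * lam * α * T) = Real.exp (-2 * (lam * (α * T))) := by ring_nf
  rw [hE] at key
  have e1 := mul_le_mul_of_nonneg_left hVT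
    (by positivity : 0 ≤ K * lam * Real.exp (-2 * (lam * (α * T))))
  have e2 := mul_le_mul_of_nonneg_right hexp (sq_nonneg (normH 5 (OmegaT ε M T) h))
  simp only [weightedEnergy, carlemanWeight]
  have hβ0 : 0 ≤ β := by rw [hβ]; positivity
  have e3 := congrArg (β * ·) hpar
  have e4 := mul_nonneg hβ0 (sq_nonneg (normH 5 (OmegaT ε M T) h))
  linarith

end Convexity

/-! ### Existence and uniqueness of the minimizer -/

section Minimizer

variable {ε M T α cbar R : ℝ}

theorem MemH.abs_normH_sub_le {k : ℕ} {Ω : Set (ℝ × ℝ)} (hΩ : IsOpen Ω) {q q' : ℝ × ℝ → ℝ}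
    (h : MemH k Ω q) (h' : MemH k Ω q') :
    |normH k Ω q - normH k Ω q'| ≤ normH k Ω (q - q') := by
  have h1 := (h.sub h').normH_add_le hΩ h'
  have h2 := (h'.sub h).normH_add_le hΩ h
  rw [sub_add_cancel] at h1 h2
  rw [h'.normH_sub_rev hΩ h] at h2
  exact abs_le.2 ⟨by linarith, by linarith⟩

theorem MemH.ae_eq_zero (hM : ε < M) (hT : 0 < T) {q : ℝ × ℝ → ℝ}
    (hq : MemH 5 (OmegaT ε M T) q) (h0 : normH 5 (OmegaT ε M T) q = 0) :
    q =ᵐ[volume.restrict (OmegaT ε M T)] 0 := by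
  obtain ⟨C, -, hC⟩ := exists_isC3Rep hM hT
  obtain ⟨u, hu, hb⟩ := hC q hq
  filter_upwards [hu.ae_eq_self] with p hp
  have := hb (i := 0) (j := 0) (by norm_num) p
  rw [h0, mul_zero] at this
  rw [hp, Pi.zero_apply]
  exact abs_nonpos_iff.1 this

theorem funJ_nonneg {lam β : ℝ} (hβ : 0 ≤ β) (q : ℝ × ℝ → ℝ) : 0 ≤ funJ ε M T lam α β q :=
  add_nonneg (integral_nonneg fun _ => by positivity) (by positivity)

/-- A sequence of admissible functions of the ball that converges in `H⁵` has its limit there, and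
the functional `J` is continuous along it. -/
theorem funJ_tendsto_of_tendsto_normH (hM : ε < M) (hT : 0 < T) (hc : 0 < cbar) {g₀ g₁ : ℝ → ℝ}
    {q : ℕ → ℝ × ℝ → ℝ} (hq : ∀ n, q n ∈ closedB ε M T R ∩ admissible ε M T cbar g₀ g₁)
    {q' : ℝ × ℝ → ℝ} (hq' : MemH 5 (OmegaT ε M T) q')
    (hlim : Filter.Tendsto (fun n => normH 5 (OmegaT ε M T) (q n - q')) Filter.atTop (nhds 0))
    (lam β : ℝ) :
    q' ∈ closedB ε M T R ∩ admissible ε M T cbar g₀ g₁ ∧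
      Filter.Tendsto (fun n => funJ ε M T lam α β (q n)) Filter.atTop
        (nhds (funJ ε M T lam α β q')) := by
  have hΩ : IsOpen (OmegaT ε M T) := isOpen_OmegaT
  obtain ⟨C, hC0, hC⟩ := exists_isC3Rep hM hT
  obtain ⟨u', hu', -⟩ := hC q' hq'
  choose u hu hub using fun n => hC (q n) (hq n).1.1
  have hnorm : Filter.Tendsto (fun n => normH 5 (OmegaT ε M T) (q n)) Filter.atTop
      (nhds (normH 5 (OmegaT ε M T) q')) := by
    rw [tendsto_iff_norm_sub_tendsto_zero]
    exact squeeze_zero (fun _ => norm_nonneg _)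
      (fun n => (hq n).1.1.abs_normH_sub_le hΩ hq') hlim
  have hpt : ∀ {i j}, i + j ≤ 3 → ∀ p,
      Filter.Tendsto (fun n => u n i j p) Filter.atTop (nhds (u' i j p)) := by
    intro i j hij p
    rw [tendsto_iff_norm_sub_tendsto_zero]
    have := hlim.const_mul C
    rw [mul_zero] at this
    exact squeeze_zero (fun _ => norm_nonneg _)
      (fun n => ((hu n).sub hu').abs_le hM hT hC hij p) this
  have hA := fun n => ((hu n).mem_admissible_iff hM hT).1 (hq n).2
  have hA' : q' ∈ admissible ε M T cbar g₀ g₁ := by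
    rw [hu'.mem_admissible_iff hM hT]
    refine ⟨fun t ht => ?_, fun t ht => ?_, fun t ht => ?_, fun x hx => ?_⟩
    · refine tendsto_nhds_unique (hpt (i := 0) (j := 0) (by norm_num) (ε, t)) ?_
      simp only [(hA _).1 t ht, tendsto_const_nhds]
    · refine tendsto_nhds_unique (hpt (i := 1) (j := 0) (by norm_num) (ε, t)) ?_
      simp only [(hA _).2.1 t ht, tendsto_const_nhds]
    · refine tendsto_nhds_unique (hpt (i := 1) (j := 0) (by norm_num) (M, t)) ?_
      simp only [(hA _).2.2.1 t ht, tendsto_const_nhds]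
    · exact ge_of_tendsto' (hpt (i := 0) (j := 0) (by norm_num) (x, 0))
        fun n => (hA n).2.2.2 x hx
  refine ⟨⟨⟨hq', le_of_tendsto' hnorm fun n => (hq n).1.2⟩, hA'⟩, ?_⟩
  have hA'' := (hu'.mem_admissible_iff hM hT).1 hA'
  simp only [fun n => (hu n).funJ_eq hM hT lam α β]
  rw [hu'.funJ_eq hM hT]
  refine Filter.Tendsto.add ?_ ((hnorm.pow 2).const_mul β)
  have hq₀ := qLower_pos hc
  have hl := fun n => (hu n).toIsC3.le_apply_zero hM hT (hA n).2.2.2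
  have hl' := hu'.toIsC3.le_apply_zero hM hT hA''.2.2.2
  have hbd : ∀ n {i j}, i + j ≤ 3 → ∀ p, |u n i j p| ≤ C * R := fun n i j hij p =>
    (hub n hij p).trans (mul_le_mul_of_nonneg_left (hq n).1.2 hC0.le)
  set B := C * R
  set K := B + B * (qLower cbar)⁻¹ ^ 2 + B * B * (qLower cbar)⁻¹ ^ 3
  -- The C³ bounds and the lower bound of the traces are uniform along the sequence, so F is
  -- uniformly bounded.
  refine tendsto_integral_of_dominated_convergence
    (fun p => carlemanWeight lam α p * K ^ 2) (fun n => ?_) ?_ (fun n => ?_) ?_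
  · have := continuous_opC (hu n).toIsC3 fun x => (hq₀.trans_le (hl n x)).ne'
    exact (by fun_prop : Continuous _).aestronglyMeasurable
  · exact Continuous.integrableOn_OmegaT (by fun_prop)
  · refine Filter.Eventually.of_forall fun p => ?_
    have hK := abs_opC_le hq₀ (hl n p.1) (hbd n (i := 2) (j := 0) (by norm_num) p)
      (hbd n (i := 1) (j := 1) (by norm_num) p) (hbd n (i := 0) (j := 1) (by norm_num) p)
      (hbd n (i := 1) (j := 0) (by norm_num) (p.1, 0))
    rw [Real.norm_eq_abs, abs_of_nonneg (by positivity)]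
    exact mul_le_mul_of_nonneg_left (sq_le_sq.2 (hK.trans (le_abs_self _))) (Real.exp_pos _).le
  · refine Filter.Eventually.of_forall fun p => ?_
    have hne : u' 0 0 (p.1, 0) ≠ 0 := (hq₀.trans_le (hl' _)).ne'
    have h00 := hpt (i := 0) (j := 0) (by norm_num) (p.1, 0)
    refine Filter.Tendsto.const_mul _ (Filter.Tendsto.pow ?_ 2)
    exact ((hpt (by norm_num) p).sub ((hpt (by norm_num) p).div ((h00.pow 2).const_mul 2)
      (by positivity))).add (((hpt (by norm_num) p).mul (hpt (by norm_num) _)).div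
      ((h00.pow 3).const_mul 2) (by positivity))

/-- If a nonnegative functional satisfies the midpoint inequality, it has a minimizer. -/
theorem exists_isMinimizer_funJ (hM : ε < M) (hT : 0 < T) (hc : 0 < cbar) {g₀ g₁ : ℝ → ℝ}
    {lam β : ℝ} (hβ : 0 < β)
    (hne : (closedB ε M T R ∩ admissible ε M T cbar g₀ g₁).Nonempty)
    (hconv : ∀ q ∈ closedB ε M T R ∩ admissible ε M T cbar g₀ g₁,
      ∀ q' ∈ closedB ε M T R ∩ admissible ε M T cbar g₀ g₁,
      β * normH 5 (OmegaT ε M T) ((1 / 2 : ℝ) • (q - q')) ^ 2 ≤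
        funJ ε M T lam α β q + funJ ε M T lam α β q' -
          2 * funJ ε M T lam α β ((1 / 2 : ℝ) • (q + q'))) :
    ∃ q, IsMinimizer (funJ ε M T lam α β)
      (closedB ε M T R ∩ admissible ε M T cbar g₀ g₁) q := by
  have hΩ : IsOpen (OmegaT ε M T) := isOpen_OmegaT
  set S := closedB ε M T R ∩ admissible ε M T cbar g₀ g₁
  set J := funJ ε M T lam α β
  have hbdd : BddBelow (J '' S) := ⟨0, by
    rintro _ ⟨q, -, rfl⟩
    exact funJ_nonneg hβ.le q⟩
  set a := sInf (J '' S)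
  have ha : ∀ q ∈ S, a ≤ J q := fun q hq => csInf_le hbdd (mem_image_of_mem _ hq)
  have hseq : ∀ n : ℕ, ∃ q ∈ S, J q < a + 1 / ((n : ℝ) + 1) := fun n => by
    obtain ⟨_, ⟨q, hq, rfl⟩, hlt⟩ := exists_lt_of_csInf_lt (hne.image J)
      (lt_add_of_pos_right a (by positivity : (0 : ℝ) < 1 / ((n : ℝ) + 1)))
    exact ⟨q, hq, hlt⟩
  choose q hqS hqJ using hseq
  -- Midpoints stay in the set, so J there is at least the infimum. Strong convexity thus replaces
  -- weak compactness and lower semicontinuity.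
  have hcauchy : ∀ r > 0, ∃ N, ∀ m ≥ N, ∀ n ≥ N,
      normH 5 (OmegaT ε M T) (q m - q n) < r := by
    intro r hr
    -- The midpoint inequality gives (β/4)[q_m - q_n]² < 2/(N + 1) < β r²/4.
    obtain ⟨N, hN⟩ := exists_nat_one_div_lt (by positivity : 0 < β * r ^ 2 / 8)
    refine ⟨N, fun m hm n hn => ?_⟩
    have h1 := hconv _ (hqS m) _ (hqS n)
    have h2 := ha _ ⟨midpoint_mem_closedB (hqS m).1 (hqS n).1,
      midpoint_mem_admissible hM hT (hqS m).2 (hqS n).2⟩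
    rw [((hqS m).1.1.sub (hqS n).1.1).normH_const_smul hΩ, abs_of_pos (by norm_num)] at h1
    have h3 : 1 / ((m : ℝ) + 1) ≤ 1 / ((N : ℝ) + 1) := by gcongr
    have h4 : 1 / ((n : ℝ) + 1) ≤ 1 / ((N : ℝ) + 1) := by gcongr
    have h5 : β * normH 5 (OmegaT ε M T) (q m - q n) ^ 2 < β * r ^ 2 := by
      linarith [hqJ m, hqJ n]
    exact lt_of_pow_lt_pow_left₀ 2 hr.le (lt_of_mul_lt_mul_left h5 hβ.le)
  obtain ⟨q', hq', hlim⟩ := exists_tendsto_normH hΩ (fun n => (hqS n).1.1) hcauchy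
  obtain ⟨hmem, hJ⟩ := funJ_tendsto_of_tendsto_normH (α := α) hM hT hc hqS hq' hlim lam β
  refine ⟨q', hmem, fun z hz => ?_⟩
  refine (le_of_tendsto_of_tendsto' hJ ?_ fun n => (hqJ n).le).trans (ha z hz)
  simpa using tendsto_const_nhds.add (tendsto_one_div_add_atTop_nhds_zero_nat (𝕜 := ℝ))

/-- At the midpoint J is no smaller than at either minimizer, so the convexity gap is not positive
and the distance in H⁵ is zero. -/
theorem IsMinimizer.ae_eq (hM : ε < M) (hT : 0 < T) {g₀ g₁ : ℝ → ℝ} {lam β : ℝ} (hβ : 0 < β)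
    (hconv : ∀ q ∈ closedB ε M T R ∩ admissible ε M T cbar g₀ g₁,
      ∀ q' ∈ closedB ε M T R ∩ admissible ε M T cbar g₀ g₁,
      β * normH 5 (OmegaT ε M T) ((1 / 2 : ℝ) • (q - q')) ^ 2 ≤
        funJ ε M T lam α β q + funJ ε M T lam α β q' -
          2 * funJ ε M T lam α β ((1 / 2 : ℝ) • (q + q')))
    {q q' : ℝ × ℝ → ℝ} (hq : IsMinimizer (funJ ε M T lam α β)
      (closedB ε M T R ∩ admissible ε M T cbar g₀ g₁) q)
    (hq' : IsMinimizer (funJ ε M T lam α β)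
      (closedB ε M T R ∩ admissible ε M T cbar g₀ g₁) q') :
    q =ᵐ[volume.restrict (OmegaT ε M T)] q' := by
  have hmem : (1 / 2 : ℝ) • (q + q') ∈ closedB ε M T R ∩ admissible ε M T cbar g₀ g₁ :=
    ⟨midpoint_mem_closedB hq.1.1 hq'.1.1, midpoint_mem_admissible hM hT hq.1.2 hq'.1.2⟩
  have h1 := isMinOn_iff.1 hq.2 _ hmem
  have h2 := isMinOn_iff.1 hq'.2 _ hmem
  have h3 := hconv q hq.1 q' hq'.1
  have h4 : normH 5 (OmegaT ε M T) ((1 / 2 : ℝ) • (q - q')) = 0 := by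
    have : β * normH 5 (OmegaT ε M T) ((1 / 2 : ℝ) • (q - q')) ^ 2 ≤ 0 := by linarith
    exact pow_eq_zero_iff two_ne_zero |>.1
      (le_antisymm (nonpos_of_mul_nonpos_right this hβ) (sq_nonneg _))
  filter_upwards [MemH.ae_eq_zero hM hT ((hq.1.1.1.sub hq'.1.1.1).const_smul _) h4] with p hp
  simp only [Pi.smul_apply, Pi.sub_apply, smul_eq_mul, Pi.zero_apply] at hp
  linarith

end Minimizer

/-! ### Stability estimates -/

/-! ### First order Sobolev norms and lower bounds of the weight. -/

section FirstOrderNorms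

variable {ε M T α : ℝ}

/-- Integration by parts identifies the classical derivative with the weak one; test functions
vanish at the end points. Equality with g is required only inside, as `val` has no meaning off the
closed rectangle. -/
theorem memH1D_one_of_hasDerivAt {a b : ℝ} (hab : a < b) {f f' g : ℝ → ℝ} (hf : Continuous f)
    (hf' : Continuous f') (hderiv : ∀ x ∈ Ioo a b, HasDerivAt f (f' x) x)
    (hg : ∀ x ∈ Ioo a b, g x = f x) :
    MemH1D 1 (Ioo a b) g ∧
      normH1D 1 (Ioo a b) g = √((∫ x in a..b, f x ^ 2) + ∫ x in a..b, f' x ^ 2) := by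
  have hfg : f =ᵐ[volume.restrict (Ioo a b)] g :=
    (ae_restrict_iff' measurableSet_Ioo).2 (Filter.Eventually.of_forall fun x hx => (hg x hx).symm)
  have hmem : ∀ {k : ℝ → ℝ}, Continuous k → MemLp k 2 (volume.restrict (Ioo a b)) := by
    intro k hk
    rw [memLp_two_iff_integrable_sq hk.aestronglyMeasurable]
    exact (by fun_prop : Continuous fun x => k x ^ 2).integrableOn_Ioo
  have hloc : ∀ {k : ℝ → ℝ}, Continuous k → LocallyIntegrableOn k (Ioo a b) :=
    fun hk => hk.integrableOn_Ioo.locallyIntegrableOn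
  have w0 : IsWeakDeriv (Ioo a b) (List.replicate 0 (1 : ℝ)) g f :=
    IsWeakDeriv.congr (⟨hloc hf, hloc hf, fun φ _ => by simp⟩ :
      IsWeakDeriv (Ioo a b) (List.replicate 0 (1 : ℝ)) f f) hfg (ae_eq_refl _)
  have w1 : IsWeakDeriv (Ioo a b) (List.replicate 1 (1 : ℝ)) g f' := by
    refine IsWeakDeriv.congr (f := f) ⟨hloc hf, hloc hf', fun φ hφ => ?_⟩ hfg (ae_eq_refl _)
    have hφ' := hφ.deriv.1.continuous
    simp only [List.replicate_one, List.foldr_cons, List.foldr_nil, List.length_cons,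
      List.length_nil, ← deriv_eq_dirDeriv]
    rw [setIntegral_Ioo_eq_intervalIntegral hab.le, setIntegral_Ioo_eq_intervalIntegral hab.le,
      intervalIntegral.integral_mul_deriv_eq_deriv_mul_of_hasDerivAt hf.continuousOn
        hφ.1.continuous.continuousOn
        (fun x hx => hderiv x (by rwa [min_eq_left hab.le, max_eq_right hab.le] at hx))
        (fun x _ => hφ.hasDerivAt x) (hf'.intervalIntegrable _ _) (hφ'.intervalIntegrable _ _),
      hφ.eq_zero_of_notMem (fun h => lt_irrefl _ h.1),
      hφ.eq_zero_of_notMem (fun h => lt_irrefl _ h.2)]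
    ring
  refine ⟨fun i hi => ?_, ?_⟩
  · have hi' : i = 0 ∨ i = 1 := by
      have := Finset.mem_range.1 hi
      omega
    rcases hi' with rfl | rfl
    · exact ⟨f, hmem hf, w0⟩
    · exact ⟨f', hmem hf', w1⟩
  · have e : ∀ {l : List ℝ} {k : ℝ → ℝ}, IsWeakDeriv (Ioo a b) l g k →
        ∫ x in Ioo a b, weakDeriv (Ioo a b) l g x ^ 2 = ∫ x in a..b, k x ^ 2 := by
      intro l k hk
      rw [← setIntegral_Ioo_eq_intervalIntegral hab.le]
      refine integral_congr_ae ?_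
      filter_upwards [hk.weakDeriv_ae_eq isOpen_Ioo] with x hx
      rw [hx]
    rw [normH1D, Finset.sum_range_succ, Finset.sum_range_one, e w0, e w1]

theorem OmegaT_subset {T₀ : ℝ} (hT₀ : T₀ ≤ T) : OmegaT ε M T₀ ⊆ OmegaT ε M T :=
  prod_mono_right (Ioo_subset_Ioo_right hT₀)

theorem multiIndices_one : multiIndices 1 = {(0, 0), (1, 0), (0, 1)} := by decide

theorem IsC3Rep.memH_one_of_le {q : ℝ × ℝ → ℝ} {u : ℕ → ℕ → ℝ × ℝ → ℝ} (h : IsC3Rep ε M T q u)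
    {T₀ : ℝ} (hT₀ : T₀ ≤ T) :
    MemH 1 (OmegaT ε M T₀) q ∧
      normH 1 (OmegaT ε M T₀) q = √((∫ p in OmegaT ε M T₀, u 0 0 p ^ 2) +
        (∫ p in OmegaT ε M T₀, u 1 0 p ^ 2) + ∫ p in OmegaT ε M T₀, u 0 1 p ^ 2) := by
  have hsub := OmegaT_subset (ε := ε) (M := M) hT₀
  have w : ∀ {i j}, i + j ≤ 1 → IsWeakDeriv (OmegaT ε M T₀) (dirs i j) q (u i j) := fun hij =>
    ((h.memH.isWeakDeriv (by omega)).congr (ae_eq_refl _) (h.ae_eq (by omega))).mono hsub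
  have e : ∀ {i j}, i + j ≤ 1 →
      ∫ p in OmegaT ε M T₀, weakDeriv (OmegaT ε M T₀) (dirs i j) q p ^ 2 =
        ∫ p in OmegaT ε M T₀, u i j p ^ 2 := by
    intro i j hij
    refine integral_congr_ae ?_
    filter_upwards [(w hij).weakDeriv_ae_eq isOpen_OmegaT] with x hx
    rw [hx]
  refine ⟨fun a ha => ?_, ?_⟩
  · have ha' := mem_multiIndices.1 ha
    have hc := h.continuous (i := a.1) (j := a.2) (by omega)
    refine ⟨u a.1 a.2, ?_, w ha'⟩
    rw [memLp_two_iff_integrable_sq hc.aestronglyMeasurable]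
    exact (by fun_prop : Continuous fun x => u a.1 a.2 x ^ 2).integrableOn_OmegaT
  · rw [normH, multiIndices_one, Finset.sum_insert (by decide), Finset.sum_insert (by decide),
      Finset.sum_singleton, e (by norm_num), e (by norm_num), e (by norm_num), add_assoc]

/-- The weight decreases in x and t, so its infimum over Ω_{T₀} is its value at the corner (M, T₀).
-/
theorem exp_mul_setIntegral_sq_le {lam T₀ : ℝ} (hT₀ : T₀ ≤ T) (hl : 0 ≤ lam) (hα : 0 < α)
    {f : ℝ × ℝ → ℝ} (hf : Continuous f) :
    Real.exp (-2 * lam * (M + α * T₀)) * ∫ p in OmegaT ε M T₀, f p ^ 2 ≤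
      ∫ p in OmegaT ε M T, carlemanWeight lam α p * f p ^ 2 := by
  have hc : Continuous fun p => carlemanWeight lam α p * f p ^ 2 := by fun_prop
  refine le_trans ?_ (setIntegral_mono_set hc.integrableOn_OmegaT
    (Filter.Eventually.of_forall fun p => mul_nonneg (carlemanWeight_pos p).le (sq_nonneg _))
    (OmegaT_subset hT₀).eventuallyLE)
  rw [← integral_const_mul]
  refine setIntegral_OmegaT_mono (by fun_prop) hc fun p hp => ?_
  refine mul_le_mul_of_nonneg_right (Real.exp_le_exp.2 ?_) (sq_nonneg _)
  have h1 : p.1 + α * p.2 ≤ M + α * T₀ :=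
    add_le_add hp.1.2.le (mul_le_mul_of_nonneg_left hp.2.2.le hα.le)
  have := mul_le_mul_of_nonneg_left h1 hl
  linarith

theorem exp_mul_intervalIntegral_sq_le (hM : ε < M) {lam : ℝ} (hl : 0 ≤ lam) {f : ℝ → ℝ}
    (hf : Continuous f) :
    Real.exp (-2 * lam * M) * ∫ x in ε..M, f x ^ 2 ≤
      ∫ x in ε..M, carlemanWeight lam α (x, 0) * f x ^ 2 := by
  rw [← intervalIntegral.integral_const_mul]
  refine intervalIntegral.integral_mono_on hM.le
    ((by fun_prop : Continuous _).intervalIntegrable _ _)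
    ((by fun_prop : Continuous _).intervalIntegrable _ _) fun x hx => ?_
  refine mul_le_mul_of_nonneg_right (Real.exp_le_exp.2 ?_) (sq_nonneg _)
  have := mul_le_mul_of_nonneg_left hx.2 hl
  simp only [mul_zero, add_zero]
  linarith

theorem exp_mul_setIntegral_le_weightedEnergy (hM : ε < M) {lam T₀ : ℝ} (hT₀ : T₀ ≤ T)
    (hl : 0 ≤ lam) (hα : 0 < α) {u : ℕ → ℕ → ℝ × ℝ → ℝ} (hu : IsC3 ε M T u) :
    Real.exp (-2 * lam * (M + α * T₀)) * ((∫ p in OmegaT ε M T₀, u 0 0 p ^ 2) +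
      (∫ p in OmegaT ε M T₀, u 1 0 p ^ 2) + ∫ p in OmegaT ε M T₀, u 0 1 p ^ 2) ≤
      weightedEnergy ε M T lam α u := by
  have h1 := exp_mul_setIntegral_sq_le (ε := ε) (M := M) hT₀ hl hα
    (hu.continuous (i := 0) (j := 0) (by norm_num))
  have h2 := exp_mul_setIntegral_sq_le (ε := ε) (M := M) hT₀ hl hα
    (hu.continuous (i := 1) (j := 0) (by norm_num))
  have h3 := exp_mul_setIntegral_sq_le (ε := ε) (M := M) hT₀ hl hα
    (hu.continuous (i := 0) (j := 1) (by norm_num))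
  have nn1 : ∀ f : ℝ → ℝ, 0 ≤ ∫ x in ε..M, carlemanWeight lam α (x, 0) * f x ^ 2 :=
    fun f => intervalIntegral.integral_nonneg hM.le fun p _ =>
      mul_nonneg (carlemanWeight_pos _).le (sq_nonneg _)
  unfold weightedEnergy
  linarith [nn1 fun x => u 0 0 (x, 0), nn1 fun x => u 1 0 (x, 0)]

theorem exp_mul_intervalIntegral_le_weightedEnergy (hM : ε < M) {lam : ℝ} (hl : 0 ≤ lam)
    {u : ℕ → ℕ → ℝ × ℝ → ℝ} (hu : IsC3 ε M T u) :
    Real.exp (-2 * lam * M) *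
      ((∫ x in ε..M, u 0 0 (x, 0) ^ 2) + ∫ x in ε..M, u 1 0 (x, 0) ^ 2) ≤
      weightedEnergy ε M T lam α u := by
  have c1 := hu.continuous (i := 0) (j := 0) (by norm_num)
  have c2 := hu.continuous (i := 1) (j := 0) (by norm_num)
  have h1 := exp_mul_intervalIntegral_sq_le (α := α) hM hl
    (by fun_prop : Continuous fun x : ℝ => u 0 0 (x, 0))
  have h2 := exp_mul_intervalIntegral_sq_le (α := α) hM hl
    (by fun_prop : Continuous fun x : ℝ => u 1 0 (x, 0))
  have nn : ∀ f : ℝ × ℝ → ℝ, 0 ≤ ∫ p in OmegaT ε M T, carlemanWeight lam α p * f p ^ 2 :=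
    fun f => integral_nonneg fun p => mul_nonneg (carlemanWeight_pos p).le (sq_nonneg _)
  unfold weightedEnergy
  linarith [nn (u 0 0), nn (u 1 0), nn (u 0 1)]

end FirstOrderNorms

/-! ### Lipschitz dependence of F on its arguments. -/

section Lipschitz

variable {q₀ B d : ℝ}

theorem abs_inv_sub_inv_le (hq₀ : 0 < q₀) {y z : ℝ} (hy : q₀ ≤ y) (hz : q₀ ≤ z) :
    |y⁻¹ - z⁻¹| ≤ q₀⁻¹ ^ 2 * |y - z| := by
  have hy0 : 0 < y := by linarith
  have hz0 : 0 < z := by linarith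
  have e : y⁻¹ - z⁻¹ = y⁻¹ * z⁻¹ * (z - y) := by field_simp
  rw [e, abs_mul, abs_sub_comm z y, abs_of_pos (by positivity), sq]
  gcongr

theorem abs_inv_pow_sub_inv_pow_le (hq₀ : 0 < q₀) {y z : ℝ} (hy : q₀ ≤ y) (hz : q₀ ≤ z) (n : ℕ) :
    |y⁻¹ ^ n - z⁻¹ ^ n| ≤ n * q₀⁻¹ ^ (n + 1) * |y - z| := by
  have hy0 : 0 < y := by linarith
  have hz0 : 0 < z := by linarith
  have hQ : 0 < q₀⁻¹ := inv_pos.2 hq₀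
  have hyQ : y⁻¹ ≤ q₀⁻¹ := inv_anti₀ hq₀ hy
  have hzQ : z⁻¹ ≤ q₀⁻¹ := inv_anti₀ hq₀ hz
  have h1 := abs_inv_sub_inv_le hq₀ hy hz
  induction n with
  | zero => simp
  | succ n ih =>
    have e : y⁻¹ ^ (n + 1) - z⁻¹ ^ (n + 1) =
      y⁻¹ * (y⁻¹ ^ n - z⁻¹ ^ n) + (y⁻¹ - z⁻¹) * z⁻¹ ^ n := by ring
    have a1 : |y⁻¹| ≤ q₀⁻¹ := by rwa [abs_of_pos (inv_pos.2 hy0)]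
    have a2 : |z⁻¹ ^ n| ≤ q₀⁻¹ ^ n := by
      rw [abs_of_pos (by positivity)]
      gcongr
    have b1 := abs_mul_le_mul_of_abs_le a1 ih
    have b2 := abs_mul_le_mul_of_abs_le h1 a2
    rw [e]
    refine (abs_add_le _ _).trans ((add_le_add b1 b2).trans (le_of_eq ?_))
    push_cast
    ring

/-- Change one factor at a time: every difference costs d and the remaining factors are bounded by B
and q₀⁻¹. The constant is not sharp. -/
theorem abs_opC_sub_le (hq₀ : 0 < q₀) {y z a b c y' a' b' c' z' : ℝ} (hy : q₀ ≤ y) (hz : q₀ ≤ z)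
    (hy' : |y'| ≤ B) (hb' : |b'| ≤ B) (hc' : |c'| ≤ B) (hz' : |z'| ≤ B)
    (ha : |a - a'| ≤ d) (hb : |b - b'| ≤ d) (hc : |c - c'| ≤ d) (hyz : |y - z| ≤ d)
    (hyz' : |y' - z'| ≤ d) :
    |(a - b / (2 * y ^ 2) + c * y' / (2 * y ^ 3)) - (a' - b' / (2 * z ^ 2) + c' * z' / (2 * z ^ 3))|
      ≤ (1 + q₀⁻¹ ^ 2 + 4 * B * q₀⁻¹ ^ 3 + 3 * B ^ 2 * q₀⁻¹ ^ 4) * d := by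
  have hy0 : 0 < y := by linarith
  have hz0 : 0 < z := by linarith
  have hd : 0 ≤ d := (abs_nonneg _).trans ha
  have hB : 0 ≤ B := (abs_nonneg _).trans hb'
  have hQ : 0 < q₀⁻¹ := inv_pos.2 hq₀
  have p : ∀ n, |y⁻¹ ^ n| ≤ q₀⁻¹ ^ n := fun n => by
    rw [abs_of_pos (by positivity)]
    gcongr
  have s : ∀ n : ℕ, |y⁻¹ ^ n - z⁻¹ ^ n| ≤ n * q₀⁻¹ ^ (n + 1) * d := fun n =>
    (abs_inv_pow_sub_inv_pow_le hq₀ hy hz n).trans (mul_le_mul_of_nonneg_left hyz (by positivity))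
  have e : (a - b / (2 * y ^ 2) + c * y' / (2 * y ^ 3)) -
      (a' - b' / (2 * z ^ 2) + c' * z' / (2 * z ^ 3)) = (a - a') - (b - b') * y⁻¹ ^ 2 / 2 -
      b' * (y⁻¹ ^ 2 - z⁻¹ ^ 2) / 2 + (c - c') * y' * y⁻¹ ^ 3 / 2 + c' * (y' - z') * y⁻¹ ^ 3 / 2 +
      c' * z' * (y⁻¹ ^ 3 - z⁻¹ ^ 3) / 2 := by
    field_simp
    ring
  have a1 := abs_le.1 (abs_mul_le_mul_of_abs_le hb (p 2))
  have a2 := abs_le.1 (abs_mul_le_mul_of_abs_le hb' (s 2))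
  have a3 := abs_le.1 (abs_mul_le_mul_of_abs_le (abs_mul_le_mul_of_abs_le hc hy') (p 3))
  have a4 := abs_le.1 (abs_mul_le_mul_of_abs_le (abs_mul_le_mul_of_abs_le hc' hyz') (p 3))
  have a5 := abs_le.1 (abs_mul_le_mul_of_abs_le (abs_mul_le_mul_of_abs_le hc' hz') (s 3))
  have a0 := abs_le.1 ha
  push_cast at a2 a5
  have n1 : 0 ≤ q₀⁻¹ ^ 2 * d := by positivity
  have n2 : 0 ≤ B * q₀⁻¹ ^ 3 * d := by positivity
  have n3 : 0 ≤ B ^ 2 * q₀⁻¹ ^ 4 * d := by positivity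
  rw [e, abs_le]
  constructor <;> linarith [a0.1, a0.2, a1.1, a1.2, a2.1, a2.2, a3.1, a3.2, a4.1, a4.2, a5.1, a5.2]

end Lipschitz

/-! ### The relation between λ and the noise level δ. -/

section NoiseLevel

variable {δ s lam : ℝ}

theorem le_log_rpow_of_le_exp (hs : 0 < s) (hδ : 0 < δ) {l : ℝ}
    (h : δ ≤ Real.exp (-(l * s / 2))) : l ≤ Real.log (δ ^ (-2 / s)) := by
  have h1 := (Real.log_le_iff_le_exp hδ).2 h
  rw [Real.log_rpow hδ, div_mul_eq_mul_div, le_div_iff₀ hs]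
  linarith

/-- By the choice of λ, exp(-2λc) = δ^(4c/s), and ρ is the exponent with 4c/s + 2ρ = 2. With s = αT,
the values c = M + αT₀ and c = M give ρ₁ and ρ₂; c = s/2 gives ρ = 0, that is β = 2δ². -/
theorem exp_mul_rpow_sq (hs : 0 < s) (hδ : 0 < δ) (hlam : lam = Real.log (δ ^ (-2 / s)))
    {c ρ : ℝ} (hρ : ρ = (s - 2 * c) / s) :
    Real.exp (-2 * lam * c) * (δ ^ ρ) ^ 2 = δ ^ 2 := by
  have h1 : δ ^ 2 = Real.exp (2 * Real.log δ) := by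
    rw [two_mul, Real.exp_add, Real.exp_log hδ, sq]
  rw [h1, hlam, Real.log_rpow hδ, Real.rpow_def_of_pos hδ, ← Real.exp_nat_mul, ← Real.exp_add, hρ]
  congr 1
  field_simp
  push_cast
  ring

theorem le_mul_rpow_sq (hs : 0 < s) (hδ : 0 < δ) (hlam : lam = Real.log (δ ^ (-2 / s)))
    {c ρ S K : ℝ} (hρ : ρ = (s - 2 * c) / s) (h : Real.exp (-2 * lam * c) * S ≤ K * δ ^ 2) :
    S ≤ K * (δ ^ ρ) ^ 2 := by
  rw [← exp_mul_rpow_sq hs hδ hlam hρ, mul_left_comm] at h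
  exact le_of_mul_le_mul_left h (Real.exp_pos _)

theorem exp_neg_mul_eq_sq (hs : 0 < s) (hδ : 0 < δ) (hlam : lam = Real.log (δ ^ (-2 / s))) :
    Real.exp (-(lam * s)) = δ ^ 2 := by
  have h := exp_mul_rpow_sq hs hδ hlam (c := s / 2) (ρ := 0) (by field_simp; ring)
  rw [Real.rpow_zero] at h
  rw [← h]
  ring_nf

theorem sqrt_le_mul_rpow {ρ S K : ℝ} (hδ : 0 < δ) (h : S ≤ K * (δ ^ ρ) ^ 2) :
    √S ≤ √K * δ ^ ρ := by
  refine (Real.sqrt_le_sqrt h).trans (le_of_eq ?_)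
  rw [Real.sqrt_mul' _ (sq_nonneg _), Real.sqrt_sq (Real.rpow_pos_of_pos hδ _).le]

end NoiseLevel

/-! ### Comparison with the exact solution. -/

section Stability

variable {ε M T α cbar R : ℝ}

/-- Convexity controls half the distance from the minimizer to the shifted solution. Twice that
function differs from q* - q_min only by the shift, bounded by c, and (2h + e)² ≤ 8h² + 2e². -/
theorem setIntegral_OmegaT_sq_le {T₀ : ℝ} (hT₀ : T₀ ≤ T) {f h : ℝ × ℝ → ℝ} (hf : Continuous f)
    (hh : Continuous h) {c : ℝ} (hfh : ∀ p, |f p - 2 * h p| ≤ c) :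
    ∫ p in OmegaT ε M T₀, f p ^ 2 ≤ 8 * (∫ p in OmegaT ε M T₀, h p ^ 2) +
      2 * c ^ 2 * (volume.restrict (OmegaT ε M T)).real univ := by
  have h1 : ∫ p in OmegaT ε M T₀, f p ^ 2 ≤ ∫ p in OmegaT ε M T₀, (8 * h p ^ 2 + 2 * c ^ 2) := by
    refine setIntegral_OmegaT_mono (by fun_prop) (by fun_prop) fun p _ => ?_
    have := sq_le_sq.2 ((hfh p).trans (le_abs_self c))
    nlinarith [sq_nonneg (f p - 4 * h p)]
  refine h1.trans ?_
  rw [integral_add (by fun_prop : Continuous fun p => 8 * h p ^ 2).integrableOn_OmegaT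
    (integrable_const _), integral_const_mul, integral_const, smul_eq_mul, mul_comm _ (2 * c ^ 2)]
  have h2 : (volume.restrict (OmegaT ε M T₀)).real univ ≤
      (volume.restrict (OmegaT ε M T)).real univ :=
    ENNReal.toReal_mono (measure_ne_top _ _)
      (Measure.restrict_mono_set volume (OmegaT_subset hT₀) univ)
  have := mul_le_mul_of_nonneg_left h2 (by positivity : 0 ≤ 2 * c ^ 2)
  linarith

theorem intervalIntegral_sq_le (hM : ε < M) {f h : ℝ → ℝ} (hf : Continuous f) (hh : Continuous h)
    {c : ℝ} (hfh : ∀ p, |f p - 2 * h p| ≤ c) :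
    ∫ x in ε..M, f x ^ 2 ≤ 8 * (∫ x in ε..M, h x ^ 2) + 2 * c ^ 2 * (M - ε) := by
  have h1 : ∫ x in ε..M, f x ^ 2 ≤ ∫ x in ε..M, (8 * h x ^ 2 + 2 * c ^ 2) := by
    refine intervalIntegral.integral_mono_on hM.le
      ((by fun_prop : Continuous _).intervalIntegrable _ _)
      ((by fun_prop : Continuous _).intervalIntegrable _ _) fun x _ => ?_
    have := sq_le_sq.2 ((hfh x).trans (le_abs_self c))
    nlinarith [sq_nonneg (f x - 4 * h x)]
  refine h1.trans (le_of_eq ?_)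
  rw [intervalIntegral.integral_add ((by fun_prop : Continuous _).intervalIntegrable _ _)
    ((by fun_prop : Continuous _).intervalIntegrable _ _), intervalIntegral.integral_const_mul,
    intervalIntegral.integral_const, smul_eq_mul, mul_comm (M - ε)]

/-- The coefficient `1 / (16 q⁴)` depends on `q` in a Lipschitz way, in the norm of `H¹`. -/
theorem normH1D_inv_pow_four_sub_le (hM : ε < M) {q₀ B : ℝ} (hq₀ : 0 < q₀) {a a' b b' g : ℝ → ℝ}
    (ca : Continuous a) (ca' : Continuous a') (cb : Continuous b) (cb' : Continuous b')
    (ha : ∀ x ∈ Ioo ε M, HasDerivAt a (a' x) x) (hb : ∀ x ∈ Ioo ε M, HasDerivAt b (b' x) x)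
    (la : ∀ x, q₀ ≤ a x) (lb : ∀ x, q₀ ≤ b x) (hB : ∀ x, |b' x| ≤ B)
    (hg : ∀ x ∈ Ioo ε M, g x = 1 / (16 * a x ^ 4) - 1 / (16 * b x ^ 4)) :
    MemH1D 1 (Ioo ε M) g ∧ normH1D 1 (Ioo ε M) g ≤ √((q₀⁻¹ ^ 5) ^ 2 + 4 * (B * q₀⁻¹ ^ 6) ^ 2) *
      √((∫ x in ε..M, (a x - b x) ^ 2) + ∫ x in ε..M, (a' x - b' x) ^ 2) := by
  have a0 : ∀ x, a x ≠ 0 := fun x => (hq₀.trans_le (la x)).ne'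
  have b0 : ∀ x, b x ≠ 0 := fun x => (hq₀.trans_le (lb x)).ne'
  have cia : Continuous fun x => (a x)⁻¹ := ca.inv₀ a0
  have cib : Continuous fun x => (b x)⁻¹ := cb.inv₀ b0
  have hd : ∀ {y : ℝ → ℝ} {y' x : ℝ}, HasDerivAt y y' x → y x ≠ 0 →
      HasDerivAt (fun x => (y x)⁻¹ ^ 4) (-4 * (y' * (y x)⁻¹ ^ 5)) x := by
    intro y y' x h h0
    refine HasDerivAt.congr_deriv ((h.inv h0).pow 4) ?_
    simp only [Pi.inv_apply]
    push_cast
    ring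
  obtain ⟨hmem, hnorm⟩ := memH1D_one_of_hasDerivAt hM (g := g)
    (f := fun x => ((a x)⁻¹ ^ 4 - (b x)⁻¹ ^ 4) / 16)
    (f' := fun x => (b' x * (b x)⁻¹ ^ 5 - a' x * (a x)⁻¹ ^ 5) / 4) (by fun_prop) (by fun_prop)
    (fun x hx => by
      refine HasDerivAt.congr_deriv (((hd (ha x hx) (a0 x)).sub (hd (hb x hx) (b0 x))).div_const 16)
        ?_
      ring)
    (fun x hx => by
      have := a0 x
      have := b0 x
      rw [hg x hx]
      field_simp)
  refine ⟨hmem, ?_⟩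
  rw [hnorm, ← Real.sqrt_mul (by positivity)]
  refine Real.sqrt_le_sqrt ?_
  rw [← intervalIntegral.integral_add ((by fun_prop : Continuous _).intervalIntegrable _ _)
    ((by fun_prop : Continuous _).intervalIntegrable _ _),
    ← intervalIntegral.integral_add ((by fun_prop : Continuous _).intervalIntegrable _ _)
    ((by fun_prop : Continuous _).intervalIntegrable _ _), ← intervalIntegral.integral_const_mul]
  refine intervalIntegral.integral_mono_on hM.le
    ((by fun_prop : Continuous _).intervalIntegrable _ _)
    ((by fun_prop : Continuous _).intervalIntegrable _ _) fun x _ => ?_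
  have hQ : 0 < q₀⁻¹ := inv_pos.2 hq₀
  have hB0 : 0 ≤ B := (abs_nonneg _).trans (hB x)
  set Q := q₀⁻¹
  have e4 : |(a x)⁻¹ ^ 4 - (b x)⁻¹ ^ 4| ≤ 4 * Q ^ 5 * |a x - b x| := by
    exact_mod_cast abs_inv_pow_sub_inv_pow_le hq₀ (la x) (lb x) 4
  have e5 : |(a x)⁻¹ ^ 5 - (b x)⁻¹ ^ 5| ≤ 5 * Q ^ 6 * |a x - b x| := by
    exact_mod_cast abs_inv_pow_sub_inv_pow_le hq₀ (la x) (lb x) 5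
  have ha5 : |(a x)⁻¹ ^ 5| ≤ Q ^ 5 := by
    have := hq₀.trans_le (la x)
    rw [abs_of_pos (by positivity)]
    exact pow_le_pow_left₀ (by positivity) (inv_anti₀ hq₀ (la x)) 5
  have f1 := abs_mul_le_mul_of_abs_le (le_refl |a' x - b' x|) ha5
  have f2 := abs_mul_le_mul_of_abs_le (hB x) e5
  have s1 : ((a x)⁻¹ ^ 4 - (b x)⁻¹ ^ 4) ^ 2 ≤ (4 * Q ^ 5 * |a x - b x|) ^ 2 :=
    sq_le_sq.2 (e4.trans (le_abs_self _))
  have s2 : ((a' x - b' x) * (a x)⁻¹ ^ 5) ^ 2 ≤ (|a' x - b' x| * Q ^ 5) ^ 2 :=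
    sq_le_sq.2 (f1.trans (le_abs_self _))
  have s3 : (b' x * ((a x)⁻¹ ^ 5 - (b x)⁻¹ ^ 5)) ^ 2 ≤ (B * (5 * Q ^ 6 * |a x - b x|)) ^ 2 :=
    sq_le_sq.2 (f2.trans (le_abs_self _))
  simp only [mul_pow, sq_abs] at s1 s2 s3
  have e : b' x * (b x)⁻¹ ^ 5 - a' x * (a x)⁻¹ ^ 5 =
      -((a' x - b' x) * (a x)⁻¹ ^ 5 + b' x * ((a x)⁻¹ ^ 5 - (b x)⁻¹ ^ 5)) := by ring
  have s4 : (b' x * (b x)⁻¹ ^ 5 - a' x * (a x)⁻¹ ^ 5) ^ 2 ≤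
      2 * ((a' x - b' x) ^ 2 * (Q ^ 5) ^ 2) +
        2 * (B ^ 2 * (5 ^ 2 * (Q ^ 6) ^ 2 * (a x - b x) ^ 2)) := by
    rw [e, neg_sq]
    refine (add_sq_le (a := (a' x - b' x) * (a x)⁻¹ ^ 5)).trans ?_
    rw [mul_pow, mul_pow]
    linarith
  have n1 : 0 ≤ (Q ^ 5) ^ 2 * (a x - b x) ^ 2 := by positivity
  have n2 : 0 ≤ (Q ^ 5) ^ 2 * (a' x - b' x) ^ 2 := by positivity
  have n3 : 0 ≤ (B * Q ^ 6) ^ 2 * (a x - b x) ^ 2 := by positivity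
  have n4 : 0 ≤ (B * Q ^ 6) ^ 2 * (a' x - b' x) ^ 2 := by positivity
  -- After division by 16² and 4² the coefficients of Q¹⁰ are 1/16 and 1/8, and that of B²Q¹² is
  -- 50/16 ≤ 4.
  rw [div_pow, div_pow]
  linarith

/-- The boundary conditions are affine, so the shift exchanges exact for noisy data. The norm stays
below R/3 + 2R/3, and the trace drops by at most Cδ ≤ γ, which the margin allows. -/
theorem shift_mem (hM : ε < M) (hT : 0 < T) {C δ γ : ℝ} (hC0 : 0 < C)
    (hC : ∀ q, MemH 5 (OmegaT ε M T) q → ∃ u, IsC3Rep ε M T q u ∧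
      ∀ {i j}, i + j ≤ 3 → ∀ p, |u i j p| ≤ C * normH 5 (OmegaT ε M T) q)
    (hδR : δ < 2 * R / 3) (hδγ : C * δ ≤ γ) {g₀s g₁s g₀d g₁d : ℝ → ℝ} {qs Gs Gd : ℝ × ℝ → ℝ}
    (hqs : qs ∈ openB ε M T (R / 3) ∩ admissible ε M T cbar g₀s g₁s)
    (hγ : ∀ x ∈ Icc ε M, qLower cbar + γ ≤ val ε M T qs x 0)
    (hGs : Gs ∈ admissible ε M T cbar g₀s g₁s) (hGd : Gd ∈ admissible ε M T cbar g₀d g₁d)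
    (hG : normH 5 (OmegaT ε M T) (Gd - Gs) < δ) :
    qs + (Gd - Gs) ∈ closedB ε M T R ∩ admissible ε M T cbar g₀d g₁d := by
  refine ⟨⟨hqs.1.1.add (hGd.1.sub hGs.1), ?_⟩, ?_⟩
  · have := hqs.1.1.normH_add_le isOpen_OmegaT (hGd.1.sub hGs.1)
    linarith [hqs.1.2]
  obtain ⟨u, hu, -⟩ := hC qs hqs.1.1
  obtain ⟨us, hus, -⟩ := hC Gs hGs.1
  obtain ⟨ud, hud, -⟩ := hC Gd hGd.1
  have h1 := (hu.mem_admissible_iff hM hT).1 hqs.2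
  have h2 := (hus.mem_admissible_iff hM hT).1 hGs
  have h3 := (hud.mem_admissible_iff hM hT).1 hGd
  rw [(hu.add (hud.sub hus)).mem_admissible_iff hM hT]
  simp only [Pi.add_apply, Pi.sub_apply]
  refine ⟨fun t ht => ?_, fun t ht => ?_, fun t ht => ?_, fun x hx => ?_⟩
  · linarith [h1.1 t ht, h2.1 t ht, h3.1 t ht]
  · linarith [h1.2.1 t ht, h2.2.1 t ht, h3.2.1 t ht]
  · linarith [h1.2.2.1 t ht, h2.2.2.1 t ht, h3.2.2.1 t ht]
  · have h4 := (abs_le.1 ((hud.sub hus).abs_le hM hT hC (i := 0) (j := 0) (by norm_num) (x, 0))).1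
    simp only [Pi.sub_apply] at h4
    have h5 := hγ x hx
    rw [hu.val_eq hM hT hx ⟨le_rfl, hT.le⟩] at h5
    have h6 := mul_le_mul_of_nonneg_left hG.le hC0.le
    linarith

/-- The value of the functional at a perturbation of an exact solution. -/
theorem funJ_add_le (hε : 0 < ε) (hM : ε < M) (hT : 0 < T) (hα : 0 < α) {q₀ B b d lam β : ℝ}
    (hq₀ : 0 < q₀) (hl : 0 ≤ lam) (hβ : 0 ≤ β) {q g : ℝ × ℝ → ℝ} {u v : ℕ → ℕ → ℝ × ℝ → ℝ}
    (hu : IsC3Rep ε M T q u) (hv : IsC3Rep ε M T g v)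
    (hF : ∀ᵐ p ∂(volume.restrict (OmegaT ε M T)), opF ε M T q p = 0)
    (hb : normH 5 (OmegaT ε M T) (q + g) ≤ b)
    (lu : ∀ x, q₀ ≤ u 0 0 (x, 0)) (luv : ∀ x, q₀ ≤ u 0 0 (x, 0) + v 0 0 (x, 0))
    (bu : ∀ {i j}, i + j ≤ 3 → ∀ p, |u i j p| ≤ B)
    (buv : ∀ {i j}, i + j ≤ 3 → ∀ p, |u i j p + v i j p| ≤ B)
    (bv : ∀ {i j}, i + j ≤ 3 → ∀ p, |v i j p| ≤ d) :
    funJ ε M T lam α β (q + g) ≤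
      ((1 + q₀⁻¹ ^ 2 + 4 * B * q₀⁻¹ ^ 3 + 3 * B ^ 2 * q₀⁻¹ ^ 4) * d) ^ 2 *
        (volume.restrict (OmegaT ε M T)).real univ + β * b ^ 2 := by
  rw [(hu.add hv).funJ_eq hM hT]
  refine add_le_add ((le_abs_self _).trans ?_)
    (mul_le_mul_of_nonneg_left (pow_le_pow_left₀ normH_nonneg hb 2) hβ)
  refine norm_integral_le_of_norm_le_const (G := ℝ) ?_
  filter_upwards [hF, hu.opF_ae_eq hM hT, ae_restrict_OmegaT fun p hp => hp] with p h1 h2 hp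
  rw [h2] at h1
  have d' : ∀ {i j}, i + j ≤ 3 → ∀ p, |u i j p + v i j p - u i j p| ≤ d := fun hij p => by
    rw [add_sub_cancel_left]; exact bv hij p
  -- F vanishes at q, so its value at q + g is a difference of two values of F.
  have key := abs_opC_sub_le hq₀ (luv p.1) (lu p.1) (buv (i := 1) (j := 0) (by norm_num) (p.1, 0))
    (bu (i := 1) (j := 1) (by norm_num) p) (bu (i := 0) (j := 1) (by norm_num) p)
    (bu (i := 1) (j := 0) (by norm_num) (p.1, 0)) (d' (i := 2) (j := 0) (by norm_num) p)
    (d' (i := 1) (j := 1) (by norm_num) p) (d' (i := 0) (j := 1) (by norm_num) p)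
    (d' (i := 0) (j := 0) (by norm_num) (p.1, 0)) (d' (i := 1) (j := 0) (by norm_num) (p.1, 0))
  have e : u 2 0 p - u 1 1 p / (2 * u 0 0 (p.1, 0) ^ 2) +
    u 0 1 p * u 1 0 (p.1, 0) / (2 * u 0 0 (p.1, 0) ^ 3) = 0 := h1
  rw [e, sub_zero] at key
  have hw : Real.exp (-2 * lam * (p.1 + α * p.2)) ≤ 1 := by
    rw [Real.exp_le_one_iff]
    have h3 : 0 ≤ p.1 + α * p.2 :=
      add_nonneg (hε.le.trans hp.1.1.le) (mul_nonneg hα.le hp.2.1.le)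
    have := mul_nonneg hl h3
    linarith
  rw [Real.norm_eq_abs, abs_of_nonneg (by positivity)]
  exact (mul_le_of_le_one_left (sq_nonneg _) hw).trans (sq_le_sq.2 (key.trans (le_abs_self _)))

end Stability

/-- Elements of H⁵ are functions here, so uniqueness means equality almost everywhere. Membership in
H¹ is asserted with each estimate because `weakDeriv` is zero where no weak derivative exists, so a
norm bound alone could be void. -/
theorem theorem5p2 (R T ε cbar α M : ℝ) (hR : 0 < R) (hT : 0 < T) (hε : 0 < ε) (hM : ε < M)
    (hc : 0 < cbar) (hα : 0 < α) (hα' : α < 1 / (2 * √cbar)) (hαT : 2 * M < α * T) :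
    ∃ lam₁ : ℝ, 1 ≤ lam₁ ∧ ∃ C : ℝ, 0 < C ∧ ∀ γ : ℝ, 0 < γ →
      ∃ δ₀ : ℝ, 0 < δ₀ ∧ δ₀ < 2 * R / 3 ∧ lam₁ ≤ Real.log (δ₀ ^ (-2 / (α * T))) ∧
      ∀ δ : ℝ, 0 < δ → δ < δ₀ →
      ∀ (g₀s g₁s g₀d g₁d : ℝ → ℝ) (qs Gs Gd : ℝ × ℝ → ℝ),
        -- the exact solution `q*`
        qs ∈ openB ε M T (R / 3) ∩ admissible ε M T cbar g₀s g₁s →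
        (∀ᵐ p ∂(volume.restrict (OmegaT ε M T)), opF ε M T qs p = 0) →
        (∀ x ∈ Icc ε M, qLower cbar + γ ≤ val ε M T qs x 0) →
        -- the noisy data
        (closedB ε M T (R / 3) ∩ admissible ε M T cbar g₀d g₁d).Nonempty →
        Gs ∈ admissible ε M T cbar g₀s g₁s →
        Gd ∈ admissible ε M T cbar g₀d g₁d →
        normH 5 (OmegaT ε M T) (Gd - Gs) < δ →
        ∀ lam β : ℝ, lam = Real.log (δ ^ (-2 / (α * T))) → β = 2 * Real.exp (-lam * α * T) →
          -- existence and uniqueness of the minimizer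
          (∃ q, IsMinimizer (funJ ε M T lam α β)
            (closedB ε M T R ∩ admissible ε M T cbar g₀d g₁d) q) ∧
          (∀ q q', IsMinimizer (funJ ε M T lam α β)
              (closedB ε M T R ∩ admissible ε M T cbar g₀d g₁d) q →
            IsMinimizer (funJ ε M T lam α β)
              (closedB ε M T R ∩ admissible ε M T cbar g₀d g₁d) q' →
            q =ᵐ[volume.restrict (OmegaT ε M T)] q') ∧
          -- the stability estimates
          ∀ q, IsMinimizer (funJ ε M T lam α β)
              (closedB ε M T R ∩ admissible ε M T cbar g₀d g₁d) q →
            (∀ T₀ ρ₁ : ℝ, 0 < T₀ → T₀ < T → 2 * M + 2 * α * T₀ < α * T →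
              ρ₁ = (α * T - 2 * (M + α * T₀)) / (α * T) →
                (0 < ρ₁ ∧ ρ₁ < 1) ∧
                MemH 1 (OmegaT ε M T₀) (qs - q) ∧
                normH 1 (OmegaT ε M T₀) (qs - q) ≤ C * δ ^ ρ₁) ∧
            (∀ ρ₂ : ℝ, ρ₂ = (α * T - 2 * M) / (α * T) →
                (0 < ρ₂ ∧ ρ₂ < 1) ∧
                MemH1D 1 (Ioo ε M) (fun x => val ε M T qs x 0 - val ε M T q x 0) ∧
                normH1D 1 (Ioo ε M) (fun x => val ε M T qs x 0 - val ε M T q x 0) ≤ C * δ ^ ρ₂ ∧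
                MemH1D 1 (Ioo ε M) (fun x => coeff ε M T qs x - coeff ε M T q x) ∧
                normH1D 1 (Ioo ε M) (fun x => coeff ε M T qs x - coeff ε M T q x)
                  ≤ C * δ ^ ρ₂) := by
  have hs : 0 < α * T := mul_pos hα hT
  have hq₀ := qLower_pos hc
  obtain ⟨C, hC0, hC⟩ := exists_isC3Rep hM hT
  obtain ⟨lam₁, hlam₁, c₀, hc₀, hconv⟩ := funJ_midpoint_convex hε hM hT hα hc hα' hR
  obtain ⟨A, hA⟩ : ∃ A, A = (volume.restrict (OmegaT ε M T)).real univ := ⟨_, rfl⟩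
  have hA0 : 0 ≤ A := by rw [hA]; positivity
  obtain ⟨B, hB⟩ : ∃ B, B = C * R := ⟨_, rfl⟩
  have hB0 : 0 < B := by rw [hB]; positivity
  obtain ⟨KF, hKF⟩ : ∃ KF, KF = 1 + (qLower cbar)⁻¹ ^ 2 + 4 * B * (qLower cbar)⁻¹ ^ 3 +
    3 * B ^ 2 * (qLower cbar)⁻¹ ^ 4 := ⟨_, rfl⟩
  -- At the shifted solution J is at most (KF C δ)² A + βR² with β = 2δ²; dividing by c₀ gives the
  -- energy bound E δ².
  obtain ⟨E, hE⟩ : ∃ E, E = ((KF * C) ^ 2 * A + 2 * R ^ 2) / c₀ := ⟨_, rfl⟩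
  have hE0 : 0 < E := by rw [hE]; positivity
  obtain ⟨K₁, hK₁⟩ : ∃ K₁, K₁ = 8 * E + 6 * C ^ 2 * A := ⟨_, rfl⟩
  obtain ⟨K₂, hK₂⟩ : ∃ K₂, K₂ = 8 * E + 4 * C ^ 2 * (M - ε) := ⟨_, rfl⟩
  obtain ⟨L, hL⟩ : ∃ L, L = √(((qLower cbar)⁻¹ ^ 5) ^ 2 + 4 * (B * (qLower cbar)⁻¹ ^ 6) ^ 2) :=
    ⟨_, rfl⟩
  have hL0 : 0 ≤ L := by rw [hL]; positivity
  refine ⟨lam₁, hlam₁, √K₁ + √K₂ + L * √K₂ + 1, by positivity, fun γ hγ => ?_⟩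
  -- In this order: the shift stays in the ball, the margin γ survives, δ < 1 so that smaller
  -- exponents give larger powers, and λ reaches the convexity threshold.
  refine ⟨min (R / 3) (min (γ / C) (min (1 / 2) (Real.exp (-(lam₁ * (α * T) / 2))))), by positivity,
    (min_le_left _ _).trans_lt (by linarith), le_log_rpow_of_le_exp hs (by positivity)
      ((min_le_right _ _).trans ((min_le_right _ _).trans (min_le_right _ _))), ?_⟩
  intro δ hδ hδ₀ g₀s g₁s g₀d g₁d qs Gs Gd hqs hF hqγ hne hGs hGd hG lam β hlam hβ
  simp only [lt_min_iff] at hδ₀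
  obtain ⟨hδR, hδγ, hδ1, hδlam⟩ := hδ₀
  rw [lt_div_iff₀ hC0] at hδγ
  have hlam_ge : lam₁ ≤ lam := by rw [hlam]; exact le_log_rpow_of_le_exp hs hδ hδlam.le
  have hl0 : 0 ≤ lam := by linarith
  have hβδ : β = 2 * δ ^ 2 := by
    rw [hβ, ← exp_neg_mul_eq_sq hs hδ hlam, show -lam * α * T = -(lam * (α * T)) by ring]
  have hβ0 : 0 < β := by rw [hβδ]; positivity
  have hconv' : ∀ q ∈ closedB ε M T R ∩ admissible ε M T cbar g₀d g₁d,
      ∀ q' ∈ closedB ε M T R ∩ admissible ε M T cbar g₀d g₁d,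
      β * normH 5 (OmegaT ε M T) ((1 / 2 : ℝ) • (q - q')) ^ 2 ≤
        funJ ε M T lam α β q + funJ ε M T lam α β q' -
          2 * funJ ε M T lam α β ((1 / 2 : ℝ) • (q + q')) := by
    intro q hq q' hq'
    obtain ⟨u, hu, -⟩ := hC _ ((hq.1.1.sub hq'.1.1).const_smul (1 / 2))
    have := hconv lam hlam_ge g₀d g₁d q hq q' hq' u hu β hβ
    have := mul_nonneg hc₀.le (weightedEnergy_nonneg (T := T) (α := α) (lam := lam) (h := u) hM)
    linarith
  have hne' : (closedB ε M T R ∩ admissible ε M T cbar g₀d g₁d).Nonempty :=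
    hne.mono (inter_subset_inter_left _ fun q hq => ⟨hq.1, hq.2.trans (by linarith)⟩)
  refine ⟨exists_isMinimizer_funJ hM hT hc hβ0 hne' hconv',
    fun q q' hq hq' => hq.ae_eq hM hT hβ0 hconv' hq', fun q hq => ?_⟩
  -- the perturbed exact solution
  have hmem := shift_mem hM hT hC0 hC (by linarith) (by linarith : C * δ ≤ γ) hqs hqγ hGs hGd hG
  obtain ⟨us, hus, bus⟩ := hC qs hqs.1.1
  obtain ⟨v, hv, bv⟩ := hC _ (hGd.1.sub hGs.1)
  obtain ⟨uq, huq, buq⟩ := hC q hq.1.1.1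
  have hAs := (hus.mem_admissible_iff hM hT).1 hqs.2
  have hAq := (huq.mem_admissible_iff hM hT).1 hq.1.2
  have hAp := ((hus.add hv).mem_admissible_iff hM hT).1 hmem.2
  have ls := hus.toIsC3.le_apply_zero hM hT hAs.2.2.2
  have lq := huq.toIsC3.le_apply_zero hM hT hAq.2.2.2
  have bs : ∀ {i j}, i + j ≤ 3 → ∀ p, |us i j p| ≤ B := fun hij p => by
    rw [hB]
    exact (bus hij p).trans (mul_le_mul_of_nonneg_left (by linarith [hqs.1.2]) hC0.le)
  have bq : ∀ {i j}, i + j ≤ 3 → ∀ p, |uq i j p| ≤ B := fun hij p => by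
    rw [hB]
    exact (buq hij p).trans (mul_le_mul_of_nonneg_left hq.1.1.2 hC0.le)
  have bp : ∀ {i j}, i + j ≤ 3 → ∀ p, |us i j p + v i j p| ≤ B := fun hij p => by
    rw [hB]
    exact ((hus.add hv).abs_le hM hT hC hij p).trans
      (mul_le_mul_of_nonneg_left hmem.1.2 hC0.le)
  have bv' : ∀ {i j}, i + j ≤ 3 → ∀ p, |v i j p| ≤ C * δ := fun hij p =>
    (bv hij p).trans (mul_le_mul_of_nonneg_left hG.le hC0.le)
  have hJ := funJ_add_le hε hM hT hα hq₀ hl0 hβ0.le hus hv hF hmem.1.2 ls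
    ((hus.add hv).toIsC3.le_apply_zero hM hT hAp.2.2.2) bs bp bv'
  rw [← hKF, ← hA] at hJ
  -- the energy of the difference
  have hh := ((hus.add hv).sub huq).const_smul (1 / 2)
  obtain ⟨uh, huh⟩ : ∃ uh : ℕ → ℕ → ℝ × ℝ → ℝ,
    uh = fun i j => (1 / 2 : ℝ) • (us i j + v i j - uq i j) := ⟨_, rfl⟩
  rw [← huh] at hh
  -- The gap J(p) + J(q_min) - 2 J(mid) is at most J(p), because J(q_min) ≤ J(mid) and J(mid) ≥ 0.
  have henergy : weightedEnergy ε M T lam α uh ≤ E * δ ^ 2 := by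
    have h1 := hconv lam hlam_ge g₀d g₁d _ hmem _ hq.1 uh hh β hβ
    have h2 := isMinOn_iff.1 hq.2 _ (⟨midpoint_mem_closedB hmem.1 hq.1.1,
      midpoint_mem_admissible hM hT hmem.2 hq.1.2⟩ :
        (1 / 2 : ℝ) • (qs + (Gd - Gs) + q) ∈ closedB ε M T R ∩ admissible ε M T cbar g₀d g₁d)
    have h3 := funJ_nonneg (ε := ε) (M := M) (T := T) (lam := lam) (α := α) hβ0.le
      ((1 / 2 : ℝ) • (qs + (Gd - Gs) + q))
    have h4 := mul_nonneg hβ0.le (sq_nonneg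
      (normH 5 (OmegaT ε M T) ((1 / 2 : ℝ) • (qs + (Gd - Gs) - q))))
    rw [hE, div_mul_eq_mul_div, le_div_iff₀ hc₀]
    rw [hβδ] at hJ h1 h2 h3 h4
    linarith
  have hdiff : ∀ {i j}, i + j ≤ 3 → ∀ p, |us i j p - uq i j p - 2 * uh i j p| ≤ C * δ := by
    intro i j hij p
    have e : us i j p - uq i j p - 2 * uh i j p = -v i j p := by
      rw [huh]
      simp only [Pi.smul_apply, Pi.sub_apply, Pi.add_apply, smul_eq_mul]
      ring
    rw [e, abs_neg]
    exact bv' hij p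
  have hd := hus.sub huq
  have cd : ∀ {i j}, i + j ≤ 3 → Continuous fun p => us i j p - uq i j p := hd.continuous
  -- The shift contributes O(δ) to the distance, which is no worse than δ^ρ.
  have hδρ : ∀ ρ : ℝ, ρ < 1 → δ ^ 2 ≤ (δ ^ ρ) ^ 2 := fun ρ hρ => by
    refine pow_le_pow_left₀ hδ.le ?_ 2
    calc δ = δ ^ (1 : ℝ) := (Real.rpow_one δ).symm
      _ ≤ δ ^ ρ := Real.rpow_le_rpow_of_exponent_ge hδ (by linarith) hρ.le
  refine ⟨fun T₀ ρ₁ hT₀ hT₀T hαT₀ hρ => ?_, fun ρ₂ hρ => ?_⟩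
  · have hρ' : 0 < ρ₁ ∧ ρ₁ < 1 := by
      have : 0 < α * T₀ := mul_pos hα hT₀
      rw [hρ, div_lt_one hs]
      exact ⟨div_pos (by linarith) hs, by linarith⟩
    obtain ⟨hmem1, hnorm⟩ := hd.memH_one_of_le hT₀T.le
    refine ⟨hρ', hmem1, ?_⟩
    have h1 := le_mul_rpow_sq hs hδ hlam hρ
      ((exp_mul_setIntegral_le_weightedEnergy hM hT₀T.le hl0 hα hh.toIsC3).trans henergy)
    have i1 := setIntegral_OmegaT_sq_le (ε := ε) (M := M) hT₀T.le
      (cd (i := 0) (j := 0) (by norm_num)) (hh.continuous (by norm_num)) (hdiff (by norm_num))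
    have i2 := setIntegral_OmegaT_sq_le (ε := ε) (M := M) hT₀T.le
      (cd (i := 1) (j := 0) (by norm_num)) (hh.continuous (by norm_num)) (hdiff (by norm_num))
    have i3 := setIntegral_OmegaT_sq_le (ε := ε) (M := M) hT₀T.le
      (cd (i := 0) (j := 1) (by norm_num)) (hh.continuous (by norm_num)) (hdiff (by norm_num))
    rw [← hA] at i1 i2 i3
    have h2 := mul_le_mul_of_nonneg_left (hδρ ρ₁ hρ'.2) (by positivity : 0 ≤ 6 * C ^ 2 * A)
    rw [hnorm]
    simp only [Pi.sub_apply]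
    refine (sqrt_le_mul_rpow (K := K₁) hδ (ρ := ρ₁) ?_).trans
      (mul_le_mul_of_nonneg_right ?_ (Real.rpow_pos_of_pos hδ _).le)
    · rw [hK₁]
      linarith
    · linarith [Real.sqrt_nonneg K₂, mul_nonneg hL0 (Real.sqrt_nonneg K₂)]
  · have hρ' : 0 < ρ₂ ∧ ρ₂ < 1 := by
      rw [hρ, div_lt_one hs]
      exact ⟨div_pos (by linarith) hs, by linarith⟩
    have ht0 : (0 : ℝ) ∈ Icc 0 T := ⟨le_rfl, hT.le⟩
    have s00 := hus.continuous (i := 0) (j := 0) (by norm_num)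
    have s10 := hus.continuous (i := 1) (j := 0) (by norm_num)
    have q00 := huq.continuous (i := 0) (j := 0) (by norm_num)
    have q10 := huq.continuous (i := 1) (j := 0) (by norm_num)
    have h00 := hh.continuous (i := 0) (j := 0) (by norm_num)
    have h10 := hh.continuous (i := 1) (j := 0) (by norm_num)
    have h1 := le_mul_rpow_sq hs hδ hlam hρ
      ((exp_mul_intervalIntegral_le_weightedEnergy hM hl0 hh.toIsC3).trans henergy)
    have i1 := intervalIntegral_sq_le hM (f := fun x => us 0 0 (x, 0) - uq 0 0 (x, 0))
      (h := fun x => uh 0 0 (x, 0)) (by fun_prop) (by fun_prop)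
      (fun x => hdiff (by norm_num) (x, 0))
    have i2 := intervalIntegral_sq_le hM (f := fun x => us 1 0 (x, 0) - uq 1 0 (x, 0))
      (h := fun x => uh 1 0 (x, 0)) (by fun_prop) (by fun_prop)
      (fun x => hdiff (by norm_num) (x, 0))
    have h2 := mul_le_mul_of_nonneg_left (hδρ ρ₂ hρ'.2)
      (mul_nonneg (by positivity) (sub_pos.2 hM).le : 0 ≤ 4 * C ^ 2 * (M - ε))
    have h3 : √((∫ x in ε..M, (us 0 0 (x, 0) - uq 0 0 (x, 0)) ^ 2) +
        ∫ x in ε..M, (us 1 0 (x, 0) - uq 1 0 (x, 0)) ^ 2) ≤ √K₂ * δ ^ ρ₂ := by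
      refine sqrt_le_mul_rpow hδ ?_
      rw [hK₂]
      linarith
    have ds := fun x (hx : x ∈ Ioo ε M) =>
      hus.hasDerivAt_x (i := 0) (j := 0) (by norm_num) hx ht0
    have dq := fun x (hx : x ∈ Ioo ε M) =>
      huq.hasDerivAt_x (i := 0) (j := 0) (by norm_num) hx ht0
    have vs := fun x (hx : x ∈ Ioo ε M) => hus.val_eq hM hT (Ioo_subset_Icc_self hx) ht0
    have vq := fun x (hx : x ∈ Ioo ε M) => huq.val_eq hM hT (Ioo_subset_Icc_self hx) ht0
    obtain ⟨m1, n1⟩ := memH1D_one_of_hasDerivAt hM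
      (f := fun x => us 0 0 (x, 0) - uq 0 0 (x, 0))
      (f' := fun x => us 1 0 (x, 0) - uq 1 0 (x, 0))
      (g := fun x => val ε M T qs x 0 - val ε M T q x 0) (by fun_prop) (by fun_prop)
      (fun x hx => (ds x hx).sub (dq x hx)) (fun x hx => by rw [vs x hx, vq x hx])
    obtain ⟨m2, n2⟩ := normH1D_inv_pow_four_sub_le hM hq₀
      (g := fun x => coeff ε M T qs x - coeff ε M T q x)
      (a' := fun x => us 1 0 (x, 0)) (b' := fun x => uq 1 0 (x, 0)) (B := B)
      (by fun_prop) (by fun_prop) (by fun_prop) (by fun_prop) ds dq ls lq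
      (fun x => bq (by norm_num) (x, 0)) (fun x hx => by rw [coeff, coeff, vs x hx, vq x hx])
    rw [← hL] at n2
    have hpos := (Real.rpow_pos_of_pos hδ ρ₂).le
    refine ⟨hρ', m1, ?_, m2, ?_⟩
    · rw [n1]
      refine h3.trans (mul_le_mul_of_nonneg_right ?_ hpos)
      linarith [Real.sqrt_nonneg K₁, mul_nonneg hL0 (Real.sqrt_nonneg K₂)]
    · refine n2.trans ((mul_le_mul_of_nonneg_left h3 hL0).trans ?_)
      rw [← mul_assoc]
      refine mul_le_mul_of_nonneg_right ?_ hpos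
      linarith [Real.sqrt_nonneg K₁, Real.sqrt_nonneg K₂]
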